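/- Fix integers $m,l,n\ge 0$. All vector spaces are over $\mathbb C$. **The Yangian.** $\mathrm Y(\mathfrak{gl}_n)$ is the unital associative algebra with generators $T_{ij}^{(s)}$ ($s\ge1$, $1\le i,j\le n$) and, for $T_{ij}(u)=\delta_{ij}+\sum_{s\ge1}T_{ij}^{(s)}u^{-s}$, the defining relations $$(u-v)\,[T_{ij}(u),T_{kh}(v)]=T_{kj}(u)\,T_{ih}(v)-T_{kj}(v)\,T_{ih}(u).$$ Its comultiplication is $\Delta:T_{ij}(u)\mapsto\sum_{k=1}^nT_{ik}(u)\otimes T_{kj}(u)$, which defines the action on tensor products of modules. For $z\in\mathbb C$ let $\tau_z$ be the automorphism $T_{ij}(u)\mapsto T_{ij}(u-z)$, re-expanded in $u^{-1}$. **The bimodules $\mathcal E_m(V)$.** Let $\Lambda(\mathbb C^m\otimes\mathbb C^n)$ be the Grassmann algebra on anticommuting variables $x_{ai}$ ($1\le a\le m$, $1\le i\le n$), and let $\partial_{ai}$ be the left derivation with respect to $x_{ai}$. For a $\mathfrak{gl}_m$-module $V$ put $\mathcal E_m(V)=V\otimes\Lambda(\mathbb C^m\otimes\mathbb C^n)$.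 The matrix unit $E_{ab}\in\mathfrak{gl}_m$ acts on it as $E_{ab}\otimes1+\sum_{k=1}^n1\otimes x_{ak}\partial_{bk}$, and for $s\ge0$ the generator $T_{ij}^{(s+1)}$ acts as $$\sum_{c_0,c_1,\dots,c_s=1}^mE_{c_1c_0}E_{c_2c_1}\cdots E_{c_sc_{s-1}}\otimes x_{c_0i}\,\partial_{c_sj}$$ (for $s=0$ the first tensor factor is $1$). This defines commuting actions of $\mathfrak{gl}_m$ and $\mathrm Y(\mathfrak{gl}_n)$. For $z\in\mathbb C$ let $\mathcal E_m^z(V)$ be the same $\mathfrak{gl}_m$-module, with the action of $\mathrm Y(\mathfrak{gl}_n)$ pulled back through $\tau_{-z}$. **Parabolic induction.** Regard $\mathfrak{gl}_m\oplus\mathfrak{gl}_l\subset\mathfrak{gl}_{m+l}$ as the block diagonal matrices for $\mathbb C^{m+l}=\mathbb C^m\oplus\mathbb C^l$. Let $\mathfrak q$ and $\mathfrak q'$ be spanned by the matrix units $E_{ba}$, respectively $E_{ab}$, with $a\le m<b$, and let $\mathfrak p=\mathfrak{gl}_m\oplus\mathfrak{gl}_l\oplus\mathfrak q'$. For a $\mathfrak{gl}_m$-module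 $V$ and a $\mathfrak{gl}_l$-module $U$ let $V\boxtimes U=\mathrm U(\mathfrak{gl}_{m+l})\otimes_{\mathrm U(\mathfrak p)}(V\otimes U)$, where $\mathfrak q'$ acts on $V\otimes U$ as zero. **Theorem.** Let $V$ be any $\mathfrak{gl}_m$-module and $U$ any $\mathfrak{gl}_l$-module. The space of $\mathfrak q$-coinvariants $$\mathcal E_{m+l}(V\boxtimes U)_{\mathfrak q}=\mathcal E_{m+l}(V\boxtimes U)\,/\,\mathfrak q\cdot\mathcal E_{m+l}(V\boxtimes U)$$ carries the induced actions of $\mathrm Y(\mathfrak{gl}_n)$ and of $\mathfrak{gl}_m\oplus\mathfrak{gl}_l$. As a bimodule over $\mathrm Y(\mathfrak{gl}_n)$ and $\mathfrak{gl}_m\oplus\mathfrak{gl}_l$ it is isomorphic to the tensor product $\mathcal E_m(V)\otimes\mathcal E_l^{m}(U)$, on which $\mathrm Y(\mathfrak{gl}_n)$ acts through $\Delta$, and $\mathfrak{gl}_m$ and $\mathfrak{gl}_l$ act on the first and on the second factor respectively. -/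

import Mathlib

open scoped TensorProduct

attribute [local instance] LieRing.ofAssociativeRing

namespace YangInd

/-! ### The Yangian -/

/-- The formal generators in the free algebra: the letter `(s, i, j)` stands for the generator
`T_{ij}^{(s+1)}`, and `T_{ij}^{(0)} = δ_{ij}`. -/
def freeT (n : ℕ) : ℕ → Fin n → Fin n → FreeAlgebra ℂ (ℕ × Fin n × Fin n)
  | 0, i, j => if i = j then 1 else 0
  | s + 1, i, j => FreeAlgebra.ι ℂ (s, i, j)

/-- The defining relations
`(u - v) [T_{ij}(u), T_{kl}(v)] = T_{kj}(u) T_{il}(v) - T_{kj}(v) T_{il}(u)`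
of the Yangian: this is the comparison of the coefficients at `u ^ (-r) v ^ (-s)`. -/
inductive YRel (n : ℕ) :
    FreeAlgebra ℂ (ℕ × Fin n × Fin n) → FreeAlgebra ℂ (ℕ × Fin n × Fin n) → Prop
  | mk (r s : ℕ) (i j k l : Fin n) : YRel n
      ((freeT n (r + 1) i j * freeT n s k l - freeT n s k l * freeT n (r + 1) i j)
        - (freeT n r i j * freeT n (s + 1) k l - freeT n (s + 1) k l * freeT n r i j))
      (freeT n r k j * freeT n s i l - freeT n s k j * freeT n r i l)

/-- The Yangian `Y(gl_n)`. -/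
def Yangian (n : ℕ) : Type := RingQuot (YRel n)

noncomputable instance (n : ℕ) : Ring (Yangian n) := inferInstanceAs (Ring (RingQuot (YRel n)))

noncomputable instance (n : ℕ) : Algebra ℂ (Yangian n) :=
  inferInstanceAs (Algebra ℂ (RingQuot (YRel n)))

/-- The element `T_{ij}^{(s)}` of the Yangian, where `T_{ij}^{(0)} = δ_{ij}`. -/
noncomputable def yT (n s : ℕ) (i j : Fin n) : Yangian n :=
  RingQuot.mkAlgHom ℂ (YRel n) (freeT n s i j)

/-- A family of elements of a ring that satisfies the defining relations of the Yangian. -/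
structure IsYangFamily {R : Type*} [Ring R] {n : ℕ} (t : ℕ → Fin n → Fin n → R) : Prop where
  zero : ∀ i j, t 0 i j = if i = j then 1 else 0
  rel : ∀ (r s : ℕ) (i j k l : Fin n),
    (t (r + 1) i j * t s k l - t s k l * t (r + 1) i j)
      - (t r i j * t (s + 1) k l - t (s + 1) k l * t r i j)
      = t r k j * t s i l - t s k j * t r i l

theorem yT_family (n : ℕ) : IsYangFamily (yT n) where
  zero i j := by
    unfold yT
    rw [freeT]
    split_ifs
    · exact map_one _
    · exact map_zero _
  rel r s i j k l := by
    have h := RingQuot.mkAlgHom_rel ℂ (YRel.mk (n := n) r s i j k l)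
    simp only [map_sub, map_mul] at h
    exact h

theorem IsYangFamily.map {R S : Type*} [Ring R] [Ring S] {n : ℕ} {t : ℕ → Fin n → Fin n → R}
    (ht : IsYangFamily t) (f : R →+* S) : IsYangFamily fun s i j => f (t s i j) where
  zero i j := by rw [ht.zero]; split_ifs <;> simp
  rel r s i j k l := by
    simpa only [map_sub, map_mul] using congrArg f (ht.rel r s i j k l)

section lift

variable {R : Type*} [Ring R] [Algebra ℂ R] {n : ℕ} {t : ℕ → Fin n → Fin n → R}

theorem freeLift_freeT (ht : IsYangFamily t) (s : ℕ) (i j : Fin n) :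
    FreeAlgebra.lift ℂ (fun g : ℕ × Fin n × Fin n => t (g.1 + 1) g.2.1 g.2.2) (freeT n s i j)
      = t s i j := by
  cases s with
  | zero => rw [ht.zero, freeT]; split_ifs <;> simp
  | succ s => simp [freeT]

/-- The homomorphism from the Yangian determined by the images of its generators. -/
noncomputable def yLift (ht : IsYangFamily t) : Yangian n →ₐ[ℂ] R :=
  RingQuot.liftAlgHom ℂ
    ⟨FreeAlgebra.lift ℂ (fun g : ℕ × Fin n × Fin n => t (g.1 + 1) g.2.1 g.2.2), by
      rintro _ _ ⟨r, s, i, j, k, l⟩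
      simp only [map_sub, map_mul, freeLift_freeT ht]
      exact ht.rel r s i j k l⟩

theorem yLift_yT (ht : IsYangFamily t) (s : ℕ) (i j : Fin n) :
    yLift ht (yT n s i j) = t s i j := by
  unfold yLift yT
  erw [RingQuot.liftAlgHom_mkAlgHom_apply]
  exact freeLift_freeT ht s i j

/-- Two homomorphisms from the Yangian that agree on the generators are equal. -/
theorem yHom_ext {f g : Yangian n →ₐ[ℂ] R}
    (h : ∀ s i j, f (yT n (s + 1) i j) = g (yT n (s + 1) i j)) : f = g := by
  refine RingQuot.ringQuot_ext' ℂ f g ?_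
  refine FreeAlgebra.hom_ext ?_
  funext ⟨s, i, j⟩
  exact h s i j

theorem yHom_commute (f : Yangian n →ₐ[ℂ] R) {z : R}
    (h : ∀ s i j, f (yT n (s + 1) i j) * z = z * f (yT n (s + 1) i j)) (y : Yangian n) :
    f y * z = z * f y := by
  obtain ⟨w, rfl⟩ := RingQuot.mkAlgHom_surjective ℂ (YRel n) y
  let φ : FreeAlgebra ℂ (ℕ × Fin n × Fin n) →ₐ[ℂ] R :=
    AlgHom.comp (B := Yangian n) f (RingQuot.mkAlgHom ℂ (YRel n))
  change φ w * z = z * φ w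
  induction w using FreeAlgebra.induction with
  | grade0 c => rw [AlgHom.commutes, Algebra.commutes]
  | grade1 g => exact h g.1 g.2.1 g.2.2
  | mul a b ha hb => rw [map_mul, mul_assoc, hb, ← mul_assoc, ha, mul_assoc]
  | add a b ha hb => rw [map_add, add_mul, mul_add, ha, hb]

end lift

/-! ### The automorphisms `τ_z` -/

section shift

variable {R : Type*} [Ring R] [Algebra ℂ R] {n : ℕ}

/-- The coefficients of `T_{ij}(u - z)`: since
`(u - z) ^ (-(r+1)) = ∑_{s ≥ r} (s choose r) z ^ (s - r) u ^ (-(s+1))`, the coefficient of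
`T_{ij}(u - z)` at `u ^ (-(s+1))` is `∑_{r ≤ s} (s choose r) z ^ (s - r) T_{ij}^{(r+1)}`. -/
noncomputable def shiftT (t : ℕ → Fin n → Fin n → R) (z : ℂ) : ℕ → Fin n → Fin n → R
  | 0, i, j => t 0 i j
  | s + 1, i, j => ∑ r ∈ Finset.range (s + 1), (z ^ (s - r) * (s.choose r : ℂ)) • t (r + 1) i j

/-- The linear map sending a polynomial `f` to the residue of `f(u) T_{ij}(u)`. -/
noncomputable def resT (t : ℕ → Fin n → Fin n → R) (i j : Fin n) : Polynomial ℂ →ₗ[ℂ] R :=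
  Polynomial.lsum fun r => LinearMap.toSpanSingleton ℂ R (t (r + 1) i j)

theorem resT_monomial (t : ℕ → Fin n → Fin n → R) (i j : Fin n) (r : ℕ) (a : ℂ) :
    resT t i j (Polynomial.monomial r a) = a • t (r + 1) i j := by
  rw [resT, Polynomial.lsum_apply, Polynomial.sum_monomial_index] <;> simp

theorem resT_X_pow (t : ℕ → Fin n → Fin n → R) (i j : Fin n) (r : ℕ) :
    resT t i j (Polynomial.X ^ r) = t (r + 1) i j := by
  rw [← Polynomial.monomial_one_right_eq_X_pow, resT_monomial, one_smul]

theorem shiftT_succ (t : ℕ → Fin n → Fin n → R) (z : ℂ) (s : ℕ) (i j : Fin n) :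
    shiftT t z (s + 1) i j = resT t i j ((Polynomial.X + Polynomial.C z) ^ s) := by
  rw [shiftT, add_pow, map_sum]
  refine Finset.sum_congr rfl fun r _ => ?_
  rw [← resT_X_pow t i j r, ← map_smul]
  congr 1
  rw [Polynomial.smul_eq_C_mul]
  simp only [map_mul, map_pow, map_natCast]
  ring

variable {t : ℕ → Fin n → Fin n → R}

theorem resT_rel (ht : IsYangFamily t) (i j k l : Fin n) (f g : Polynomial ℂ) :
    (resT t i j (f * Polynomial.X) * resT t k l g - resT t k l g * resT t i j (f * Polynomial.X))
      - (resT t i j f * resT t k l (g * Polynomial.X)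
        - resT t k l (g * Polynomial.X) * resT t i j f)
      = resT t k j f * resT t i l g - resT t k j g * resT t i l f := by
  induction f using Polynomial.induction_on' with
  | add p q hp hq =>
    rw [← sub_eq_zero] at hp hq ⊢
    have h := congrArg₂ (· + ·) hp hq
    simp only [add_zero] at h
    rw [← h]
    simp only [map_add, add_mul, mul_add]
    abel
  | monomial r a =>
    induction g using Polynomial.induction_on' with
    | add p q hp hq =>
      rw [← sub_eq_zero] at hp hq ⊢
      have h := congrArg₂ (· + ·) hp hq
      simp only [add_zero] at h
      rw [← h]
      simp only [map_add, add_mul, mul_add]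
      abel
    | monomial s b =>
      simp only [Polynomial.monomial_mul_X, resT_monomial, smul_mul_smul_comm]
      rw [mul_comm b a, ← smul_sub, ← smul_sub, ← smul_sub, ← smul_sub, ht.rel]

theorem resT_rel_zero (ht : IsYangFamily t) (i j k l : Fin n) (g : Polynomial ℂ) :
    t 1 i j * resT t k l g - resT t k l g * t 1 i j
      = t 0 k j * resT t i l g - resT t k j g * t 0 i l := by
  induction g using Polynomial.induction_on' with
  | add p q hp hq =>
    rw [← sub_eq_zero] at hp hq ⊢
    have h := congrArg₂ (· + ·) hp hq
    simp only [add_zero] at h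
    rw [← h]
    simp only [map_add, add_mul, mul_add]
    abel
  | monomial s b =>
    have h := ht.rel 0 (s + 1) i j k l
    have h0 : t 0 i j * t (s + 1 + 1) k l - t (s + 1 + 1) k l * t 0 i j = 0 := by
      rw [ht.zero]; split_ifs <;> simp
    rw [h0, sub_zero, zero_add] at h
    simp only [resT_monomial, mul_smul_comm, smul_mul_assoc]
    rw [← smul_sub, ← smul_sub, h]

/-- Re-expansion of `T_{ij}(u - z)` preserves the defining relations of the Yangian. -/
theorem shiftT_family (ht : IsYangFamily t) (z : ℂ) : IsYangFamily (shiftT t z) where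
  zero := ht.zero
  rel r s i j k l := by
    have h1 : ∀ i j, shiftT t z 1 i j = t 1 i j := fun i j => by simp [shiftT]
    have h00 : ∀ i j, shiftT t z 0 i j = t 0 i j := fun i j => rfl
    have hc : ∀ i j (y : R), t 0 i j * y = y * t 0 i j := fun i j y => by
      rw [ht.zero]; split_ifs <;> simp
    cases r with
    | zero =>
      cases s with
      | zero =>
        simp only [zero_add, h1, h00]
        rw [hc k l, hc i j, sub_self, sub_self, sub_self, sub_self]
      | succ s =>
        simp only [zero_add, h1, h00, shiftT_succ]
        rw [hc i j, sub_self, sub_zero]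
        exact resT_rel_zero ht i j k l _
    | succ r =>
      cases s with
      | zero =>
        simp only [zero_add, h1, h00, shiftT_succ]
        rw [hc k l, sub_self, zero_sub, neg_sub, resT_rel_zero ht, hc i l, hc k j]
      | succ s =>
        have h := resT_rel ht i j k l ((Polynomial.X + Polynomial.C z) ^ r)
          ((Polynomial.X + Polynomial.C z) ^ s)
        have hz : ∀ (i j : Fin n) (q : ℕ),
            resT t i j ((Polynomial.X + Polynomial.C z) ^ (q + 1))
              = resT t i j ((Polynomial.X + Polynomial.C z) ^ q * Polynomial.X)
                + z • resT t i j ((Polynomial.X + Polynomial.C z) ^ q) := fun i j q => by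
          rw [← map_smul, ← map_add, Polynomial.smul_eq_C_mul]
          congr 1
          ring
        simp only [shiftT_succ]
        rw [← h, hz i j r, hz k l s]
        simp only [add_mul, mul_add, mul_smul_comm, smul_mul_assoc]
        abel

end shift

/-- The automorphism `τ_z` of the Yangian, `T_{ij}(u) ↦ T_{ij}(u - z)`, as an endomorphism. -/
noncomputable def yShift (n : ℕ) (z : ℂ) : Yangian n →ₐ[ℂ] Yangian n :=
  yLift (shiftT_family (yT_family n) z)

/-! ### The comultiplication -/

section comul

open Finset.HasAntidiagonal in
/-- The coefficient of `u ^ (-s)` in `∑_k t_{ik}(u) t'_{kj}(u)`. -/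
def convT {R : Type*} [Ring R] {n : ℕ} (t t' : ℕ → Fin n → Fin n → R) (s : ℕ) (i j : Fin n) : R :=
  ∑ k, ∑ p ∈ antidiagonal s, t p.1 i k * t' p.2 k j

variable {R : Type*} [Ring R] {n : ℕ}

/-- A sequence as the coefficients of a series in the first of two central variables. -/
noncomputable def ser₁ (a : ℕ → R) : PowerSeries (PowerSeries R) :=
  PowerSeries.C (PowerSeries.mk a)

/-- A sequence as the coefficients of a series in the second of two central variables. -/
noncomputable def ser₂ (a : ℕ → R) : PowerSeries (PowerSeries R) :=
  PowerSeries.map PowerSeries.C (PowerSeries.mk a)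

theorem coeff_ser₁₂ (a b : ℕ → R) (r s : ℕ) :
    PowerSeries.coeff r (PowerSeries.coeff s (ser₁ a * ser₂ b)) = a r * b s := by
  simp [ser₁, ser₂]

theorem coeff_ser₂₁ (a b : ℕ → R) (r s : ℕ) :
    PowerSeries.coeff r (PowerSeries.coeff s (ser₂ b * ser₁ a)) = b s * a r := by
  simp [ser₁, ser₂]

/-- The first of two central variables. -/
noncomputable def var₁ (R : Type*) [Ring R] : PowerSeries (PowerSeries R) :=
  PowerSeries.C PowerSeries.X

/-- The second of two central variables. -/
noncomputable def var₂ (R : Type*) [Ring R] : PowerSeries (PowerSeries R) := PowerSeries.X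

theorem var₁_comm (f : PowerSeries (PowerSeries R)) : var₁ R * f = f * var₁ R := by
  ext s : 1
  simp only [var₁, PowerSeries.coeff_C_mul, PowerSeries.coeff_mul_C]
  exact (PowerSeries.commute_X _).symm

theorem var₂_comm (f : PowerSeries (PowerSeries R)) : var₂ R * f = f * var₂ R :=
  (PowerSeries.commute_X f).symm

theorem yang_series {t : ℕ → Fin n → Fin n → R} (ht : IsYangFamily t) (i j k l : Fin n) :
    (var₂ R - var₁ R) * (ser₁ (t · i j) * ser₂ (t · k l) - ser₂ (t · k l) * ser₁ (t · i j))
      = (var₂ R * var₁ R)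
        * (ser₁ (t · k j) * ser₂ (t · i l) - ser₂ (t · k j) * ser₁ (t · i l)) := by
  have hc : ∀ i j (y : R), t 0 i j * y = y * t 0 i j := fun i j y => by
    rw [ht.zero]; split_ifs <;> simp
  ext s r
  rw [sub_mul, mul_assoc, var₁, var₂]
  cases s with
  | zero =>
    rw [map_sub, PowerSeries.coeff_zero_X_mul, PowerSeries.coeff_zero_X_mul,
      PowerSeries.coeff_C_mul, zero_sub, map_neg, map_zero]
    cases r with
    | zero => rw [PowerSeries.coeff_zero_X_mul, neg_zero]
    | succ r =>
      rw [PowerSeries.coeff_succ_X_mul, map_sub, map_sub, coeff_ser₁₂, coeff_ser₂₁, hc, sub_self,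
        neg_zero]
  | succ s =>
    rw [map_sub, PowerSeries.coeff_succ_X_mul, PowerSeries.coeff_succ_X_mul,
      PowerSeries.coeff_C_mul, PowerSeries.coeff_C_mul, map_sub]
    cases r with
    | zero =>
      rw [PowerSeries.coeff_zero_X_mul, PowerSeries.coeff_zero_X_mul, sub_zero, map_sub, map_sub,
        coeff_ser₁₂, coeff_ser₂₁, hc, sub_self]
    | succ r =>
      rw [PowerSeries.coeff_succ_X_mul, PowerSeries.coeff_succ_X_mul]
      simp only [map_sub, coeff_ser₁₂, coeff_ser₂₁]
      exact ht.rel r s i j k l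

theorem yang_of_series {t : ℕ → Fin n → Fin n → R}
    (h0 : ∀ i j, t 0 i j = if i = j then 1 else 0)
    (h : ∀ i j k l,
      (var₂ R - var₁ R) * (ser₁ (t · i j) * ser₂ (t · k l) - ser₂ (t · k l) * ser₁ (t · i j))
        = (var₂ R * var₁ R)
          * (ser₁ (t · k j) * ser₂ (t · i l) - ser₂ (t · k j) * ser₁ (t · i l))) :
    IsYangFamily t where
  zero := h0
  rel r s i j k l := by
    have e := congrArg (fun f => PowerSeries.coeff (r + 1) (PowerSeries.coeff (s + 1) f))
      (h i j k l)
    simp only [var₁, var₂] at e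
    rw [sub_mul, mul_assoc, map_sub, PowerSeries.coeff_succ_X_mul, PowerSeries.coeff_succ_X_mul,
      PowerSeries.coeff_C_mul, PowerSeries.coeff_C_mul, map_sub, PowerSeries.coeff_succ_X_mul,
      PowerSeries.coeff_succ_X_mul] at e
    simpa only [map_sub, coeff_ser₁₂, coeff_ser₂₁] using e

variable {t t' : ℕ → Fin n → Fin n → R}

theorem mk_convT (i j : Fin n) :
    PowerSeries.mk (convT t t' · i j)
      = ∑ k, PowerSeries.mk (t · i k) * PowerSeries.mk (t' · k j) := by
  ext s
  simp [convT, PowerSeries.coeff_mul]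

theorem ser_commute {a b : ℕ → R} (h : ∀ r s, a r * b s = b s * a r) :
    ser₁ a * ser₂ b = ser₂ b * ser₁ a := by
  ext s r
  rw [coeff_ser₁₂, coeff_ser₂₁, h]

theorem conv_algebra {S : Type*} [Ring S] {D E : S} {A A' B B' : Fin n → Fin n → S}
    (hD : ∀ f, D * f = f * D) (hE : ∀ f, E * f = f * E)
    (hA : ∀ i j k l, D * (A i j * A' k l - A' k l * A i j)
      = E * (A k j * A' i l - A' k j * A i l))
    (hB : ∀ i j k l, D * (B i j * B' k l - B' k l * B i j)
      = E * (B k j * B' i l - B' k j * B i l))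
    (c₁ : ∀ i j k l, B i j * A' k l = A' k l * B i j)
    (c₂ : ∀ i j k l, A i j * B' k l = B' k l * A i j) (i j k l : Fin n) :
    D * (∑ a, ∑ b, A i a * B a j * (A' k b * B' b l) - ∑ a, ∑ b, A' k a * B' a l * (A i b * B b j))
      = E * (∑ a, ∑ b, A k a * B a j * (A' i b * B' b l)
        - ∑ a, ∑ b, A' k a * B' a j * (A i b * B b l)) := by
  have p₁ : ∀ (i j k l a b : Fin n),
      A i a * B a j * (A' k b * B' b l) = A i a * A' k b * (B a j * B' b l) := by
    intro i j k l a b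
    rw [mul_assoc, ← mul_assoc (B a j), c₁]
    noncomm_ring
  have p₂ : ∀ (i j k l a b : Fin n),
      A' k a * B' a l * (A i b * B b j) = A' k a * A i b * (B' a l * B b j) := by
    intro i j k l a b
    rw [mul_assoc, ← mul_assoc (B' a l), ← c₂]
    noncomm_ring
  have key : ∀ a b : Fin n,
      D * (A i a * A' k b * (B a j * B' b l)) - D * (A' k b * A i a * (B' b l * B a j))
        = (E * (A k a * A' i b * (B a j * B' b l)) - E * (A' k a * A i b * (B a j * B' b l)))
          + (E * (A' k b * A i a * (B b j * B' a l)) - E * (A' k b * A i a * (B' b j * B a l))) := by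
    intro a b
    have h₁ := congrArg (· * (B a j * B' b l)) (hA i a k b)
    have h₂ := congrArg (A' k b * A i a * ·) (hB a j b l)
    simp only [← mul_assoc, ← hD, ← hE] at h₁ h₂
    have h := congrArg₂ (· + ·) h₁ h₂
    simp only [mul_sub, sub_mul, mul_assoc] at h ⊢
    rw [← sub_eq_zero] at h ⊢
    rw [← h]
    abel
  simp only [p₁, p₂]
  rw [Finset.sum_comm (f := fun a b => A' k a * A i b * (B' a l * B b j))]
  simp only [mul_sub, Finset.mul_sum]
  rw [← Finset.sum_sub_distrib]
  simp only [← Finset.sum_sub_distrib, key, Finset.sum_add_distrib]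
  rw [Finset.sum_comm (f := fun a b => E * (A' k b * A i a * (B b j * B' a l))
    - E * (A' k b * A i a * (B' b j * B a l)))]
  simp only [← Finset.sum_add_distrib]
  refine Finset.sum_congr rfl fun a _ => Finset.sum_congr rfl fun b _ => ?_
  abel

/-- If `t` and `t'` satisfy the relations of the Yangian and commute with each other, then the
coefficients of `∑_k t_{ik}(u) t'_{kj}(u)` satisfy the relations of the Yangian. -/
theorem convT_family (ht : IsYangFamily t) (ht' : IsYangFamily t')
    (hc : ∀ r s i j k l, t r i j * t' s k l = t' s k l * t r i j) :
    IsYangFamily (convT t t') := by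
  apply yang_of_series
  · intro i j
    simp [convT, ht.zero, ht'.zero]
  · intro i j k l
    have e₁ : ∀ i j, ser₁ (convT t t' · i j) = ∑ a, ser₁ (t · i a) * ser₁ (t' · a j) :=
      fun i j => by simp only [ser₁, mk_convT, map_sum, map_mul]
    have e₂ : ∀ i j, ser₂ (convT t t' · i j) = ∑ a, ser₂ (t · i a) * ser₂ (t' · a j) :=
      fun i j => by simp only [ser₂, mk_convT, map_sum, map_mul]
    simp only [e₁, e₂, Finset.sum_mul_sum]
    have hA := yang_series ht
    have hB := yang_series ht'
    have c₁ : ∀ i j k l, ser₁ (t' · i j) * ser₂ (t · k l) = ser₂ (t · k l) * ser₁ (t' · i j) :=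
      fun i j k l => ser_commute fun r s => (hc _ _ _ _ _ _).symm
    have c₂ : ∀ i j k l, ser₁ (t · i j) * ser₂ (t' · k l) = ser₂ (t' · k l) * ser₁ (t · i j) :=
      fun i j k l => ser_commute fun r s => hc _ _ _ _ _ _
    have hD : ∀ f, (var₂ R - var₁ R) * f = f * (var₂ R - var₁ R) := fun f => by
      rw [sub_mul, mul_sub, var₁_comm, var₂_comm]
    have hE : ∀ f, (var₂ R * var₁ R) * f = f * (var₂ R * var₁ R) := fun f => by
      rw [mul_assoc, var₁_comm, ← mul_assoc, var₂_comm, mul_assoc]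
    exact conv_algebra hD hE hA hB c₁ c₂ i j k l

end comul

/-- The comultiplication of the Yangian, `T_{ij}(u) ↦ ∑_k T_{ik}(u) ⊗ T_{kj}(u)`. -/
noncomputable def yComul (n : ℕ) : Yangian n →ₐ[ℂ] Yangian n ⊗[ℂ] Yangian n :=
  yLift (t := convT (fun s i j => yT n s i j ⊗ₜ[ℂ] (1 : Yangian n))
      (fun s i j => (1 : Yangian n) ⊗ₜ[ℂ] yT n s i j))
    (convT_family
      ((yT_family n).map (Algebra.TensorProduct.includeLeft :
        Yangian n →ₐ[ℂ] Yangian n ⊗[ℂ] Yangian n).toRingHom)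
      ((yT_family n).map (Algebra.TensorProduct.includeRight :
        Yangian n →ₐ[ℂ] Yangian n ⊗[ℂ] Yangian n).toRingHom)
      (fun r s i j k l => by simp))


/-! ### Representations of Lie algebras -/

section rep

variable {L L' : Type*} [LieRing L] [LieAlgebra ℂ L] [LieRing L'] [LieAlgebra ℂ L']
  {M N : Type*} [AddCommGroup M] [Module ℂ M] [AddCommGroup N] [Module ℂ N]

/-- The tensor product of two representations of a Lie algebra. -/
noncomputable def tensorRep (ρ : L →ₗ⁅ℂ⁆ Module.End ℂ M) (σ : L →ₗ⁅ℂ⁆ Module.End ℂ N) :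
    L →ₗ⁅ℂ⁆ Module.End ℂ (M ⊗[ℂ] N) where
  toFun X := (ρ X).rTensor N + (σ X).lTensor M
  map_add' X Y := by
    rw [map_add, map_add, LinearMap.rTensor_add, LinearMap.lTensor_add]
    abel
  map_smul' c X := by
    simp only [map_smul, LinearMap.rTensor_smul, LinearMap.lTensor_smul, smul_add,
      RingHom.id_apply]
  map_lie' {X Y} := by
    refine TensorProduct.ext' fun v w => ?_
    simp only [LieHom.map_lie, LieRing.of_associative_ring_bracket, LinearMap.add_apply,
      LinearMap.sub_apply, LinearMap.rTensor_tmul, LinearMap.lTensor_tmul, Module.End.mul_apply,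
      TensorProduct.sub_tmul, TensorProduct.tmul_sub, map_add]
    abel

/-- The external tensor product of representations of two Lie algebras, as a representation of
their direct sum. -/
noncomputable def outerRep (ρ : L →ₗ⁅ℂ⁆ Module.End ℂ M) (σ : L' →ₗ⁅ℂ⁆ Module.End ℂ N) :
    L × L' →ₗ⁅ℂ⁆ Module.End ℂ (M ⊗[ℂ] N) :=
  tensorRep (ρ.comp (LieHom.fst ℂ L L')) (σ.comp (LieHom.snd ℂ L L'))

/-- The subspace `𝔮 · W` for a representation of a Lie algebra on `W` and a subalgebra `𝔮`. -/
def lieSpan (ρ : L →ₗ⁅ℂ⁆ Module.End ℂ M) (q : LieSubalgebra ℂ L) : Submodule ℂ M :=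
  Submodule.span ℂ {w | ∃ X ∈ q, ∃ v, w = ρ X v}

/-- The space of coinvariants `W_𝔮 = W / 𝔮 · W`. -/
abbrev Coinv (ρ : L →ₗ⁅ℂ⁆ Module.End ℂ M) (q : LieSubalgebra ℂ L) : Type _ := M ⧸ lieSpan ρ q

/-- If every element of the image of `f` commutes with the action of `𝔮`, then `f` induces an
action on the coinvariants. -/
noncomputable def coinvAlg {A : Type*} [Ring A] [Algebra ℂ A] (ρ : L →ₗ⁅ℂ⁆ Module.End ℂ M)
    (q : LieSubalgebra ℂ L) (f : A →ₐ[ℂ] Module.End ℂ M)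
    (h : ∀ a X, f a * ρ X = ρ X * f a) : A →ₐ[ℂ] Module.End ℂ (Coinv ρ q) :=
  have h' : ∀ a, lieSpan ρ q ≤ (lieSpan ρ q).comap (f a) := fun a => by
    refine Submodule.span_le.2 ?_
    rintro _ ⟨X, hX, v, rfl⟩
    exact Submodule.subset_span ⟨X, hX, f a v, LinearMap.congr_fun (h a X) v⟩
  AlgHom.ofLinearMap
    { toFun := fun a => (lieSpan ρ q).mapQ (lieSpan ρ q) (f a) (h' a)
      map_add' := fun a b => by
        refine Submodule.linearMap_qext _ (LinearMap.ext fun v => ?_)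
        simp
      map_smul' := fun c a => by
        refine Submodule.linearMap_qext _ (LinearMap.ext fun v => ?_)
        simp }
    (by
      refine Submodule.linearMap_qext _ (LinearMap.ext fun v => ?_)
      simp)
    (fun a b => by
      refine Submodule.linearMap_qext _ (LinearMap.ext fun v => ?_)
      simp)

/-- If `f : L' → L` is a homomorphism whose image normalizes `𝔮`, then `L'` acts on the
coinvariants. -/
noncomputable def coinvLie (ρ : L →ₗ⁅ℂ⁆ Module.End ℂ M) (q : LieSubalgebra ℂ L)
    (f : L' →ₗ⁅ℂ⁆ L) (h : ∀ Z, ∀ X ∈ q, ⁅f Z, X⁆ ∈ q) : L' →ₗ⁅ℂ⁆ Module.End ℂ (Coinv ρ q) :=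
  have h' : ∀ Z, lieSpan ρ q ≤ (lieSpan ρ q).comap (ρ (f Z)) := fun Z => by
    refine Submodule.span_le.2 ?_
    rintro _ ⟨X, hX, v, rfl⟩
    have e : ρ (f Z) (ρ X v) = ρ ⁅f Z, X⁆ v + ρ X (ρ (f Z) v) := by
      rw [LieHom.map_lie, LieRing.of_associative_ring_bracket]
      simp
    rw [SetLike.mem_coe, Submodule.mem_comap, e]
    exact Submodule.add_mem _ (Submodule.subset_span ⟨_, h Z X hX, v, rfl⟩)
      (Submodule.subset_span ⟨X, hX, _, rfl⟩)
  { toFun := fun Z => (lieSpan ρ q).mapQ (lieSpan ρ q) (ρ (f Z)) (h' Z)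
    map_add' := fun a b => by
      refine Submodule.linearMap_qext _ (LinearMap.ext fun v => ?_)
      simp
    map_smul' := fun c a => by
      refine Submodule.linearMap_qext _ (LinearMap.ext fun v => ?_)
      simp
    map_lie' := fun {a b} => by
      refine Submodule.linearMap_qext _ (LinearMap.ext fun v => ?_)
      simp [LieRing.of_associative_ring_bracket] }

/-- The relations `(u · X) ⊗ w = u ⊗ (X · w)` for `u ∈ U(L)`, `X ∈ 𝔭`, `w ∈ N`. -/
def indRel (p : LieSubalgebra ℂ L) (σ : p →ₗ⁅ℂ⁆ Module.End ℂ N) :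
    Submodule ℂ (UniversalEnvelopingAlgebra ℂ L ⊗[ℂ] N) :=
  Submodule.span ℂ {y | ∃ (u : UniversalEnvelopingAlgebra ℂ L) (X : p) (w : N),
    y = (u * UniversalEnvelopingAlgebra.ι ℂ (X : L)) ⊗ₜ[ℂ] w - u ⊗ₜ[ℂ] σ X w}

/-- The space `U(L) ⊗_{U(𝔭)} N` of the module induced from a `𝔭`-module `N`. -/
abbrev Ind (p : LieSubalgebra ℂ L) (σ : p →ₗ⁅ℂ⁆ Module.End ℂ N) : Type _ :=
  (UniversalEnvelopingAlgebra ℂ L ⊗[ℂ] N) ⧸ indRel p σ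

/-- The action of `L` on the induced module, by left multiplication on `U(L)`. -/
noncomputable def indRep (p : LieSubalgebra ℂ L) (σ : p →ₗ⁅ℂ⁆ Module.End ℂ N) :
    L →ₗ⁅ℂ⁆ Module.End ℂ (Ind p σ) :=
  have h' : ∀ X : L, indRel p σ ≤ (indRel p σ).comap
      ((LinearMap.mulLeft ℂ (UniversalEnvelopingAlgebra.ι ℂ X)).rTensor N) := fun X => by
    refine Submodule.span_le.2 ?_
    rintro _ ⟨u, Y, w, rfl⟩
    refine Submodule.subset_span ⟨UniversalEnvelopingAlgebra.ι ℂ X * u, Y, w, ?_⟩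
    rw [map_sub, LinearMap.rTensor_tmul, LinearMap.rTensor_tmul, LinearMap.mulLeft_apply,
      LinearMap.mulLeft_apply, mul_assoc]
  { toFun := fun X => (indRel p σ).mapQ (indRel p σ)
      ((LinearMap.mulLeft ℂ (UniversalEnvelopingAlgebra.ι ℂ X)).rTensor N) (h' X)
    map_add' := fun X Y => by
      refine Submodule.linearMap_qext _ (TensorProduct.ext' fun u w => ?_)
      simp only [LinearMap.comp_apply, LinearMap.add_apply, Submodule.mkQ_apply,
        Submodule.mapQ_apply, LinearMap.rTensor_tmul, LinearMap.mulLeft_apply, map_add, add_mul,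
        TensorProduct.add_tmul, Submodule.Quotient.mk_add]
    map_smul' := fun c X => by
      refine Submodule.linearMap_qext _ (TensorProduct.ext' fun u w => ?_)
      simp only [LinearMap.comp_apply, LinearMap.smul_apply, Submodule.mkQ_apply,
        Submodule.mapQ_apply, LinearMap.rTensor_tmul, LinearMap.mulLeft_apply, map_smul,
        smul_mul_assoc, ← TensorProduct.smul_tmul', Submodule.Quotient.mk_smul, RingHom.id_apply]
    map_lie' := fun {X Y} => by
      refine Submodule.linearMap_qext _ (TensorProduct.ext' fun u w => ?_)
      simp only [LinearMap.comp_apply, LieRing.of_associative_ring_bracket, LinearMap.sub_apply,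
        Module.End.mul_apply, Submodule.mkQ_apply,
        Submodule.mapQ_apply, LinearMap.rTensor_tmul, LinearMap.mulLeft_apply, LieHom.map_lie,
        sub_mul, mul_assoc, TensorProduct.sub_tmul, Submodule.Quotient.mk_sub] }

end rep


/-! ### The bimodule `E_m(V)` -/

section bimod

theorem matPow_comm {ι R : Type*} [Fintype ι] [DecidableEq ι] [Ring R] {P : Matrix ι ι R}
    (hP : ∀ a b c d, P a b * P c d - P c d * P a b
      = (if a = d then P c b else 0) - (if c = b then P a d else 0)) (s : ℕ) (a b c d : ι) :
    P a b * (P ^ s) c d - (P ^ s) c d * P a b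
      = (if a = d then (P ^ s) c b else 0) - (if c = b then (P ^ s) a d else 0) := by
  induction s generalizing c d with
  | zero =>
    simp only [pow_zero, Matrix.one_apply, mul_ite, ite_mul, mul_one, one_mul, mul_zero, zero_mul]
    split_ifs <;> simp_all
  | succ s ih =>
    have h : ∀ e, P a b * ((P ^ s) c e * P e d) - (P ^ s) c e * P e d * P a b
        = ((if a = e then (P ^ s) c b * P e d else 0) - (if c = b then (P ^ s) a e * P e d else 0))
          + ((if a = d then (P ^ s) c e * P e b else 0)
            - (if e = b then (P ^ s) c e * P a d else 0)) := fun e => by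
      have h₁ := congrArg (· * P e d) (ih c e)
      have h₂ := congrArg ((P ^ s) c e * ·) (hP a b e d)
      simp only [sub_mul, mul_sub, ite_mul, mul_ite, zero_mul, mul_zero, mul_assoc] at h₁ h₂
      simp only [mul_assoc]
      rw [← h₁, ← h₂]
      abel
    simp only [pow_succ, Matrix.mul_apply, Finset.mul_sum, Finset.sum_mul]
    rw [← Finset.sum_sub_distrib]
    simp only [h, Finset.sum_add_distrib, Finset.sum_sub_distrib, Finset.sum_ite_eq,
      Finset.sum_ite_eq', Finset.mem_univ, if_true]
    split_ifs <;> (simp; try abel)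

theorem matPow_rel {ι R : Type*} [Fintype ι] [DecidableEq ι] [Ring R] {P : Matrix ι ι R}
    (hP : ∀ a b c d, P a b * P c d - P c d * P a b
      = (if a = d then P c b else 0) - (if c = b then P a d else 0)) (r s : ℕ) (a b c d : ι) :
    ((P ^ (r + 1)) a b * (P ^ s) c d - (P ^ s) c d * (P ^ (r + 1)) a b)
      - ((P ^ r) a b * (P ^ (s + 1)) c d - (P ^ (s + 1)) c d * (P ^ r) a b)
      = (P ^ r) a d * (P ^ s) c b - (P ^ s) a d * (P ^ r) c b := by
  induction r generalizing a b with
  | zero =>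
    have h := matPow_comm hP s a b c d
    simp only [zero_add, pow_one, pow_zero, h, Matrix.one_apply]
    split_ifs <;> simp_all
  | succ r ih =>
    have hs : ∀ (q k : ℕ) (c d : ι), (P ^ (q + 1)) a b * (P ^ k) c d
        - (P ^ k) c d * (P ^ (q + 1)) a b
        = ∑ e, (P a e * ((P ^ q) e b * (P ^ k) c d - (P ^ k) c d * (P ^ q) e b)
          + ((if a = d then (P ^ k) c e * (P ^ q) e b else 0)
            - (if c = e then (P ^ k) a d * (P ^ q) e b else 0))) := by
      intro q k c d
      simp only [pow_succ' P q, Matrix.mul_apply, Finset.mul_sum, Finset.sum_mul]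
      rw [← Finset.sum_sub_distrib]
      refine Finset.sum_congr rfl fun e _ => ?_
      have h := congrArg (· * (P ^ q) e b) (matPow_comm hP k a e c d)
      simp only [sub_mul, ite_mul, zero_mul] at h
      rw [← h]
      noncomm_ring
    rw [hs (r + 1) s, hs r (s + 1)]
    simp only [Finset.sum_add_distrib, Finset.sum_sub_distrib, Finset.sum_ite_eq,
      Finset.mem_univ, if_true]
    have h1 : ∀ (k q : ℕ), (∑ e, if a = d then (P ^ k) c e * (P ^ q) e b else 0)
        = if a = d then (P ^ (k + q)) c b else 0 := fun k q => by
      split_ifs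
      · rw [pow_add, Matrix.mul_apply]
      · simp
    rw [h1, h1, show s + 1 + r = s + (r + 1) by omega, add_sub_add_comm, ← Finset.sum_sub_distrib]
    simp only [← mul_sub, ih]
    simp only [mul_sub, ← mul_assoc, Finset.sum_sub_distrib, ← Finset.sum_mul]
    simp only [pow_succ' P r, pow_succ' P s, Matrix.mul_apply]
    abel

theorem matPow_swap {ι R : Type*} [Fintype ι] [DecidableEq ι] [Ring R] {P : Matrix ι ι R}
    (hP : ∀ a b c d, P a b * P c d - P c d * P a b
      = (if a = d then P c b else 0) - (if c = b then P a d else 0)) (r s : ℕ) (a b c d : ι) :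
    (P ^ r) a b * (P ^ s) c d - (P ^ s) c d * (P ^ r) a b
      = (P ^ s) a b * (P ^ r) c d - (P ^ r) c d * (P ^ s) a b := by
  have h1 := matPow_rel hP r s a d c b
  have h2 := matPow_rel hP s r c b a d
  rw [← sub_eq_zero] at h1 h2 ⊢
  have h := congrArg₂ (· - ·) h1 h2
  simp only [sub_zero] at h
  rw [← neg_eq_zero, ← h]
  abel

section

variable {ι R : Type*} [Fintype ι] [Ring R] {n : ℕ} {x d : ι → Fin n → R}

/-- The sums that occur in the products of two elements `glT`. -/
def quadSum (x d : ι → Fin n → R) (F : ι → ι → ι → ι → R) (i j k l : Fin n) : R :=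
  ∑ a, ∑ b, ∑ c, ∑ e, F a b c e * (x a i * x c k * (d b j * d e l))

theorem quadSum_sub (F G : ι → ι → ι → ι → R) (i j k l : Fin n) :
    quadSum x d (fun a b c e => F a b c e - G a b c e) i j k l
      = quadSum x d F i j k l - quadSum x d G i j k l := by
  simp only [quadSum, sub_mul, Finset.sum_sub_distrib]

theorem quadSum_swap (hxx : ∀ a i b j, x a i * x b j = -(x b j * x a i))
    (hdd : ∀ a i b j, d a i * d b j = -(d b j * d a i)) (F : ι → ι → ι → ι → R)
    (i j k l : Fin n) :
    quadSum x d F k l i j = quadSum x d (fun a b c e => F c e a b) i j k l := by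
  unfold quadSum
  have e : ∀ G : ι → ι → ι → ι → R, ∑ a, ∑ b, ∑ c, ∑ e, G a b c e
      = ∑ a, ∑ b, ∑ c, ∑ e, G c e a b := fun G => by
    rw [show (∑ a, ∑ b, ∑ c, ∑ e, G a b c e) = ∑ p : ι × ι, ∑ q : ι × ι, G p.1 p.2 q.1 q.2 by
      simp only [Fintype.sum_prod_type], Finset.sum_comm]
    simp only [Fintype.sum_prod_type]
  rw [e]
  refine Finset.sum_congr rfl fun a _ => Finset.sum_congr rfl fun b _ =>
    Finset.sum_congr rfl fun c _ => Finset.sum_congr rfl fun e _ => ?_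
  rw [hxx c k a i, hdd e l b j, neg_mul_neg]

theorem quadSum_half (hxx : ∀ a i b j, x a i * x b j = -(x b j * x a i))
    (F : ι → ι → ι → ι → R) (i j k l : Fin n) :
    quadSum x d F k j i l = -quadSum x d (fun a b c e => F c b a e) i j k l := by
  unfold quadSum
  simp only [← Finset.sum_neg_distrib]
  have e : ∀ G : ι → ι → ι → ι → R, ∑ a, ∑ b, ∑ c, ∑ e, G a b c e
      = ∑ a, ∑ b, ∑ c, ∑ e, G c b a e := fun G => by
    rw [Finset.sum_comm, Finset.sum_comm (f := fun a b => ∑ c, ∑ e, G c b a e)]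
    exact Finset.sum_congr rfl fun b _ => Finset.sum_comm
  rw [e]
  refine Finset.sum_congr rfl fun a _ => Finset.sum_congr rfl fun b _ =>
    Finset.sum_congr rfl fun c _ => Finset.sum_congr rfl fun e _ => ?_
  rw [hxx c k a i, neg_mul, mul_neg]

end

/-- The elements `∑_{a,b} (P ^ s)_{ab} x_{ai} ∂_{bj}`. -/
def glT {ι R : Type*} [Fintype ι] [DecidableEq ι] [Ring R] {n : ℕ} (P : Matrix ι ι R)
    (x d : ι → Fin n → R) : ℕ → Fin n → Fin n → R
  | 0, i, j => if i = j then 1 else 0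
  | s + 1, i, j => ∑ a, ∑ b, (P ^ s) a b * (x a i * d b j)

section

variable {ι R : Type*} [Fintype ι] [DecidableEq ι] [Ring R] {n : ℕ} {P : Matrix ι ι R}
  {x d : ι → Fin n → R}

theorem matPow_commute {y : R} (h : ∀ a b, P a b * y = y * P a b) (s : ℕ) (a b : ι) :
    (P ^ s) a b * y = y * (P ^ s) a b := by
  induction s generalizing a b with
  | zero =>
    rw [pow_zero, Matrix.one_apply]
    split_ifs <;> simp
  | succ s ih =>
    simp only [pow_succ, Matrix.mul_apply, Finset.sum_mul, Finset.mul_sum]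
    refine Finset.sum_congr rfl fun e _ => ?_
    rw [mul_assoc, h, ← mul_assoc, ih, mul_assoc]

theorem glT_mul (hx : ∀ a i b j, P a b * x i j = x i j * P a b)
    (hd : ∀ a i b j, P a b * d i j = d i j * P a b)
    (hdx : ∀ a i b j, d a i * x b j = (if a = b ∧ i = j then 1 else 0) - x b j * d a i)
    (r s : ℕ) (i j k l : Fin n) :
    glT P x d (r + 1) i j * glT P x d (s + 1) k l
      = (if j = k then glT P x d (r + s + 1) i l else 0)
        - quadSum x d (fun a b c e => (P ^ r) a b * (P ^ s) c e) i j k l := by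
  have h : ∀ a b c e, (P ^ r) a b * (x a i * d b j) * ((P ^ s) c e * (x c k * d e l))
      = (if b = c then (if j = k then (P ^ r) a b * (P ^ s) c e * (x a i * d e l) else 0) else 0)
        - (P ^ r) a b * (P ^ s) c e * (x a i * x c k * (d b j * d e l)) := fun a b c e => by
    have e1 : (P ^ r) a b * (x a i * d b j) * ((P ^ s) c e * (x c k * d e l))
        = (P ^ r) a b * (P ^ s) c e * (x a i * (d b j * x c k) * d e l) := by
      have h1 := matPow_commute (fun a b => hx a c b k) s c e
      have h2 := matPow_commute (fun a' b' => hd a' b b' j) s c e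
      have h3 := matPow_commute (fun a' b' => hx a' a b' i) s c e
      simp only [mul_assoc]
      rw [← mul_assoc (d b j) ((P ^ s) c e), ← h2, mul_assoc, ← mul_assoc (x a i) ((P ^ s) c e),
        ← h3, mul_assoc]
    rw [e1, hdx]
    by_cases hb : b = c <;> by_cases hj : j = k <;> simp [hb, hj, mul_sub, sub_mul, mul_assoc]
  have h2 : glT P x d (r + 1) i j * glT P x d (s + 1) k l
      = ∑ a, ∑ b, ∑ c, ∑ e,
        (P ^ r) a b * (x a i * d b j) * ((P ^ s) c e * (x c k * d e l)) := by
    simp only [glT, Finset.sum_mul]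
    simp only [Finset.mul_sum]
  rw [h2]
  simp only [h, Finset.sum_sub_distrib]
  refine congrArg₂ (· - ·) ?_ rfl
  by_cases hj : j = k
  · simp only [hj, if_true, glT, pow_add, Matrix.mul_apply, Finset.sum_mul]
    refine Finset.sum_congr rfl fun a _ => ?_
    rw [Finset.sum_comm (s := Finset.univ) (t := Finset.univ)
      (f := fun e b => (P ^ r) a b * (P ^ s) b e * (x a i * d e l))]
    refine Finset.sum_congr rfl fun b _ => ?_
    rw [Finset.sum_comm]
    simp
  · simp [hj]

/-- The elements `∑_{a,b} (P ^ s)_{ab} x_{ai} ∂_{bj}` satisfy the relations of the Yangian. -/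
theorem glT_family
    (hP : ∀ a b c d, P a b * P c d - P c d * P a b
      = (if a = d then P c b else 0) - (if c = b then P a d else 0))
    (hx : ∀ a i b j, P a b * x i j = x i j * P a b)
    (hd : ∀ a i b j, P a b * d i j = d i j * P a b)
    (hxx : ∀ a i b j, x a i * x b j = -(x b j * x a i))
    (hdd : ∀ a i b j, d a i * d b j = -(d b j * d a i))
    (hdx : ∀ a i b j, d a i * x b j = (if a = b ∧ i = j then 1 else 0) - x b j * d a i) :
    IsYangFamily (glT P x d) where
  zero i j := rfl
  rel r s i j k l := by
    have hc : ∀ i j (y : R), glT P x d 0 i j * y = y * glT P x d 0 i j := fun i j y => by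
      rw [glT]; split_ifs <;> simp
    have h1 : ∀ (s : ℕ) (i j k l : Fin n),
        glT P x d 1 i j * glT P x d (s + 1) k l - glT P x d (s + 1) k l * glT P x d 1 i j
          = glT P x d 0 k j * glT P x d (s + 1) i l
            - glT P x d (s + 1) k j * glT P x d 0 i l := fun s i j k l => by
      have m1 := glT_mul hx hd hdx 0 s i j k l
      have m2 := glT_mul hx hd hdx s 0 k l i j
      rw [quadSum_swap hxx hdd] at m2
      have : (fun a b c e => (P ^ s) c e * (P ^ 0) a b)
          = fun a b c e => (P ^ 0) a b * (P ^ s) c e := by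
        funext a b c e
        rw [pow_zero, Matrix.one_apply]
        split_ifs <;> simp
      rw [this] at m2
      simp only [zero_add, add_zero] at m1 m2
      rw [m1, m2, sub_sub_sub_cancel_right]
      congr 1
      · rw [glT]; by_cases h : j = k
        · simp [h]
        · simp [h, Ne.symm h]
      · rw [glT]; by_cases h : l = i
        · simp [h]
        · simp [h, Ne.symm h]
    cases r with
    | zero =>
      cases s with
      | zero =>
        simp only [zero_add]
        rw [hc k l, hc i j, hc k j, sub_self, sub_self, sub_self, hc i l, hc k j]
        simp only [glT]
        split_ifs <;> simp
      | succ s =>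
        rw [hc i j, sub_self, sub_zero]
        exact h1 s i j k l
    | succ r =>
      cases s with
      | zero =>
        simp only [zero_add]
        rw [hc k l, sub_self, zero_sub, neg_sub, h1, hc i l, hc k j]
      | succ s =>
        simp only [glT_mul hx hd hdx]
        rw [quadSum_swap hxx hdd _ i j k l, quadSum_swap hxx hdd _ i j k l,
          quadSum_half hxx _ i j k l, quadSum_half hxx _ i j k l]
        have key : quadSum x d (fun a b c e => ((P ^ (r + 1)) a b * (P ^ s) c e
              - (P ^ s) c e * (P ^ (r + 1)) a b)
              - ((P ^ r) a b * (P ^ (s + 1)) c e - (P ^ (s + 1)) c e * (P ^ r) a b)) i j k l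
            = quadSum x d (fun a b c e => (P ^ s) c b * (P ^ r) a e
              - (P ^ r) c b * (P ^ s) a e) i j k l := by
          congr 1
          funext a b c e
          rw [matPow_rel hP]
          have h := matPow_swap hP s r c b a e
          rw [← sub_eq_zero] at h ⊢
          rw [← neg_eq_zero, ← h]
          abel
        simp only [quadSum_sub] at key
        rw [show r + 1 + s = r + s + 1 by omega, show s + (r + 1) = r + s + 1 by omega,
          show s + 1 + r = r + s + 1 by omega, show r + (s + 1) = r + s + 1 by omega,
          add_comm s r]
        rw [← sub_eq_zero] at key ⊢
        rw [← neg_eq_zero, ← key]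
        abel

end

theorem glT_comm {ι R : Type*} [Fintype ι] [DecidableEq ι] [Ring R] {n : ℕ} {P : Matrix ι ι R}
    {x d : ι → Fin n → R}
    (hP : ∀ a b c d, P a b * P c d - P c d * P a b
      = (if a = d then P c b else 0) - (if c = b then P a d else 0))
    (hx : ∀ a i b j, P a b * x i j = x i j * P a b)
    (hd : ∀ a i b j, P a b * d i j = d i j * P a b) {g : R} (p q : ι)
    (hg : ∀ a b, g * P a b = P a b * g)
    (hgx : ∀ a i, g * x a i = x a i * g + if q = a then x p i else 0)
    (hgd : ∀ a i, g * d a i = d a i * g - if a = p then d q i else 0)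
    (s : ℕ) (i j : Fin n) :
    glT P x d s i j * (P q p + g) = (P q p + g) * glT P x d s i j := by
  cases s with
  | zero => rw [glT]; split_ifs <;> simp
  | succ s =>
    have h : ∀ a b, (P q p + g) * ((P ^ s) a b * (x a i * d b j))
        - (P ^ s) a b * (x a i * d b j) * (P q p + g)
        = ((if q = b then (P ^ s) a p * (x a i * d b j) else 0)
            - (if a = p then (P ^ s) q b * (x a i * d b j) else 0))
          + ((if q = a then (P ^ s) a b * (x p i * d b j) else 0)
            - (if b = p then (P ^ s) a b * (x a i * d q j) else 0)) := fun a b => by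
      have h1 := congrArg (· * (x a i * d b j)) (matPow_comm hP s q p a b)
      have h2 : g * (P ^ s) a b = (P ^ s) a b * g :=
        (matPow_commute (fun a b => (hg a b).symm) s a b).symm
      have h3 : x a i * d b j * P q p = P q p * (x a i * d b j) := by
        rw [mul_assoc, ← hd, ← mul_assoc, ← hx, mul_assoc]
      have h4 : g * (x a i * d b j) - x a i * d b j * g
          = (if q = a then x p i * d b j else 0) - (if b = p then x a i * d q j else 0) := by
        rw [← mul_assoc, hgx, add_mul, mul_assoc, hgd]
        by_cases h : q = a <;> by_cases h' : b = p <;> simp [h, h', mul_sub, mul_assoc]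
        abel
      have h5 := congrArg ((P ^ s) a b * ·) h4
      simp only [sub_mul, mul_sub, ite_mul, mul_ite, zero_mul, mul_zero] at h1 h5
      rw [← h1, ← h5, mul_add, mul_assoc _ (x a i * d b j) (P q p), h3, add_mul, ← mul_assoc g, h2]
      simp only [mul_assoc]
      abel
    rw [eq_comm, ← sub_eq_zero]
    simp only [glT, Finset.mul_sum, Finset.sum_mul]
    simp only [← Finset.sum_sub_distrib, h]
    simp only [Finset.sum_add_distrib, Finset.sum_sub_distrib, Finset.sum_ite_eq,
      Finset.sum_ite_eq', Finset.mem_univ, if_true]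
    rw [Finset.sum_comm (f := fun a b => if a = p then (P ^ s) q b * (x a i * d b j) else 0),
      Finset.sum_comm (f := fun a b => if q = a then (P ^ s) a b * (x p i * d b j) else 0)]
    simp only [Finset.sum_ite_eq, Finset.sum_ite_eq', Finset.mem_univ, if_true]
    abel

/-- The Lie algebra `gl(ℂ^ι)` of complex matrices. -/
abbrev gl (ι : Type) : Type := Matrix ι ι ℂ

/-- The Grassmann algebra `Λ(ℂ^ι ⊗ ℂ^n)` on the anticommuting variables `x_{ai}`, where `a ∈ ι` and
`1 ≤ i ≤ n`. -/
abbrev Grass (ι : Type) (n : ℕ) : Type := ExteriorAlgebra ℂ (ι × Fin n → ℂ)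

section

variable {ι : Type} [DecidableEq ι] {n : ℕ}

/-- The operator of left multiplication by `x_{ai}`. -/
noncomputable def gx (a : ι) (i : Fin n) : Module.End ℂ (Grass ι n) :=
  LinearMap.mulLeft ℂ (ExteriorAlgebra.ι ℂ (Pi.single (a, i) 1))

/-- The left derivation `∂_{ai}` (inner multiplication) corresponding to `x_{ai}`. -/
noncomputable def gd (a : ι) (i : Fin n) : Module.End ℂ (Grass ι n) :=
  CliffordAlgebra.contractLeft (LinearMap.proj (a, i) : Module.Dual ℂ (ι × Fin n → ℂ))

theorem gx_gx (a : ι) (i : Fin n) (b : ι) (j : Fin n) : gx a i * gx b j = -(gx b j * gx a i) := by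
  refine LinearMap.ext fun w => ?_
  simp only [gx, Module.End.mul_apply, LinearMap.neg_apply, LinearMap.mulLeft_apply, ← mul_assoc]
  rw [eq_neg_of_add_eq_zero_left (ExteriorAlgebra.ι_add_mul_swap (R := ℂ)
    (Pi.single (a, i) 1 : ι × Fin n → ℂ) (Pi.single (b, j) 1)), neg_mul]

theorem gd_gd {κ : Type} {n : ℕ} (a : κ) (i : Fin n) (b : κ) (j : Fin n) :
    (gd a i : Module.End ℂ (Grass κ n)) * gd b j = -(gd b j * gd a i) := by
  refine LinearMap.ext fun w => ?_
  exact CliffordAlgebra.contractLeft_comm _ _ w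

theorem gd_gx (a : ι) (i : Fin n) (b : ι) (j : Fin n) :
    (gd a i : Module.End ℂ (Grass ι n)) * gx b j
      = (if a = b ∧ i = j then 1 else 0) - gx b j * gd a i := by
  refine LinearMap.ext fun w => ?_
  have h := CliffordAlgebra.contractLeft_ι_mul (Q := (0 : QuadraticForm ℂ (ι × Fin n → ℂ)))
    (d := (LinearMap.proj (a, i) : Module.Dual ℂ (ι × Fin n → ℂ))) (Pi.single (b, j) 1) w
  refine h.trans ?_
  refine congrArg₂ (· - ·) ?_ rfl
  rw [LinearMap.proj_apply, Pi.single_apply]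
  by_cases hab : a = b <;> by_cases hij : i = j <;> simp [hab, hij]

/-- The operator by which the matrix unit `E_{ab}` acts on the Grassmann algebra,
`∑_k x_{ak} ∂_{bk}`. -/
noncomputable def gE (n : ℕ) (a b : ι) : Module.End ℂ (Grass ι n) := ∑ k, gx a k * gd b k

theorem gE_gx (p q a : ι) (i : Fin n) :
    gE n p q * gx a i = gx a i * gE n p q + if q = a then gx p i else 0 := by
  have h : ∀ k, gx p k * gd q k * gx a i
      = gx a i * (gx p k * gd q k) + if q = a ∧ k = i then gx p k else 0 := fun k => by
    rw [mul_assoc, gd_gx, mul_sub, ← mul_assoc, gx_gx p k a i, mul_ite, mul_one, mul_zero]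
    rw [neg_mul, sub_neg_eq_add, add_comm, mul_assoc]
  simp only [gE, Finset.sum_mul, Finset.mul_sum, h, Finset.sum_add_distrib]
  by_cases hq : q = a <;> simp [hq]

theorem gE_gd (p q a : ι) (i : Fin n) :
    gE n p q * gd a i = gd a i * gE n p q - if a = p then gd q i else 0 := by
  have h : ∀ k, gd a i * (gx p k * gd q k)
      = gx p k * gd q k * gd a i + if a = p ∧ i = k then gd q k else 0 := fun k => by
    rw [← mul_assoc, gd_gx, sub_mul, mul_assoc, gd_gd a i q k, ite_mul, one_mul, zero_mul]
    rw [mul_neg, sub_neg_eq_add, add_comm, mul_assoc]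
  simp only [gE, Finset.sum_mul, Finset.mul_sum, h, Finset.sum_add_distrib]
  by_cases hq : a = p <;> simp [hq]

theorem gE_gE (n : ℕ) (a b c d : ι) :
    gE n a b * gE n c d - gE n c d * gE n a b
      = (if b = c then gE n a d else 0) - if d = a then gE n c b else 0 := by
  have h : ∀ k, gE n a b * (gx c k * gd d k) - gx c k * gd d k * gE n a b
      = (if b = c then gx a k * gd d k else 0) - if d = a then gx c k * gd b k else 0 := fun k => by
    rw [← mul_assoc, gE_gx, add_mul, mul_assoc (gx c k), gE_gd, ite_mul, zero_mul, mul_sub,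
      mul_ite, mul_zero, ← mul_assoc]
    abel
  rw [gE.eq_1 n c d, Finset.mul_sum, Finset.sum_mul, ← Finset.sum_sub_distrib]
  simp only [h, Finset.sum_sub_distrib]
  by_cases h1 : b = c <;> by_cases h2 : d = a <;> simp [h1, h2, gE]

end

section

variable {ι : Type} [Fintype ι] [DecidableEq ι]

/-- The natural representation of `gl(ℂ^ι)` on `Λ(ℂ^ι ⊗ ℂ^n)`, where `E_{ab}` acts as
`∑_k x_{ak} ∂_{bk}`. -/
noncomputable def grassRep (ι : Type) [Fintype ι] [DecidableEq ι] (n : ℕ) :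
    gl ι →ₗ⁅ℂ⁆ Module.End ℂ (Grass ι n) where
  toFun X := ∑ a, ∑ b, X a b • gE n a b
  map_add' X Y := by
    simp only [Matrix.add_apply, add_smul, Finset.sum_add_distrib]
  map_smul' c X := by
    simp only [Matrix.smul_apply, smul_eq_mul, mul_smul, Finset.smul_sum, RingHom.id_apply]
  map_lie' {X Y} := by
    have h : ∀ a b c d, (X a b • gE n a b) * (Y c d • gE n c d)
        - (Y c d • gE n c d) * (X a b • gE n a b)
        = (if b = c then (X a b * Y c d) • gE n a d else 0)
          - if d = a then (Y c d * X a b) • gE n c b else 0 := fun a b c d => by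
      have h' := congrArg ((X a b * Y c d) • ·) (gE_gE n a b c d)
      simp only [smul_sub, smul_ite, smul_zero] at h'
      rw [smul_mul_smul_comm, smul_mul_smul_comm, mul_comm (Y c d), h']
    have e₁ : (∑ a, ∑ b, X a b • gE n a b) * (∑ a, ∑ b, Y a b • gE n a b)
        = ∑ a, ∑ b, ∑ c, ∑ d, (X a b • gE n a b) * (Y c d • gE n c d) := by
      simp only [Finset.sum_mul]
      simp only [Finset.mul_sum]
    have e₂ : (∑ a, ∑ b, Y a b • gE n a b) * (∑ a, ∑ b, X a b • gE n a b)
        = ∑ a, ∑ b, ∑ c, ∑ d, (Y c d • gE n c d) * (X a b • gE n a b) := by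
      simp only [Finset.mul_sum]
      simp only [Finset.sum_mul]
    rw [LieRing.of_associative_ring_bracket, LieRing.of_associative_ring_bracket, e₁, e₂]
    simp only [← Finset.sum_sub_distrib, h]
    simp only [Finset.sum_sub_distrib, Matrix.sub_apply, Matrix.mul_apply, sub_smul,
      Finset.sum_smul]
    congr 1
    · refine Finset.sum_congr rfl fun a _ => ?_
      rw [Finset.sum_comm]
      refine Finset.sum_congr rfl fun b _ => ?_
      rw [Finset.sum_comm]
      simp
    · simp only [Finset.sum_ite_eq', Finset.mem_univ, if_true]
      rw [Finset.sum_congr rfl fun a _ => Finset.sum_comm, Finset.sum_comm]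
      rw [Finset.sum_congr rfl fun a _ => Finset.sum_comm]

theorem grassRep_single (n : ℕ) (a b : ι) : grassRep ι n (Matrix.single a b 1) = gE n a b := by
  change ∑ c, ∑ d, (Matrix.single a b (1 : ℂ)) c d • gE n c d = _
  rw [Finset.sum_eq_single a, Finset.sum_eq_single b]
  · simp
  · intro d _ hd
    simp [hd.symm]
  · simp
  · intro c _ hc
    simp [hc.symm]
  · simp

variable {V : Type*} [AddCommGroup V] [Module ℂ V]

/-- The action of `gl(ℂ^ι)` on `V ⊗ Λ(ℂ^ι ⊗ ℂ^n)` for a `gl(ℂ^ι)`-module `V`: the matrix unit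
`E_{ab}` acts as `E_{ab} ⊗ 1 + ∑_k 1 ⊗ x_{ak} ∂_{bk}`. -/
noncomputable def eLie (n : ℕ) (ρ : gl ι →ₗ⁅ℂ⁆ Module.End ℂ V) :
    gl ι →ₗ⁅ℂ⁆ Module.End ℂ (V ⊗[ℂ] Grass ι n) :=
  tensorRep ρ (grassRep ι n)

/-- The matrix whose entry at `(a, b)` is the operator `E_{ba} ⊗ 1` on `V ⊗ Λ(ℂ^ι ⊗ ℂ^n)`.
The entry at `(c_0, c_s)` of its `s`-th power is
`∑ E_{c_1 c_0} E_{c_2 c_1} ⋯ E_{c_s c_{s-1}} ⊗ 1`, summed over `c_1, …, c_{s-1}`. -/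
noncomputable def eMat (n : ℕ) (ρ : gl ι →ₗ⁅ℂ⁆ Module.End ℂ V) :
    Matrix ι ι (Module.End ℂ (V ⊗[ℂ] Grass ι n)) :=
  Matrix.of fun a b => (ρ (Matrix.single b a 1)).rTensor (Grass ι n)

/-- The operators by which the `T_{ij}^{(s)}` act on `V ⊗ Λ(ℂ^ι ⊗ ℂ^n)`: the generator
`T_{ij}^{(s+1)}` acts as
`∑ E_{c_1 c_0} E_{c_2 c_1} ⋯ E_{c_s c_{s-1}} ⊗ x_{c_0 i} ∂_{c_s j}`,
summed over `c_0, c_1, …, c_s`. -/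
noncomputable def eT (n : ℕ) (ρ : gl ι →ₗ⁅ℂ⁆ Module.End ℂ V) :
    ℕ → Fin n → Fin n → Module.End ℂ (V ⊗[ℂ] Grass ι n) :=
  glT (eMat n ρ) (fun a i => (gx a i).lTensor V) (fun a i => (gd a i).lTensor V)

theorem lie_single_single (a b c d : ι) :
    ⁅(Matrix.single b a 1 : gl ι), (Matrix.single d c 1 : gl ι)⁆
      = (if a = d then Matrix.single b c 1 else 0) - (if c = b then Matrix.single d a 1 else 0) := by
  rw [LieRing.of_associative_ring_bracket]
  by_cases h : a = d <;> by_cases h' : c = b <;> simp [h, h']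

theorem eMat_comm (n : ℕ) (ρ : gl ι →ₗ⁅ℂ⁆ Module.End ℂ V) (a b c d : ι) :
    eMat n ρ a b * eMat n ρ c d - eMat n ρ c d * eMat n ρ a b
      = (if a = d then eMat n ρ c b else 0) - (if c = b then eMat n ρ a d else 0) := by
  have h := ρ.map_lie (Matrix.single b a 1) (Matrix.single d c 1)
  rw [lie_single_single, LieRing.of_associative_ring_bracket] at h
  simp only [eMat, Matrix.of_apply, ← LinearMap.rTensor_mul, ← LinearMap.rTensor_sub]
  rw [← h]
  by_cases h : a = d <;> by_cases h' : c = b <;> simp [h, h', LinearMap.rTensor_sub]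

theorem rTensor_lTensor_comm {M N : Type*} [AddCommGroup M] [Module ℂ M] [AddCommGroup N]
    [Module ℂ N] (f : Module.End ℂ M) (g : Module.End ℂ N) :
    f.rTensor N * g.lTensor M = g.lTensor M * f.rTensor N :=
  TensorProduct.ext' fun v w => by simp

theorem eT_family (n : ℕ) (ρ : gl ι →ₗ⁅ℂ⁆ Module.End ℂ V) : IsYangFamily (eT n ρ) := by
  refine glT_family (eMat_comm n ρ) (fun a b c i => rTensor_lTensor_comm _ _)
    (fun a b c i => rTensor_lTensor_comm _ _) ?_ ?_ ?_
  · intro a i b j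
    rw [← LinearMap.lTensor_mul, gx_gx, LinearMap.lTensor_neg, LinearMap.lTensor_mul]
  · intro a i b j
    rw [← LinearMap.lTensor_mul, gd_gd, LinearMap.lTensor_neg, LinearMap.lTensor_mul]
  · intro a i b j
    rw [← LinearMap.lTensor_mul, ← LinearMap.lTensor_mul, gd_gx, LinearMap.lTensor_sub]
    refine congrArg₂ (· - ·) ?_ rfl
    split_ifs
    · exact LinearMap.lTensor_id _ _
    · exact LinearMap.lTensor_zero _

/-- The action of the Yangian on `E(V) = V ⊗ Λ(ℂ^ι ⊗ ℂ^n)`. -/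
noncomputable def eYang (n : ℕ) (ρ : gl ι →ₗ⁅ℂ⁆ Module.End ℂ V) :
    Yangian n →ₐ[ℂ] Module.End ℂ (V ⊗[ℂ] Grass ι n) :=
  yLift (eT_family n ρ)

theorem eT_eLie (n : ℕ) (ρ : gl ι →ₗ⁅ℂ⁆ Module.End ℂ V) (s : ℕ) (i j : Fin n) (X : gl ι) :
    eT n ρ s i j * eLie n ρ X = eLie n ρ X * eT n ρ s i j := by
  induction X using Matrix.induction_on' with
  | h_zero => simp
  | h_add X Y hX hY => rw [map_add, mul_add, add_mul, hX, hY]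
  | h_std_basis p q c =>
    rw [show (Matrix.single p q c : gl ι) = c • Matrix.single p q 1 by simp, map_smul,
      mul_smul_comm, smul_mul_assoc]
    congr 1
    have e : eLie n ρ (Matrix.single p q 1) = eMat n ρ q p + (gE n p q).lTensor V := by
      rw [← grassRep_single]
      rfl
    rw [e]
    refine glT_comm (eMat_comm n ρ) (fun a b c i => rTensor_lTensor_comm _ _)
      (fun a b c i => rTensor_lTensor_comm _ _) p q (fun a b => (rTensor_lTensor_comm _ _).symm)
      ?_ ?_ s i j
    · intro a i
      rw [← LinearMap.lTensor_mul, gE_gx, LinearMap.lTensor_add, LinearMap.lTensor_mul]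
      split_ifs <;> simp
    · intro a i
      rw [← LinearMap.lTensor_mul, gE_gd, LinearMap.lTensor_sub, LinearMap.lTensor_mul]
      split_ifs <;> simp

/-- The actions of the Yangian and of `gl(ℂ^ι)` on `E(V)` commute. -/
theorem eYang_eLie (n : ℕ) (ρ : gl ι →ₗ⁅ℂ⁆ Module.End ℂ V) (y : Yangian n) (X : gl ι) :
    eYang n ρ y * eLie n ρ X = eLie n ρ X * eYang n ρ y := by
  refine yHom_commute _ (fun s i j => ?_) y
  rw [eYang, yLift_yT, eT_eLie]

end

end bimod

/-! ### Parabolic induction -/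

section parabolic

theorem fromBlocks_sub' {o p : Type*} (A A' : Matrix o o ℂ) (B B' : Matrix o p ℂ)
    (C C' : Matrix p o ℂ) (D D' : Matrix p p ℂ) :
    Matrix.fromBlocks A B C D - Matrix.fromBlocks A' B' C' D'
      = Matrix.fromBlocks (A - A') (B - B') (C - C') (D - D') := by
  ext i j
  rcases i with i | i <;> rcases j with j | j <;> rfl

variable (m l : ℕ)

/-- The parabolic subalgebra `𝔭 = gl_m ⊕ gl_l ⊕ 𝔮'` of block upper triangular matrices in
`gl_{m+l} = gl(ℂ^m ⊕ ℂ^l)`. -/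
def parab : LieSubalgebra ℂ (gl (Fin m ⊕ Fin l)) where
  carrier := {X | X.toBlocks₂₁ = 0}
  add_mem' {X Y} hX hY := by
    ext a b
    have h₁ := congrFun (congrFun hX a) b
    have h₂ := congrFun (congrFun hY a) b
    simp_all [Matrix.toBlocks₂₁]
  zero_mem' := rfl
  smul_mem' c X hX := by
    ext a b
    have h₁ := congrFun (congrFun hX a) b
    simp_all [Matrix.toBlocks₂₁]
  lie_mem' {X Y} hX hY := by
    change Matrix.toBlocks₂₁ X = 0 at hX
    change Matrix.toBlocks₂₁ Y = 0 at hY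
    change Matrix.toBlocks₂₁ (X * Y - Y * X) = 0
    rw [← Matrix.fromBlocks_toBlocks X, ← Matrix.fromBlocks_toBlocks Y, hX, hY,
      Matrix.fromBlocks_multiply, Matrix.fromBlocks_multiply, fromBlocks_sub']
    simp

/-- The Abelian subalgebra `𝔮` of strictly block lower triangular matrices, spanned by the matrix
units `E_{ba}` with `a ≤ m < b`. -/
def qAlg : LieSubalgebra ℂ (gl (Fin m ⊕ Fin l)) where
  carrier := {X | ∃ C : Matrix (Fin l) (Fin m) ℂ, X = Matrix.fromBlocks 0 0 C 0}
  add_mem' := by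
    rintro _ _ ⟨C, rfl⟩ ⟨D, rfl⟩
    exact ⟨C + D, by simp [Matrix.fromBlocks_add]⟩
  zero_mem' := ⟨0, by simp⟩
  smul_mem' := by
    rintro c _ ⟨C, rfl⟩
    exact ⟨c • C, by simp [Matrix.fromBlocks_smul]⟩
  lie_mem' := by
    rintro _ _ ⟨C, rfl⟩ ⟨D, rfl⟩
    refine ⟨0, ?_⟩
    rw [LieRing.of_associative_ring_bracket]
    simp [Matrix.fromBlocks_multiply]

/-- The projection of `𝔭` to `gl_m ⊕ gl_l` with kernel `𝔮'`. -/
def leviProj : parab m l →ₗ⁅ℂ⁆ gl (Fin m) × gl (Fin l) where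
  toFun X := ((X : gl (Fin m ⊕ Fin l)).toBlocks₁₁, (X : gl (Fin m ⊕ Fin l)).toBlocks₂₂)
  map_add' X Y := rfl
  map_smul' c X := rfl
  map_lie' {X Y} := by
    obtain ⟨X, hX⟩ := X
    obtain ⟨Y, hY⟩ := Y
    change X.toBlocks₂₁ = 0 at hX
    change Y.toBlocks₂₁ = 0 at hY
    change ((X * Y - Y * X).toBlocks₁₁, (X * Y - Y * X).toBlocks₂₂)
      = (X.toBlocks₁₁ * Y.toBlocks₁₁ - Y.toBlocks₁₁ * X.toBlocks₁₁,
        X.toBlocks₂₂ * Y.toBlocks₂₂ - Y.toBlocks₂₂ * X.toBlocks₂₂)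
    rw [← Matrix.fromBlocks_toBlocks X, ← Matrix.fromBlocks_toBlocks Y, hX, hY,
      Matrix.fromBlocks_multiply, Matrix.fromBlocks_multiply, fromBlocks_sub']
    simp

/-- The embedding of `gl_m ⊕ gl_l` in `gl_{m+l}` as the block diagonal matrices. -/
def levi : gl (Fin m) × gl (Fin l) →ₗ⁅ℂ⁆ gl (Fin m ⊕ Fin l) where
  toFun Z := Matrix.fromBlocks Z.1 0 0 Z.2
  map_add' Z W := by simp [Matrix.fromBlocks_add]
  map_smul' c Z := by simp [Matrix.fromBlocks_smul]
  map_lie' {Z W} := by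
    simp only [LieRing.of_associative_ring_bracket,
      Matrix.fromBlocks_multiply, fromBlocks_sub']
    simp

theorem levi_qAlg (Z : gl (Fin m) × gl (Fin l)) (X : gl (Fin m ⊕ Fin l)) (hX : X ∈ qAlg m l) :
    ⁅levi m l Z, X⁆ ∈ qAlg m l := by
  obtain ⟨C, rfl⟩ := hX
  refine ⟨Z.2 * C - C * Z.1, ?_⟩
  change Matrix.fromBlocks Z.1 0 0 Z.2 * Matrix.fromBlocks 0 0 C 0
    - Matrix.fromBlocks 0 0 C 0 * Matrix.fromBlocks Z.1 0 0 Z.2 = _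
  simp [Matrix.fromBlocks_multiply, fromBlocks_sub']

variable {m l}
variable {V : Type*} [AddCommGroup V] [Module ℂ V] {U : Type*} [AddCommGroup U] [Module ℂ U]

/-- The `𝔭`-module `V ⊗ U`, on which `𝔮'` acts as zero. -/
noncomputable def parabRep (ρ : gl (Fin m) →ₗ⁅ℂ⁆ Module.End ℂ V)
    (σ : gl (Fin l) →ₗ⁅ℂ⁆ Module.End ℂ U) : parab m l →ₗ⁅ℂ⁆ Module.End ℂ (V ⊗[ℂ] U) :=
  (outerRep ρ σ).comp (leviProj m l)

/-- The space of the parabolically induced module `V ⊠ U`. -/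
abbrev Box (ρ : gl (Fin m) →ₗ⁅ℂ⁆ Module.End ℂ V) (σ : gl (Fin l) →ₗ⁅ℂ⁆ Module.End ℂ U) : Type _ :=
  Ind (parab m l) (parabRep ρ σ)

/-- The action of `gl_{m+l}` on the parabolically induced module `V ⊠ U`. -/
noncomputable def boxRep (ρ : gl (Fin m) →ₗ⁅ℂ⁆ Module.End ℂ V)
    (σ : gl (Fin l) →ₗ⁅ℂ⁆ Module.End ℂ U) :
    gl (Fin m ⊕ Fin l) →ₗ⁅ℂ⁆ Module.End ℂ (Box ρ σ) :=
  indRep (parab m l) (parabRep ρ σ)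

/-- The space of `𝔮`-coinvariants of `E_{m+l}(V ⊠ U)`. -/
abbrev BoxCoinv (n : ℕ) (ρ : gl (Fin m) →ₗ⁅ℂ⁆ Module.End ℂ V)
    (σ : gl (Fin l) →ₗ⁅ℂ⁆ Module.End ℂ U) : Type _ :=
  Coinv (eLie n (boxRep ρ σ)) (qAlg m l)

/-- The action of the Yangian on the `𝔮`-coinvariants of `E_{m+l}(V ⊠ U)`. -/
noncomputable def boxCoinvYang (n : ℕ) (ρ : gl (Fin m) →ₗ⁅ℂ⁆ Module.End ℂ V)
    (σ : gl (Fin l) →ₗ⁅ℂ⁆ Module.End ℂ U) :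
    Yangian n →ₐ[ℂ] Module.End ℂ (BoxCoinv n ρ σ) :=
  coinvAlg (eLie n (boxRep ρ σ)) (qAlg m l) (eYang n (boxRep ρ σ)) (eYang_eLie n (boxRep ρ σ))

/-- The action of `gl_m ⊕ gl_l` on the `𝔮`-coinvariants of `E_{m+l}(V ⊠ U)`. -/
noncomputable def boxCoinvLie (n : ℕ) (ρ : gl (Fin m) →ₗ⁅ℂ⁆ Module.End ℂ V)
    (σ : gl (Fin l) →ₗ⁅ℂ⁆ Module.End ℂ U) :
    gl (Fin m) × gl (Fin l) →ₗ⁅ℂ⁆ Module.End ℂ (BoxCoinv n ρ σ) :=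
  coinvLie (eLie n (boxRep ρ σ)) (qAlg m l) (levi m l) (levi_qAlg m l)

/-- The tensor product of two modules over the Yangian, through the comultiplication. -/
noncomputable def yTensor {n : ℕ} {M N : Type*} [AddCommGroup M] [Module ℂ M] [AddCommGroup N]
    [Module ℂ N] (f : Yangian n →ₐ[ℂ] Module.End ℂ M) (g : Yangian n →ₐ[ℂ] Module.End ℂ N) :
    Yangian n →ₐ[ℂ] Module.End ℂ (M ⊗[ℂ] N) :=
  (Module.endTensorEndAlgHom (R := ℂ) (S := ℂ) (A := ℂ) (M := M) (N := N)).comp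
    ((Algebra.TensorProduct.map f g).comp (yComul n))

/-- The action of the Yangian on `E_ι^z(V)`: the action on `E_ι(V)` pulled back through
`τ_{-z}`. -/
noncomputable def eYangShift {ι : Type} [Fintype ι] [DecidableEq ι] (n : ℕ) (z : ℂ)
    (ρ : gl ι →ₗ⁅ℂ⁆ Module.End ℂ V) : Yangian n →ₐ[ℂ] Module.End ℂ (V ⊗[ℂ] Grass ι n) :=
  (eYang n ρ).comp (yShift n (-z))

end parabolic

end YangInd

/-! Put N = V ⊗ U and let Λ be the Grassmann algebra of ℂ^(m+l) ⊗ ℂ^n. Over the commutative algebra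
U(𝔮) the module V ⊠ U is free on 1 ⊗ N, and in the coinvariants Zx ⊗ ω ≡ -x ⊗ Zω for Z ∈ 𝔮. Hence
every class has a unique representative in N ⊗ Λ. The proof does not use the PBW theorem. Existence
(`coinvVac_surjective`) holds because 𝔮 alone generates V ⊠ U from 1 ⊗ N (`ind_parab_eq_top`). For
uniqueness, gl_{m+l} is made to act on polynomials in y_{ba} with coefficients in N, with E_{ba} ∈ 𝔮
acting as multiplication by y_{ba} (`fockRep`). Frobenius reciprocity maps V ⊠ U to this model, and
substituting the operators -E_{ba} on Λ for the y_{ba} gives a left inverse of N ⊗ Λ → coinvariants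
(`coinvEval_coinvVac`).

For the Yangian, let P be the matrix with P_{ab} = E_{ba}, so that T_{ij}^{(s+1)} is the sum of
(P^s)_{ab} ⊗ x_{ai} ∂_{bj}. On 1 ⊗ N the lower left block of P lies in 𝔮' and vanishes, and the
diagonal blocks act as the analogous matrices A of gl_m and D of gl_l. The entries of the upper
right block lie in 𝔮. Moving them to the left through a power of P costs one commutator for each of
m indices, which replaces D by D - m; this is the origin of the shift in the second factor. With
sums over p + q = s and repeated indices, on 1 ⊗ N (P^(s+1))_{ad} = ∑ P_{ec} (A^p)_{ae}
((D-m)^q)_{cd} for a ≤ m < d, (P^(s+1))_{bd} = ((D-m)^(s+1))_{bd} + ∑ tr(A^p) ((D-m)^q)_{bd} for b,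
d > m (`blockPow_left_right`, `blockPow_right_right`). In the coinvariants P_{ec} turns into -∑_k
x_{ck} ∂_{ek} on Λ. Commuting this past x_{ai} produces a term that cancels the traces, and what is
left is ∑_k T_{ik} T_{kj}, the comultiplication (`contract_swap`, `tensT_block`).

Finally Λ is the product of the Grassmann algebras of the two blocks. Only even operators x ∂ within
one block remain, so each acts on its own tensor factor without a sign. -/

namespace YangInd

/-! ### The Grassmann algebra of a direct sum -/

section grass

variable {ι κ : Type} {n : ℕ}

/-- The variables `x_{ai}` with `a ∈ ι ⊕ κ` are those with `a ∈ ι` and those with `a ∈ κ`. -/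
noncomputable def sumVec (ι κ : Type) (n : ℕ) :
    ((ι × Fin n → ℂ) × (κ × Fin n → ℂ)) ≃ₗ[ℂ] ((ι ⊕ κ) × Fin n → ℂ) :=
  (LinearEquiv.sumArrowLequivProdArrow _ _ ℂ ℂ).symm.trans
    (LinearEquiv.funCongrLeft ℂ ℂ (Equiv.sumProdDistrib ι κ (Fin n)))

theorem sumVec_inl (v : (ι × Fin n → ℂ) × (κ × Fin n → ℂ)) (a : ι) (i : Fin n) :
    sumVec ι κ n v (Sum.inl a, i) = v.1 (a, i) := rfl

theorem sumVec_inr (v : (ι × Fin n → ℂ) × (κ × Fin n → ℂ)) (a : κ) (i : Fin n) :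
    sumVec ι κ n v (Sum.inr a, i) = v.2 (a, i) := rfl

/-- The embedding of the Grassmann algebra of the first summand. -/
noncomputable def grassInl (ι κ : Type) (n : ℕ) : Grass ι n →ₐ[ℂ] Grass (ι ⊕ κ) n :=
  ExteriorAlgebra.map ((sumVec ι κ n).toLinearMap ∘ₗ LinearMap.inl ℂ _ _)

/-- The embedding of the Grassmann algebra of the second summand. -/
noncomputable def grassInr (ι κ : Type) (n : ℕ) : Grass κ n →ₐ[ℂ] Grass (ι ⊕ κ) n :=
  ExteriorAlgebra.map ((sumVec ι κ n).toLinearMap ∘ₗ LinearMap.inr ℂ _ _)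

theorem grassInl_ι (v : ι × Fin n → ℂ) :
    grassInl ι κ n (ExteriorAlgebra.ι ℂ v) = ExteriorAlgebra.ι ℂ (sumVec ι κ n (v, 0)) :=
  ExteriorAlgebra.map_apply_ι _ _

theorem grassInr_ι (v : κ × Fin n → ℂ) :
    grassInr ι κ n (ExteriorAlgebra.ι ℂ v) = ExteriorAlgebra.ι ℂ (sumVec ι κ n (0, v)) :=
  ExteriorAlgebra.map_apply_ι _ _

theorem prod_zero_zero :
    (0 : QuadraticForm ℂ (ι × Fin n → ℂ)).prod (0 : QuadraticForm ℂ (κ × Fin n → ℂ)) = 0 := by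
  ext v
  simp

/-- The Clifford algebra of the zero form on a direct sum, as a Grassmann algebra. -/
noncomputable def cliffordSumEquiv (ι κ : Type) (n : ℕ) :
    CliffordAlgebra ((0 : QuadraticForm ℂ (ι × Fin n → ℂ)).prod
      (0 : QuadraticForm ℂ (κ × Fin n → ℂ))) ≃ₐ[ℂ] Grass (ι ⊕ κ) n :=
  CliffordAlgebra.equivOfIsometry
    { sumVec ι κ n with
      map_app' := fun v => by rw [prod_zero_zero]; rfl }

/-- The isomorphism `Λ(ℂ^ι ⊗ ℂ^n) ⊗ Λ(ℂ^κ ⊗ ℂ^n) → Λ(ℂ^(ι ⊕ κ) ⊗ ℂ^n)` of vector spaces. -/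
noncomputable def grassMul (ι κ : Type) (n : ℕ) :
    (Grass ι n ⊗[ℂ] Grass κ n) ≃ₗ[ℂ] Grass (ι ⊕ κ) n :=
  (GradedTensorProduct.of ℂ (CliffordAlgebra.evenOdd (0 : QuadraticForm ℂ (ι × Fin n → ℂ)))
      (CliffordAlgebra.evenOdd (0 : QuadraticForm ℂ (κ × Fin n → ℂ)))).trans
    ((CliffordAlgebra.prodEquiv _ _).symm.toLinearEquiv.trans
      (cliffordSumEquiv ι κ n).toLinearEquiv)

/-- With the isomorphism written as a product inside the large Grassmann algebra, operators can be
computed by induction on the left factor, one generator at a time. -/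
theorem grassMul_tmul (ω : Grass ι n) (η : Grass κ n) :
    grassMul ι κ n (ω ⊗ₜ η) = grassInl ι κ n ω * grassInr ι κ n η := by
  have h₁ : ((cliffordSumEquiv ι κ n).toAlgHom.comp (CliffordAlgebra.map (.inl _ _)))
      = grassInl ι κ n := by
    refine CliffordAlgebra.hom_ext (LinearMap.ext fun v => ?_)
    refine Eq.trans ?_ (grassInl_ι v).symm
    simp [cliffordSumEquiv]
    rfl
  have h₂ : ((cliffordSumEquiv ι κ n).toAlgHom.comp (CliffordAlgebra.map (.inr _ _)))
      = grassInr ι κ n := by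
    refine CliffordAlgebra.hom_ext (LinearMap.ext fun v => ?_)
    refine Eq.trans ?_ (grassInr_ι v).symm
    simp [cliffordSumEquiv]
    rfl
  rw [← h₁, ← h₂]
  -- The inverse of `CliffordAlgebra.prodEquiv` is `CliffordAlgebra.toProd`, which multiplies the
  -- images of the two factors.
  change cliffordSumEquiv ι κ n (CliffordAlgebra.toProd _ _ (ω ᵍ⊗ₜ[ℂ] η)) = _
  rw [CliffordAlgebra.toProd, GradedTensorProduct.lift_tmul, map_mul]
  rfl

theorem gd_ι_mul (a : ι) (i : Fin n) (v : ι × Fin n → ℂ) (ω : Grass ι n) :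
    gd a i (ExteriorAlgebra.ι ℂ v * ω)
      = v (a, i) • ω - ExteriorAlgebra.ι ℂ v * gd a i ω :=
  CliffordAlgebra.contractLeft_ι_mul (Q := (0 : QuadraticForm ℂ (ι × Fin n → ℂ))) _ _ _

theorem gd_algebraMap_mul (a : ι) (i : Fin n) (c : ℂ) (ω : Grass ι n) :
    gd a i (algebraMap ℂ _ c * ω) = algebraMap ℂ _ c * gd a i ω :=
  CliffordAlgebra.contractLeft_algebraMap_mul _ _ _

theorem gd_algebraMap (a : ι) (i : Fin n) (c : ℂ) :
    gd a i (algebraMap ℂ (Grass ι n) c) = 0 :=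
  CliffordAlgebra.contractLeft_algebraMap _ _ _

/-- No variable of the first block occurs in an element of the second Grassmann algebra. -/
theorem gd_inl_grassInr (a : ι) (i : Fin n) (η : Grass κ n) :
    gd (Sum.inl a) i (grassInr ι κ n η) = 0 := by
  induction η using CliffordAlgebra.left_induction with
  | algebraMap c => rw [AlgHom.commutes, gd_algebraMap]
  | add x y hx hy => rw [map_add, map_add, hx, hy, add_zero]
  | ι_mul x v hx =>
    rw [map_mul, show grassInr ι κ n (CliffordAlgebra.ι 0 v) = _ from grassInr_ι v, gd_ι_mul, hx,
      sumVec_inl]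
    simp

theorem gd_inr_grassInr (a : κ) (i : Fin n) (η : Grass κ n) :
    gd (Sum.inr a) i (grassInr ι κ n η) = grassInr ι κ n (gd a i η) := by
  induction η using CliffordAlgebra.left_induction with
  | algebraMap c => rw [AlgHom.commutes, gd_algebraMap, gd_algebraMap, map_zero]
  | add x y hx hy => simp only [map_add, hx, hy]
  | ι_mul x v hx =>
    rw [map_mul, show grassInr ι κ n (CliffordAlgebra.ι 0 v) = _ from grassInr_ι v, gd_ι_mul, hx,
      sumVec_inr, show gd a i (CliffordAlgebra.ι 0 v * x) = _ from gd_ι_mul a i v x, map_sub,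
      map_smul, map_mul, grassInr_ι]

/-- A left derivation meets the first factor first, so no sign appears. A derivation of the second
block would acquire the parity of ω; for that block only the even products x ∂ are compared. -/
theorem gd_inl_grassMul (a : ι) (i : Fin n) (ω : Grass ι n) (η : Grass κ n) :
    gd (Sum.inl a) i (grassMul ι κ n (ω ⊗ₜ η)) = grassMul ι κ n (gd a i ω ⊗ₜ η) := by
  rw [grassMul_tmul, grassMul_tmul]
  induction ω using CliffordAlgebra.left_induction with
  | algebraMap c =>
    rw [AlgHom.commutes, gd_algebraMap_mul, gd_inl_grassInr, gd_algebraMap, map_zero, zero_mul,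
      mul_zero]
  | add x y hx hy => simp only [map_add, add_mul, hx, hy]
  | ι_mul x v hx =>
    rw [map_mul (grassInl ι κ n), show grassInl ι κ n (CliffordAlgebra.ι 0 v) = _ from grassInl_ι v,
        mul_assoc,
      gd_ι_mul, hx, sumVec_inl, show gd a i (CliffordAlgebra.ι 0 v * x) = _ from gd_ι_mul a i v x,
      map_sub, map_smul, map_mul, grassInl_ι, sub_mul, smul_mul_assoc, mul_assoc]

variable [DecidableEq ι] [DecidableEq κ]

theorem sumVec_single_inl (a : ι) (i : Fin n) :
    sumVec ι κ n (Pi.single (a, i) 1, 0) = Pi.single (Sum.inl a, i) 1 := by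
  funext ⟨b, j⟩
  cases b <;> simp [sumVec_inl, sumVec_inr, Pi.single_apply]

theorem sumVec_single_inr (a : κ) (i : Fin n) :
    sumVec ι κ n (0, Pi.single (a, i) 1) = Pi.single (Sum.inr a, i) 1 := by
  funext ⟨b, j⟩
  cases b <;> simp [sumVec_inl, sumVec_inr, Pi.single_apply]

theorem gx_inl_grassMul (a : ι) (i : Fin n) (ω : Grass ι n) (η : Grass κ n) :
    gx (Sum.inl a) i (grassMul ι κ n (ω ⊗ₜ η)) = grassMul ι κ n (gx a i ω ⊗ₜ η) := by
  rw [grassMul_tmul, grassMul_tmul, gx, gx, LinearMap.mulLeft_apply, LinearMap.mulLeft_apply,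
    map_mul, grassInl_ι, sumVec_single_inl, mul_assoc]

/-- The even operators `x_{ai} ∂_{bj}` with `a, b ∈ ι` act on the first tensor factor. -/
theorem gx_gd_inl_grassMul (a b : ι) (i j : Fin n) (t : Grass ι n ⊗[ℂ] Grass κ n) :
    (gx (Sum.inl a) i * gd (Sum.inl b) j : Module.End ℂ (Grass (ι ⊕ κ) n))
        (grassMul ι κ n t)
      = grassMul ι κ n ((gx a i * gd b j).rTensor _ t) := by
  induction t with
  | zero => simp
  | add s t hs ht => simp only [map_add, hs, ht]
  | tmul ω η =>
    rw [Module.End.mul_apply, gd_inl_grassMul, gx_inl_grassMul]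
    rfl

/-- The even operators `x_{ai} ∂_{bj}` with `a, b ∈ κ` act on the second tensor factor. -/
theorem gx_gd_inr_grassMul (a b : κ) (i j : Fin n) (t : Grass ι n ⊗[ℂ] Grass κ n) :
    (gx (Sum.inr a) i * gd (Sum.inr b) j : Module.End ℂ (Grass (ι ⊕ κ) n))
        (grassMul ι κ n t)
      = grassMul ι κ n ((gx a i * gd b j).lTensor _ t) := by
  induction t with
  | zero => simp
  | add s t hs ht => simp only [map_add, hs, ht]
  | tmul ω η =>
    rw [LinearMap.lTensor_tmul, Module.End.mul_apply, Module.End.mul_apply, grassMul_tmul,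
      grassMul_tmul]
    induction ω using CliffordAlgebra.left_induction with
    | algebraMap c =>
      rw [AlgHom.commutes, ← Algebra.smul_def, ← Algebra.smul_def, map_smul, map_smul,
        gd_inr_grassInr, gx, gx, LinearMap.mulLeft_apply, LinearMap.mulLeft_apply, map_mul,
        grassInr_ι, sumVec_single_inr]
    | add x y hx hy => simp only [map_add, add_mul, hx, hy]
    | ι_mul x v hx =>
      -- A generator of the first block anticommutes with the derivation and with the variable of
      -- the second block; the two signs cancel.
      rw [map_mul (grassInl ι κ n), show grassInl ι κ n (CliffordAlgebra.ι 0 v) = _ from grassInl_ι v,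
        mul_assoc,
        mul_assoc, ← hx, gd_ι_mul, sumVec_inr, gx, map_sub, LinearMap.mulLeft_apply,
        LinearMap.mulLeft_apply, LinearMap.mulLeft_apply, ← mul_assoc, ← mul_assoc,
        eq_neg_of_add_eq_zero_left (ExteriorAlgebra.ι_add_mul_swap (R := ℂ)
          (Pi.single (Sum.inr a, i) 1 : (ι ⊕ κ) × Fin n → ℂ) (sumVec ι κ n (v, 0)))]
      simp

end grass

/-! ### The polynomial model of the parabolically induced module -/

section fock

variable (m l : ℕ) (N : Type*) [AddCommGroup N] [Module ℂ N]

/-- Polynomials with coefficients in `N` on the space of `l × m` matrices. -/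
def Fock : Type _ := MvPolynomial (Fin l × Fin m) ℂ ⊗[ℂ] N

noncomputable instance : AddCommGroup (Fock m l N) :=
  inferInstanceAs (AddCommGroup (MvPolynomial (Fin l × Fin m) ℂ ⊗[ℂ] N))

noncomputable instance : Module ℂ (Fock m l N) :=
  inferInstanceAs (Module ℂ (MvPolynomial (Fin l × Fin m) ℂ ⊗[ℂ] N))

/-- Polynomials and coefficients as a bilinear map. -/
noncomputable def fmk : MvPolynomial (Fin l × Fin m) ℂ →ₗ[ℂ] N →ₗ[ℂ] Fock m l N :=
  TensorProduct.mk ℂ _ _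

/-- The operator of multiplication by a variable. -/
noncomputable def fy (b : Fin l) (a : Fin m) : Module.End ℂ (Fock m l N) :=
  (LinearMap.mulLeft ℂ (MvPolynomial.X (b, a))).rTensor N

/-- The operator of differentiation with respect to a variable. -/
noncomputable def fz (b : Fin l) (a : Fin m) : Module.End ℂ (Fock m l N) :=
  (MvPolynomial.pderiv (b, a)).toLinearMap.rTensor N

/-- The constant polynomials. -/
noncomputable def fvac : N →ₗ[ℂ] Fock m l N := fmk m l N 1

variable {m l N}

theorem fock_ext {M : Type*} [AddCommGroup M] [Module ℂ M] {f g : Fock m l N →ₗ[ℂ] M}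
    (h : ∀ p w, f (fmk m l N p w) = g (fmk m l N p w)) : f = g :=
  TensorProduct.ext' h

theorem fy_fmk (b : Fin l) (a : Fin m) (p : MvPolynomial (Fin l × Fin m) ℂ) (w : N) :
    fy m l N b a (fmk m l N p w) = fmk m l N (MvPolynomial.X (b, a) * p) w := rfl

theorem fz_fmk (b : Fin l) (a : Fin m) (p : MvPolynomial (Fin l × Fin m) ℂ) (w : N) :
    fz m l N b a (fmk m l N p w) = fmk m l N (MvPolynomial.pderiv (b, a) p) w := rfl

theorem fz_fvac (b : Fin l) (a : Fin m) (w : N) : fz m l N b a (fvac m l N w) = 0 := by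
  rw [fvac, fz_fmk, MvPolynomial.pderiv_one, map_zero, LinearMap.zero_apply]

theorem fy_fy (b : Fin l) (a : Fin m) (b' : Fin l) (a' : Fin m) :
    fy m l N b a * fy m l N b' a' = fy m l N b' a' * fy m l N b a :=
  fock_ext fun p w => by
    simp only [Module.End.mul_apply, fy_fmk]
    rw [mul_left_comm]

theorem fz_fy (b : Fin l) (a : Fin m) (b' : Fin l) (a' : Fin m) :
    fz m l N b a * fy m l N b' a'
      = fy m l N b' a' * fz m l N b a + if b = b' ∧ a = a' then 1 else 0 :=
  fock_ext fun p w => by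
    simp only [Module.End.mul_apply, LinearMap.add_apply, fy_fmk, fz_fmk, Derivation.leibniz,
      smul_eq_mul, MvPolynomial.pderiv_X, map_add]
    congr 1
    by_cases h : b = b' <;> by_cases h' : a = a' <;> simp [h, h', eq_comm]

/-- An operator that commutes with the variables and vanishes on the constants is zero. -/
theorem fock_eq_zero {O : Module.End ℂ (Fock m l N)}
    (h : ∀ b a, O * fy m l N b a = fy m l N b a * O)
    (h0 : ∀ w, O (fvac m l N w) = 0) : O = 0 := by
  refine fock_ext fun p w => ?_
  rw [LinearMap.zero_apply]
  induction p using MvPolynomial.induction_on with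
  | C c =>
    have e : fmk m l N (MvPolynomial.C c) w = c • fvac m l N w := by
      rw [fvac, ← LinearMap.smul_apply, ← map_smul, MvPolynomial.smul_eq_C_mul, mul_one]
    rw [e, map_smul, h0, smul_zero]
  | add p q hp hq => rw [map_add, LinearMap.add_apply, map_add, hp, hq, add_zero]
  | mul_X p v hp =>
    have e := LinearMap.congr_fun (h v.1 v.2) (fmk m l N p w)
    rw [Module.End.mul_apply, Module.End.mul_apply, hp, map_zero, fy_fmk] at e
    rw [mul_comm, ← e]

variable (τ : gl (Fin m) × gl (Fin l) →ₗ⁅ℂ⁆ Module.End ℂ N)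

/-- The action of `gl_m ⊕ gl_l` on the coefficients. -/
noncomputable def fcoef : gl (Fin m) × gl (Fin l) →ₗ[ℂ] Module.End ℂ (Fock m l N) :=
  LinearMap.lTensorHom (MvPolynomial (Fin l × Fin m) ℂ)
    ∘ₗ (τ : gl (Fin m) × gl (Fin l) →ₗ[ℂ] Module.End ℂ N)

theorem fcoef_fy (Z : gl (Fin m) × gl (Fin l)) (b : Fin l) (a : Fin m) :
    fcoef τ Z * fy m l N b a = fy m l N b a * fcoef τ Z :=
  fock_ext fun _ _ => rfl

theorem fcoef_fvac (Z : gl (Fin m) × gl (Fin l)) (w : N) :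
    fcoef τ Z (fvac m l N w) = fvac m l N (τ Z w) := rfl

/-- The operators by which the matrix units of `gl_{m+l}` act on the polynomials. -/
noncomputable def fockE : Fin m ⊕ Fin l → Fin m ⊕ Fin l → Module.End ℂ (Fock m l N)
  -- The entries are forced once 𝔮 acts by multiplication, 𝔮' kills the constants and the Levi
  -- subalgebra acts on them through N: a matrix unit is moved to the right through a monomial in 𝔮
  -- until it reaches N. In the upper right block two such passages are possible, whence second
  -- derivatives.
  | .inl a, .inl a' => fcoef τ (Matrix.single a a' 1, 0) - ∑ b, fy m l N b a' * fz m l N b a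
  | .inr b, .inr b' => fcoef τ (0, Matrix.single b b' 1) + ∑ a, fy m l N b a * fz m l N b' a
  | .inr b, .inl a => fy m l N b a
  | .inl a, .inr b => ∑ a', fcoef τ (Matrix.single a a' 1, 0) * fz m l N b a'
      - ∑ b', fcoef τ (0, Matrix.single b' b 1) * fz m l N b' a
      - ∑ a', ∑ b', fy m l N b' a' * (fz m l N b a' * fz m l N b' a)

/-- These are the brackets [E_{ij}, E_{ba}] with E_{ba} ∈ 𝔮, the only ones computed from the
explicit operators. All others follow from them by the Jacobi identity. -/
theorem fockE_fy (i j : Fin m ⊕ Fin l) (b : Fin l) (a : Fin m) :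
    fockE τ i j * fy m l N b a - fy m l N b a * fockE τ i j
      = (if j = .inr b then fockE τ i (.inl a) else 0)
        - (if .inl a = i then fockE τ (.inr b) j else 0) := by
  have h1 : ∀ c d e f, fy m l N c d * fz m l N e f * fy m l N b a
      = fy m l N b a * (fy m l N c d * fz m l N e f)
        + if e = b ∧ f = a then fy m l N c d else 0 := fun c d e f => by
    rw [mul_assoc, fz_fy, mul_add, ← mul_assoc, fy_fy c d b a, mul_assoc]
    simp
  have h2 : ∀ Z e f, fcoef τ Z * fz m l N e f * fy m l N b a
      = fy m l N b a * (fcoef τ Z * fz m l N e f)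
        + if e = b ∧ f = a then fcoef τ Z else 0 := fun Z e f => by
    rw [mul_assoc, fz_fy, mul_add, ← mul_assoc, fcoef_fy, mul_assoc]
    simp
  have h3 : ∀ c d e f g h, fy m l N c d * (fz m l N e f * fz m l N g h) * fy m l N b a
      = fy m l N b a * (fy m l N c d * (fz m l N e f * fz m l N g h))
        + ((if g = b ∧ h = a then fy m l N c d * fz m l N e f else 0)
        + if e = b ∧ f = a then fy m l N c d * fz m l N g h else 0) := fun c d e f g h => by
    rw [mul_assoc, mul_assoc, fz_fy, mul_add, ← mul_assoc (fz m l N e f), fz_fy, add_mul, mul_add,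
      mul_add, mul_assoc (fy m l N b a), ← mul_assoc (fy m l N c d), fy_fy c d b a, mul_assoc,
      add_assoc, add_comm (fy m l N c d * (_ * fz m l N g h))]
    congr 1
    split_ifs <;> simp
  rcases i with i | i <;> rcases j with j | j
  · simp only [fockE, sub_mul, mul_sub, Finset.sum_mul, Finset.mul_sum, h1, fcoef_fy,
      Finset.sum_add_distrib]
    by_cases h : i = a
    · simp [h]
    · simp [h, Ne.symm h]
  · simp only [fockE, sub_mul, mul_sub, Finset.sum_mul, Finset.mul_sum, h2, h3,
      Finset.sum_add_distrib]
    by_cases h : i = a <;> by_cases h' : j = b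
    · simp [h, h']
      abel
    · simp [h, h']
      abel
    · simp [h, Ne.symm h, h']
      abel
    · simp [h, Ne.symm h, h']
  · simp [fockE, fy_fy]
  · simp only [fockE, add_mul, mul_add, Finset.sum_mul, Finset.mul_sum, h1, fcoef_fy,
      Finset.sum_add_distrib]
    by_cases h : j = b <;> simp [h]

/-- The action of `gl_{m+l}` on the polynomials, as a linear map. -/
noncomputable def fockAct : gl (Fin m ⊕ Fin l) →ₗ[ℂ] Module.End ℂ (Fock m l N) where
  toFun X := ∑ i, ∑ j, X i j • fockE τ i j
  map_add' X Y := by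
    simp only [Matrix.add_apply, add_smul, Finset.sum_add_distrib]
  map_smul' c X := by
    simp only [Matrix.smul_apply, smul_eq_mul, mul_smul, Finset.smul_sum, RingHom.id_apply]

theorem fockAct_single (i j : Fin m ⊕ Fin l) : fockAct τ (Matrix.single i j 1) = fockE τ i j := by
  change ∑ c, ∑ d, (Matrix.single i j (1 : ℂ)) c d • fockE τ c d = _
  rw [Finset.sum_eq_single i, Finset.sum_eq_single j]
  · simp
  · intro d _ hd
    simp [hd.symm]
  · simp
  · intro c _ hc
    simp [hc.symm]
  · simp

/-- Derivatives kill constants, so of the operators in `fockE` only the coefficient action and the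
multiplications by variables survive. -/
theorem fockAct_fvac (X : gl (Fin m ⊕ Fin l)) (w : N) :
    fockAct τ X (fvac m l N w)
      = fvac m l N (τ (X.toBlocks₁₁, X.toBlocks₂₂) w)
        + ∑ b, ∑ a, X (.inr b) (.inl a) • fy m l N b a (fvac m l N w) := by
  have h11 : ∀ a a', fockE τ (.inl a) (.inl a') (fvac m l N w)
      = fvac m l N (τ (Matrix.single a a' 1, 0) w) := fun a a' => by
    simp [fockE, LinearMap.sum_apply, fz_fvac, fcoef_fvac]
  have h22 : ∀ b b', fockE τ (.inr b) (.inr b') (fvac m l N w)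
      = fvac m l N (τ (0, Matrix.single b b' 1) w) := fun b b' => by
    simp [fockE, LinearMap.sum_apply, fz_fvac, fcoef_fvac]
  have h12 : ∀ a b, fockE τ (.inl a) (.inr b) (fvac m l N w) = 0 := fun a b => by
    simp [fockE, LinearMap.sum_apply, fz_fvac]
  have e : τ (X.toBlocks₁₁, X.toBlocks₂₂)
      = ∑ a, ∑ a', X (.inl a) (.inl a') • τ (Matrix.single a a' 1, 0)
        + ∑ b, ∑ b', X (.inr b) (.inr b') • τ (0, Matrix.single b b' 1) := by
    simp only [← map_smul, ← map_sum, ← map_add]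
    congr 1
    refine Prod.ext ?_ ?_
    · simp only [Prod.fst_add, Prod.fst_sum, Prod.smul_fst, smul_zero, Finset.sum_const_zero,
        add_zero]
      conv_lhs => rw [Matrix.matrix_eq_sum_single X.toBlocks₁₁]
      simp [Matrix.toBlocks₁₁]
    · simp only [Prod.snd_add, Prod.snd_sum, Prod.smul_snd, smul_zero, Finset.sum_const_zero,
        zero_add]
      conv_lhs => rw [Matrix.matrix_eq_sum_single X.toBlocks₂₂]
      simp [Matrix.toBlocks₂₂]
  rw [e]
  simp only [fockAct, LinearMap.coe_mk, AddHom.coe_mk, LinearMap.sum_apply, LinearMap.smul_apply,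
    Fintype.sum_sum_type, LinearMap.add_apply, h11, h22, h12, smul_zero, Finset.sum_const_zero,
    map_add, map_sum, map_smul, Finset.sum_add_distrib]
  simp only [fockE]
  abel

theorem qAlg_induction {p : gl (Fin m ⊕ Fin l) → Prop} (h0 : p 0)
    (hadd : ∀ X Y, p X → p Y → p (X + Y)) (hsmul : ∀ (c : ℂ) X, p X → p (c • X))
    (hs : ∀ b a, p (Matrix.single (.inr b) (.inl a) 1)) {X : gl (Fin m ⊕ Fin l)}
    (hX : X ∈ qAlg m l) : p X := by
  obtain ⟨C, rfl⟩ := hX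
  induction C using Matrix.induction_on' with
  | h_zero => simpa using h0
  | h_add C D hC hD => simpa [Matrix.fromBlocks_add] using hadd _ _ hC hD
  | h_std_basis b a c =>
    have e : (Matrix.fromBlocks 0 0 (Matrix.single b a c) 0 : gl (Fin m ⊕ Fin l))
        = c • Matrix.single (.inr b) (.inl a) 1 := by
      ext (i | i) (j | j) <;> simp [Matrix.single_apply]
    rw [e]
    exact hsmul _ _ (hs b a)

theorem fockAct_lie_qAlg (X : gl (Fin m ⊕ Fin l)) {Z : gl (Fin m ⊕ Fin l)} (hZ : Z ∈ qAlg m l) :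
    fockAct τ ⁅X, Z⁆ = fockAct τ X * fockAct τ Z - fockAct τ Z * fockAct τ X := by
  refine qAlg_induction (p := fun Z => fockAct τ ⁅X, Z⁆
    = fockAct τ X * fockAct τ Z - fockAct τ Z * fockAct τ X) ?_ (fun Z W hZ hW => ?_)
    (fun c Z hZ => ?_) (fun b a => ?_) hZ
  · simp
  · rw [lie_add, map_add, map_add, hZ, hW, mul_add, add_mul]
    abel
  · rw [lie_smul, map_smul, map_smul, hZ, mul_smul_comm, smul_mul_assoc, smul_sub]
  · induction X using Matrix.induction_on' with
    | h_zero => simp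
    | h_add X Y hX hY =>
      rw [add_lie, map_add, map_add, hX, hY, mul_add, add_mul]
      abel
    | h_std_basis i j c =>
      rw [show (Matrix.single i j c : gl (Fin m ⊕ Fin l)) = c • Matrix.single i j 1 by simp,
        smul_lie, map_smul, map_smul, smul_mul_assoc, mul_smul_comm, ← smul_sub]
      congr 1
      rw [lie_single_single, fockAct_single, fockAct_single,
        show fockE τ (.inr b) (.inl a) = fy m l N b a from rfl, fockE_fy, map_sub]
      congr 1
      · split_ifs with h
        · rw [fockAct_single]
        · rw [map_zero]
      · split_ifs with h
        · rw [fockAct_single]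
        · rw [map_zero]

theorem fockAct_fy (b : Fin l) (a : Fin m) :
    fockAct τ (Matrix.single (.inr b) (.inl a) 1) = fy m l N b a :=
  fockAct_single τ _ _

theorem single_mem_qAlg (b : Fin l) (a : Fin m) :
    (Matrix.single (.inr b) (.inl a) 1 : gl (Fin m ⊕ Fin l)) ∈ qAlg m l := by
  refine ⟨Matrix.single b a 1, ?_⟩
  ext (i | i) (j | j) <;> simp [Matrix.single_apply]

/-- Compatibility with brackets propagates by the Jacobi identity. -/
theorem fockAct_lie_of {X Y : gl (Fin m ⊕ Fin l)} (hX : X ∈ parab m l) (hY : Y ∈ parab m l)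
    (h₁ : ∀ Z ∈ qAlg m l, fockAct τ ⁅X, ⁅Y, Z⁆⁆
      = fockAct τ X * fockAct τ ⁅Y, Z⁆ - fockAct τ ⁅Y, Z⁆ * fockAct τ X)
    (h₂ : ∀ Z ∈ qAlg m l, fockAct τ ⁅Y, ⁅X, Z⁆⁆
      = fockAct τ Y * fockAct τ ⁅X, Z⁆ - fockAct τ ⁅X, Z⁆ * fockAct τ Y) :
    fockAct τ ⁅X, Y⁆ = fockAct τ X * fockAct τ Y - fockAct τ Y * fockAct τ X := by
  rw [← sub_eq_zero]
  -- The defect of the bracket relation is an operator on polynomials; it vanishes if it commutes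
  -- with the variables and kills the constants.
  refine fock_eq_zero (fun b a => ?_) (fun w => ?_)
  · have hZ := single_mem_qAlg (m := m) (l := l) b a
    rw [← fockAct_fy τ]
    generalize (Matrix.single (.inr b) (.inl a) 1 : gl (Fin m ⊕ Fin l)) = Z at hZ
    -- Brackets with Z ∈ 𝔮 are already known, so ⁅⁅X, Y⁆, Z⁆ can be expanded by the Jacobi identity
    -- into brackets covered by `h₁` and `h₂`.
    have e := fockAct_lie_qAlg τ ⁅X, Y⁆ hZ
    rw [lie_lie, map_sub, h₁ Z hZ, h₂ Z hZ, fockAct_lie_qAlg τ X hZ,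
      fockAct_lie_qAlg τ Y hZ] at e
    rw [← sub_eq_zero] at e ⊢
    rw [← neg_eq_zero, ← e]
    noncomm_ring
  -- On constants 𝔭 acts through its projection to the Levi subalgebra, where τ respects brackets.
  · have hp : ∀ W ∈ parab m l, ∀ w, fockAct τ W (fvac m l N w)
        = fvac m l N (τ (W.toBlocks₁₁, W.toBlocks₂₂) w) := fun W hW w => by
      have h : ∀ b a, W (.inr b) (.inl a) = 0 := fun b a => congrFun (congrFun hW b) a
      simp [fockAct_fvac, h]
    have hτ := LinearMap.congr_fun
      ((τ.comp (leviProj m l)).map_lie (⟨X, hX⟩ : parab m l) ⟨Y, hY⟩) w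
    rw [LinearMap.sub_apply, LinearMap.sub_apply, Module.End.mul_apply, Module.End.mul_apply,
      hp _ ((parab m l).lie_mem hX hY), hp _ hX, hp _ hY, hp _ hX, hp _ hY, ← map_sub, sub_eq_zero]
    exact congrArg _ hτ

theorem block_decomp (X : gl (Fin m ⊕ Fin l)) :
    ∃ Y ∈ parab m l, ∃ Z ∈ qAlg m l, X = Y + Z :=
  ⟨Matrix.fromBlocks X.toBlocks₁₁ X.toBlocks₁₂ 0 X.toBlocks₂₂, Matrix.toBlocks_fromBlocks₂₁ _ _ _ _,
    Matrix.fromBlocks 0 0 X.toBlocks₂₁ 0, ⟨_, rfl⟩, by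
      conv_lhs => rw [← Matrix.fromBlocks_toBlocks X]
      simp [Matrix.fromBlocks_add]⟩

/-- The bracket of 𝔭 with 𝔮 has no component in 𝔮'. Hence a bracket of 𝔭 with 𝔭, tested against 𝔮,
leads back to the smaller Levi subalgebra, and inductions along 𝔮, Levi, 𝔭 terminate. -/
theorem parab_lie_qAlg {X Z : gl (Fin m ⊕ Fin l)} (hX : X ∈ parab m l) (hZ : Z ∈ qAlg m l) :
    ∃ (W : gl (Fin m) × gl (Fin l)), ∃ Z' ∈ qAlg m l, ⁅X, Z⁆ = levi m l W + Z' := by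
  obtain ⟨C, rfl⟩ := hZ
  change X.toBlocks₂₁ = 0 at hX
  refine ⟨(X.toBlocks₁₂ * C, -(C * X.toBlocks₁₂)), _,
    ⟨X.toBlocks₂₂ * C - C * X.toBlocks₁₁, rfl⟩, ?_⟩
  change _ = Matrix.fromBlocks (X.toBlocks₁₂ * C) 0 0 (-(C * X.toBlocks₁₂)) + _
  rw [← Matrix.fromBlocks_toBlocks X, hX, LieRing.of_associative_ring_bracket]
  simp [Matrix.fromBlocks_multiply, fromBlocks_sub', Matrix.fromBlocks_add]

theorem levi_mem_parab (W : gl (Fin m) × gl (Fin l)) : levi m l W ∈ parab m l :=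
  Matrix.toBlocks_fromBlocks₂₁ _ _ _ _

/-- The relation is known when one argument is in 𝔮. By `fockAct_lie_of` it then passes to Levi with
Levi, to 𝔭 with Levi and to 𝔭 with 𝔭: the inner bracket with an element of 𝔮 always falls into a
pair settled before. The decomposition gl_{m+l} = 𝔭 + 𝔮 gives the rest. -/
theorem fockAct_lie (X Y : gl (Fin m ⊕ Fin l)) :
    fockAct τ ⁅X, Y⁆ = fockAct τ X * fockAct τ Y - fockAct τ Y * fockAct τ X := by
  have hadd : ∀ X Y Z, fockAct τ ⁅X, Y⁆ = fockAct τ X * fockAct τ Y - fockAct τ Y * fockAct τ X →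
      fockAct τ ⁅X, Z⁆ = fockAct τ X * fockAct τ Z - fockAct τ Z * fockAct τ X →
      fockAct τ ⁅X, Y + Z⁆ = fockAct τ X * fockAct τ (Y + Z) - fockAct τ (Y + Z) * fockAct τ X := by
    intro X Y Z hY hZ
    rw [lie_add, map_add, map_add, hY, hZ]
    noncomm_ring
  have hswap : ∀ X Y, fockAct τ ⁅X, Y⁆ = fockAct τ X * fockAct τ Y - fockAct τ Y * fockAct τ X →
      fockAct τ ⁅Y, X⁆ = fockAct τ Y * fockAct τ X - fockAct τ X * fockAct τ Y := by
    intro X Y h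
    rw [← lie_skew, map_neg, h, neg_sub]
  have hll : ∀ W W', fockAct τ ⁅levi m l W, levi m l W'⁆ = fockAct τ (levi m l W)
      * fockAct τ (levi m l W') - fockAct τ (levi m l W') * fockAct τ (levi m l W) := fun W W' =>
    fockAct_lie_of τ (levi_mem_parab W) (levi_mem_parab W')
      (fun Z hZ => fockAct_lie_qAlg τ _ (levi_qAlg m l W' Z hZ))
      (fun Z hZ => fockAct_lie_qAlg τ _ (levi_qAlg m l W Z hZ))
  have hpl : ∀ X ∈ parab m l, ∀ W, fockAct τ ⁅X, levi m l W⁆ = fockAct τ X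
      * fockAct τ (levi m l W) - fockAct τ (levi m l W) * fockAct τ X := fun X hX W => by
    refine fockAct_lie_of τ hX (levi_mem_parab W)
      (fun Z hZ => fockAct_lie_qAlg τ _ (levi_qAlg m l W Z hZ)) (fun Z hZ => ?_)
    obtain ⟨W', Z', hZ', e⟩ := parab_lie_qAlg hX hZ
    rw [e]
    exact hadd _ _ _ (hll _ _) (fockAct_lie_qAlg τ _ hZ')
  have hpp : ∀ X ∈ parab m l, ∀ Y ∈ parab m l, fockAct τ ⁅X, Y⁆ = fockAct τ X
      * fockAct τ Y - fockAct τ Y * fockAct τ X := fun X hX Y hY => by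
    refine fockAct_lie_of τ hX hY (fun Z hZ => ?_) (fun Z hZ => ?_)
    · obtain ⟨W', Z', hZ', e⟩ := parab_lie_qAlg hY hZ
      rw [e]
      exact hadd _ _ _ (hpl _ hX _) (fockAct_lie_qAlg τ _ hZ')
    · obtain ⟨W', Z', hZ', e⟩ := parab_lie_qAlg hX hZ
      rw [e]
      exact hadd _ _ _ (hpl _ hY _) (fockAct_lie_qAlg τ _ hZ')
  obtain ⟨Y₁, hY₁, Y₂, hY₂, rfl⟩ := block_decomp Y
  refine hadd _ _ _ (hswap _ _ ?_) (fockAct_lie_qAlg τ _ hY₂)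
  obtain ⟨X₁, hX₁, X₂, hX₂, rfl⟩ := block_decomp X
  exact hadd _ _ _ (hpp _ hY₁ _ hX₁) (fockAct_lie_qAlg τ _ hX₂)

/-- The action of `gl_{m+l}` on the polynomials with coefficients in a `gl_m ⊕ gl_l`-module. -/
noncomputable def fockRep : gl (Fin m ⊕ Fin l) →ₗ⁅ℂ⁆ Module.End ℂ (Fock m l N) :=
  { fockAct τ with
    map_lie' := fun {X Y} => fockAct_lie τ X Y }

/-- This is the condition under which Frobenius reciprocity yields a map from the induced module to
the polynomial model. -/
theorem fockRep_parab (X : parab m l) (w : N) :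
    fockRep τ X (fvac m l N w) = fvac m l N (τ (leviProj m l X) w) := by
  have h : ∀ b a, (X : gl (Fin m ⊕ Fin l)) (.inr b) (.inl a) = 0 :=
    fun b a => congrFun (congrFun X.2 b) a
  refine (fockAct_fvac τ X w).trans ?_
  simp only [h, zero_smul, Finset.sum_const_zero, add_zero]
  rfl

end fock

/-! ### Induced modules -/

section induced

variable {L : Type*} [LieRing L] [LieAlgebra ℂ L] {N : Type*} [AddCommGroup N] [Module ℂ N]
  (p : LieSubalgebra ℂ L) (σ : p →ₗ⁅ℂ⁆ Module.End ℂ N)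

/-- The canonical map `w ↦ 1 ⊗ w` to the induced module. -/
noncomputable def indVac : N →ₗ[ℂ] Ind p σ :=
  (indRel p σ).mkQ ∘ₗ TensorProduct.mk ℂ (UniversalEnvelopingAlgebra ℂ L) N 1

theorem indRep_mk (X : L) (u : UniversalEnvelopingAlgebra ℂ L) (w : N) :
    indRep p σ X ((indRel p σ).mkQ (u ⊗ₜ w))
      = (indRel p σ).mkQ ((UniversalEnvelopingAlgebra.ι ℂ X * u) ⊗ₜ w) := rfl

theorem indRep_indVac (X : p) (w : N) : indRep p σ X (indVac p σ w) = indVac p σ (σ X w) := by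
  refine (indRep_mk p σ X 1 w).trans ?_
  refine (Submodule.Quotient.eq _).2 (Submodule.subset_span ⟨1, X, w, ?_⟩)
  rw [one_mul, mul_one]
  rfl

/-- The enveloping algebra is generated by L: the canonical map L → S extends to U(L), and its
composition with the inclusion of S is the identity by the universal property. -/
theorem envelope_induction {S : Subalgebra ℂ (UniversalEnvelopingAlgebra ℂ L)}
    (h : ∀ X : L, UniversalEnvelopingAlgebra.ι ℂ X ∈ S) (u : UniversalEnvelopingAlgebra ℂ L) :
    u ∈ S := by
  let f : L →ₗ⁅ℂ⁆ S :=
    { toFun := fun X => ⟨UniversalEnvelopingAlgebra.ι ℂ X, h X⟩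
      map_add' := fun X Y => Subtype.ext (map_add _ X Y)
      map_smul' := fun c X => Subtype.ext (map_smul _ c X)
      map_lie' := fun {X Y} => Subtype.ext (LieHom.map_lie _ X Y) }
  have e : S.val.comp (UniversalEnvelopingAlgebra.lift ℂ f) = AlgHom.id ℂ _ := by
    refine UniversalEnvelopingAlgebra.hom_ext ℂ (LieHom.ext fun X => ?_)
    exact congrArg Subtype.val (UniversalEnvelopingAlgebra.lift_ι_apply ℂ f X)
  have e' : (UniversalEnvelopingAlgebra.lift ℂ f u : UniversalEnvelopingAlgebra ℂ L) = u :=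
    AlgHom.congr_fun e u
  rw [← e']
  exact (UniversalEnvelopingAlgebra.lift ℂ f u).2

/-- The induced module is generated by the image of the canonical map. -/
theorem ind_eq_top {Q : Submodule ℂ (Ind p σ)} (hv : ∀ w, indVac p σ w ∈ Q)
    (hQ : ∀ X, ∀ x ∈ Q, indRep p σ X x ∈ Q) (x : Ind p σ) : x ∈ Q := by
  -- The elements of U(L) whose left multiplication preserves the preimage of Q, tested on pure
  -- tensors.
  let S : Subalgebra ℂ (UniversalEnvelopingAlgebra ℂ L) :=
    { carrier := {u | ∀ u' w, (indRel p σ).mkQ (u' ⊗ₜ w) ∈ Q →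
        (indRel p σ).mkQ ((u * u') ⊗ₜ w) ∈ Q}
      mul_mem' := fun {a b} ha hb u' w hu => by
        rw [mul_assoc]
        exact ha _ _ (hb _ _ hu)
      add_mem' := fun {a b} ha hb u' w hu => by
        rw [add_mul, TensorProduct.add_tmul, map_add]
        exact Q.add_mem (ha _ _ hu) (hb _ _ hu)
      algebraMap_mem' := fun c u' w hu => by
        rw [← Algebra.smul_def, ← TensorProduct.smul_tmul', map_smul]
        exact Q.smul_mem c hu }
  obtain ⟨t, rfl⟩ := (indRel p σ).mkQ_surjective x
  induction t with
  | zero => rw [map_zero]; exact Q.zero_mem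
  | add s t hs ht => rw [map_add]; exact Q.add_mem hs ht
  | tmul u w =>
    have h := envelope_induction (S := S) (fun X u' w hu => hQ X _ hu) u 1 w (hv w)
    rwa [mul_one] at h

section lift

variable {M : Type*} [AddCommGroup M] [Module ℂ M] (F : L →ₗ⁅ℂ⁆ Module.End ℂ M) (v : N →ₗ[ℂ] M)
  (h : ∀ (X : p) (w : N), F X (v w) = v (σ X w))

/-- The homomorphism from the induced module given by Frobenius reciprocity. -/
noncomputable def indLift : Ind p σ →ₗ[ℂ] M :=
  (indRel p σ).liftQ
    (TensorProduct.lift ((UniversalEnvelopingAlgebra.lift ℂ F).toLinearMap.compl₂ v)) (by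
      refine Submodule.span_le.2 ?_
      rintro _ ⟨u, X, w, rfl⟩
      rw [SetLike.mem_coe, LinearMap.mem_ker, map_sub, TensorProduct.lift.tmul,
        TensorProduct.lift.tmul, LinearMap.compl₂_apply, LinearMap.compl₂_apply, sub_eq_zero,
        AlgHom.toLinearMap_apply, AlgHom.toLinearMap_apply, map_mul,
        UniversalEnvelopingAlgebra.lift_ι_apply, Module.End.mul_apply, h])

theorem indLift_indVac (w : N) : indLift p σ F v h (indVac p σ w) = v w := by
  change UniversalEnvelopingAlgebra.lift ℂ F 1 (v w) = v w
  rw [map_one, Module.End.one_apply]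

theorem indLift_indRep (X : L) (x : Ind p σ) :
    indLift p σ F v h (indRep p σ X x) = F X (indLift p σ F v h x) := by
  obtain ⟨t, rfl⟩ := (indRel p σ).mkQ_surjective x
  induction t with
  | zero => simp only [map_zero]
  | add s t hs ht => simp only [map_add, hs, ht]
  | tmul u w =>
    change UniversalEnvelopingAlgebra.lift ℂ F (UniversalEnvelopingAlgebra.ι ℂ X * u) (v w)
      = F X (UniversalEnvelopingAlgebra.lift ℂ F u (v w))
    rw [map_mul, UniversalEnvelopingAlgebra.lift_ι_apply, Module.End.mul_apply]

end lift

end induced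

-- Pairwise commuting elements generate a commutative subalgebra, and there `MvPolynomial.aeval`,
-- which needs a commutative target, is available.
open scoped IsMulCommutative in
theorem exists_algHom_of_commute {σ A : Type*} [Ring A] [Algebra ℂ A] (G : σ → A)
    (hG : ∀ i j, G i * G j = G j * G i) :
    ∃ f : MvPolynomial σ ℂ →ₐ[ℂ] A, ∀ i, f (MvPolynomial.X i) = G i := by
  have := Algebra.isMulCommutative_adjoin ℂ (s := Set.range G) (by
    rintro _ ⟨i, rfl⟩ _ ⟨j, rfl⟩
    exact hG i j)
  refine ⟨(Algebra.adjoin ℂ (Set.range G)).val.comp (MvPolynomial.aeval fun i =>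
    (⟨G i, Algebra.subset_adjoin ⟨i, rfl⟩⟩ : Algebra.adjoin ℂ (Set.range G))), fun i => ?_⟩
  rw [AlgHom.comp_apply, MvPolynomial.aeval_X]
  rfl

/-! ### The coinvariants as a vector space -/

section coinv

variable {m l : ℕ} (n : ℕ) {N : Type*} [AddCommGroup N] [Module ℂ N]

/-- A submodule that contains the image of the canonical map and is stable under `𝔮` is the whole
induced module. -/
theorem ind_parab_eq_top (τ : gl (Fin m) × gl (Fin l) →ₗ⁅ℂ⁆ Module.End ℂ N)
    {S : Submodule ℂ (Ind (parab m l) (τ.comp (leviProj m l)))}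
    (hv : ∀ w, indVac _ _ w ∈ S)
    (hS : ∀ Z ∈ qAlg m l, ∀ x ∈ S, indRep (parab m l) (τ.comp (leviProj m l)) Z x ∈ S)
    (x : Ind (parab m l) (τ.comp (leviProj m l))) : x ∈ S := by
  set E := indRep (parab m l) (τ.comp (leviProj m l)) with hE
  let good : Submodule ℂ (Ind (parab m l) (τ.comp (leviProj m l))) → Prop := fun S =>
    (∀ w, indVac _ _ w ∈ S) ∧ ∀ Z ∈ qAlg m l, ∀ x ∈ S, E Z x ∈ S
  -- Being the smallest submodule that contains the canonical image and is 𝔮-stable, Q allows an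
  -- induction: to prove Q stable under X it is enough that Q ∩ X⁻¹Q is again such a submodule.
  let Q := sInf {S | good S}
  have hQle : ∀ S, good S → Q ≤ S := fun S h => sInf_le h
  have hQ : good Q := by
    refine ⟨fun w => ?_, fun Z hZ x hx => ?_⟩
    · rw [Submodule.mem_sInf]
      exact fun S h => h.1 w
    · rw [Submodule.mem_sInf] at hx ⊢
      exact fun S h => h.2 Z hZ x (hx S h)
  have hcomm : ∀ X Z x, E X (E Z x) = E Z (E X x) + E ⁅X, Z⁆ x := fun X Z x => by
    rw [LieHom.map_lie, LieRing.of_associative_ring_bracket, LinearMap.sub_apply,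
      Module.End.mul_apply, Module.End.mul_apply]
    abel
  have hvac : ∀ X ∈ parab m l, ∀ w, E X (indVac _ _ w) ∈ Q := fun X hX w => by
    rw [hE, indRep_indVac _ _ ⟨X, hX⟩]
    exact hQ.1 _
  -- The Levi subalgebra comes first, since it normalizes 𝔮; for 𝔭 the commutator with 𝔮 has a Levi
  -- part, which needs this case.
  have hlevi : ∀ W, ∀ x ∈ Q, E (levi m l W) x ∈ Q := fun W x hx => by
    have h := hQle (Q ⊓ Q.comap (E (levi m l W))) ⟨fun w =>
      ⟨hQ.1 w, hvac _ (levi_mem_parab W) w⟩, fun Z hZ x hx => ⟨hQ.2 Z hZ x hx.1, ?_⟩⟩ hx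
    · exact h.2
    · change E (levi m l W) (E Z x) ∈ Q
      rw [hcomm]
      exact Q.add_mem (hQ.2 _ hZ _ hx.2) (hQ.2 _ (levi_qAlg m l W Z hZ) _ hx.1)
  have hparab : ∀ X ∈ parab m l, ∀ x ∈ Q, E X x ∈ Q := fun X hX x hx => by
    have h := hQle (Q ⊓ Q.comap (E X)) ⟨fun w =>
      ⟨hQ.1 w, hvac _ hX w⟩, fun Z hZ x hx => ⟨hQ.2 Z hZ x hx.1, ?_⟩⟩ hx
    · exact h.2
    · obtain ⟨W, Z', hZ', e⟩ := parab_lie_qAlg hX hZ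
      change E X (E Z x) ∈ Q
      rw [hcomm, e, map_add, LinearMap.add_apply]
      exact Q.add_mem (hQ.2 _ hZ _ hx.2) (Q.add_mem (hlevi _ _ hx.1) (hQ.2 _ hZ' _ hx.1))
  refine hQle S ⟨hv, hS⟩ (ind_eq_top _ _ hQ.1 (fun X x hx => ?_) x)
  obtain ⟨Y, hY, Z, hZ, rfl⟩ := block_decomp X
  rw [map_add, LinearMap.add_apply]
  exact Q.add_mem (hparab _ hY _ hx) (hQ.2 _ hZ _ hx)

/-- Since 𝔮 is Abelian, polynomials can be evaluated at these operators. -/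
theorem gE_lower_comm (b : Fin l) (a : Fin m) (d : Fin l) (c : Fin m) :
    gE n (Sum.inr b : Fin m ⊕ Fin l) (Sum.inl a) * gE n (Sum.inr d) (Sum.inl c)
      = gE n (Sum.inr d) (Sum.inl c) * gE n (Sum.inr b) (Sum.inl a) := by
  rw [← sub_eq_zero, gE_gE]
  simp

/-- The homomorphism from polynomials to operators on the Grassmann algebra that sends the
variables to the opposites of the operators by which `𝔮` acts. -/
noncomputable def grassEval (m l n : ℕ) :
    MvPolynomial (Fin l × Fin m) ℂ →ₐ[ℂ] Module.End ℂ (Grass (Fin m ⊕ Fin l) n) :=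
  (exists_algHom_of_commute (fun v : Fin l × Fin m => -gE n (Sum.inr v.1) (Sum.inl v.2))
    (fun v w => by rw [neg_mul_neg, neg_mul_neg, gE_lower_comm])).choose

theorem grassEval_X (b : Fin l) (a : Fin m) :
    grassEval m l n (MvPolynomial.X (b, a)) = -gE n (Sum.inr b) (Sum.inl a) :=
  (exists_algHom_of_commute (fun v : Fin l × Fin m => -gE n (Sum.inr v.1) (Sum.inl v.2))
    (fun v w => by rw [neg_mul_neg, neg_mul_neg, gE_lower_comm])).choose_spec (b, a)

/-- The projection of `p(y) w ⊗ ω` to the coinvariants. -/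
noncomputable def fockEval (m l n : ℕ) (N : Type*) [AddCommGroup N] [Module ℂ N] :
    Fock m l N →ₗ[ℂ] Grass (Fin m ⊕ Fin l) n →ₗ[ℂ] N ⊗[ℂ] Grass (Fin m ⊕ Fin l) n :=
  TensorProduct.lift (LinearMap.mk₂ ℂ
    (fun p w => TensorProduct.mk ℂ N (Grass (Fin m ⊕ Fin l) n) w ∘ₗ grassEval m l n p)
    (fun p q w => by rw [map_add, LinearMap.comp_add])
    (fun c p w => by rw [map_smul, LinearMap.comp_smul])
    (fun p w w' => by rw [map_add, LinearMap.add_comp])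
    (fun c p w => by rw [map_smul, LinearMap.smul_comp]))

theorem fockEval_fmk (p : MvPolynomial (Fin l × Fin m) ℂ) (w : N) (ω : Grass (Fin m ⊕ Fin l) n) :
    fockEval m l n N (fmk m l N p w) ω = w ⊗ₜ grassEval m l n p ω := rfl

/-- The sign is the one in Zx ⊗ ω ≡ -x ⊗ Zω; it makes the evaluation vanish on 𝔮 · W. -/
theorem fockEval_fy (b : Fin l) (a : Fin m) (x : Fock m l N) (ω : Grass (Fin m ⊕ Fin l) n) :
    fockEval m l n N (fy m l N b a x) ω
      = -fockEval m l n N x (gE n (Sum.inr b) (Sum.inl a) ω) := by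
  have h : (fockEval m l n N).flip ω ∘ₗ fy m l N b a
      = -(fockEval m l n N).flip (gE n (Sum.inr b) (Sum.inl a) ω) := by
    refine fock_ext fun p w => ?_
    change fockEval m l n N (fmk m l N (MvPolynomial.X (b, a) * p) w) ω
      = -fockEval m l n N (fmk m l N p w) (gE n (Sum.inr b) (Sum.inl a) ω)
    -- The variable is moved to the right of p, so that its operator is the first to act on ω.
    rw [fockEval_fmk, fockEval_fmk, mul_comm, map_mul, grassEval_X, Module.End.mul_apply,
      LinearMap.neg_apply, map_neg, TensorProduct.tmul_neg]
  exact LinearMap.congr_fun h x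

theorem eLie_tmul {ι : Type} [Fintype ι] [DecidableEq ι] {V : Type*} [AddCommGroup V] [Module ℂ V]
    (ρ : gl ι →ₗ⁅ℂ⁆ Module.End ℂ V) (X : gl ι) (v : V) (ω : Grass ι n) :
    eLie n ρ X (v ⊗ₜ ω) = ρ X v ⊗ₜ ω + v ⊗ₜ grassRep ι n X ω := rfl

variable (τ : gl (Fin m) × gl (Fin l) →ₗ⁅ℂ⁆ Module.End ℂ N)

/-- The canonical map from `N ⊗ Λ` to the coinvariants. -/
noncomputable def coinvVac : N ⊗[ℂ] Grass (Fin m ⊕ Fin l) n →ₗ[ℂ]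
    Coinv (eLie n (indRep (parab m l) (τ.comp (leviProj m l)))) (qAlg m l) :=
  (lieSpan (eLie n (indRep (parab m l) (τ.comp (leviProj m l)))) (qAlg m l)).mkQ
    ∘ₗ (indVac (parab m l) (τ.comp (leviProj m l))).rTensor _

theorem mkQ_eLie {M L : Type*} [AddCommGroup M] [Module ℂ M] [LieRing L] [LieAlgebra ℂ L]
    (ρ : L →ₗ⁅ℂ⁆ Module.End ℂ M) (q : LieSubalgebra ℂ L) {X : L} (hX : X ∈ q) (w : M) :
    (lieSpan ρ q).mkQ (ρ X w) = 0 :=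
  (Submodule.Quotient.mk_eq_zero _).2 (Submodule.subset_span ⟨X, hX, w, rfl⟩)

/-- In the coinvariants Zx ⊗ ω equals -x ⊗ Zω, so elements of 𝔮 can be transferred from the induced
module to Λ one after another. -/
theorem coinvVac_surjective : Function.Surjective (coinvVac n τ) := by
  set E := indRep (parab m l) (τ.comp (leviProj m l)) with hE
  have key : ∀ x ω, (lieSpan (eLie n E) (qAlg m l)).mkQ (x ⊗ₜ ω) ∈
      LinearMap.range (coinvVac n τ) := by
    -- All ω are required at once because the transfer replaces ω by Zω.
    let S : Submodule ℂ (Ind (parab m l) (τ.comp (leviProj m l))) :=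
      ⨅ ω, (LinearMap.range (coinvVac n τ)).comap ((lieSpan (eLie n E) (qAlg m l)).mkQ
        ∘ₗ (TensorProduct.mk ℂ _ (Grass (Fin m ⊕ Fin l) n)).flip ω)
    have hS : ∀ x, x ∈ S ↔ ∀ ω, (lieSpan (eLie n E) (qAlg m l)).mkQ (x ⊗ₜ ω)
        ∈ LinearMap.range (coinvVac n τ) := fun x => by
      rw [Submodule.mem_iInf]
      rfl
    intro x
    rw [← hS]
    refine ind_parab_eq_top τ (fun w => ?_) (fun Z hZ x hx => ?_) x
    · rw [hS]
      exact fun ω => ⟨w ⊗ₜ ω, rfl⟩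
    · rw [hS] at hx ⊢
      intro ω
      have e := mkQ_eLie (eLie n E) (qAlg m l) hZ (x ⊗ₜ ω)
      rw [eLie_tmul, map_add] at e
      rw [eq_neg_of_add_eq_zero_left e]
      exact Submodule.neg_mem _ (hx _)
  intro y
  obtain ⟨t, rfl⟩ := (lieSpan (eLie n E) (qAlg m l)).mkQ_surjective y
  rw [← LinearMap.mem_range]
  induction t with
  | zero => rw [map_zero]; exact Submodule.zero_mem _
  | add s t hs ht => rw [map_add]; exact Submodule.add_mem _ hs ht
  | tmul x ω => exact key x ω

/-- The homomorphism from the parabolically induced module to its polynomial model. -/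
noncomputable def boxToFock : Ind (parab m l) (τ.comp (leviProj m l)) →ₗ[ℂ] Fock m l N :=
  indLift _ _ (fockRep τ) (fvac m l N) (fockRep_parab τ)

theorem boxToFock_indVac (w : N) :
    boxToFock τ (indVac (parab m l) (τ.comp (leviProj m l)) w) = fvac m l N w :=
  indLift_indVac _ _ _ _ _ w

theorem boxToFock_indRep (X : gl (Fin m ⊕ Fin l))
    (x : Ind (parab m l) (τ.comp (leviProj m l))) :
    boxToFock τ (indRep (parab m l) (τ.comp (leviProj m l)) X x) = fockRep τ X (boxToFock τ x) :=
  indLift_indRep _ _ _ _ _ X x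

/-- By linearity it is enough to take a matrix unit of 𝔮, where multiplication by y_{ba} evaluates
to -E_{ba}. The evaluation therefore descends to the coinvariants. -/
theorem fockEval_qAlg {X : gl (Fin m ⊕ Fin l)} (hX : X ∈ qAlg m l) (x : Fock m l N)
    (ω : Grass (Fin m ⊕ Fin l) n) :
    fockEval m l n N (fockRep τ X x) ω + fockEval m l n N x (grassRep _ n X ω) = 0 := by
  refine qAlg_induction (p := fun X => fockEval m l n N (fockRep τ X x) ω
    + fockEval m l n N x (grassRep _ n X ω) = 0) ?_ (fun X Y hX hY => ?_) (fun c X hX => ?_)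
    (fun b a => ?_) hX
  · simp
  · have h := congrArg₂ (· + ·) hX hY
    simp only [add_zero] at h
    rw [← h]
    simp only [map_add, LinearMap.add_apply]
    abel
  · have h := congrArg (c • ·) hX
    simp only [smul_zero, smul_add] at h
    rw [← h]
    simp only [map_smul, LinearMap.smul_apply]
  · rw [show fockRep τ (Matrix.single (.inr b) (.inl a) 1) = fy m l N b a from fockAct_fy τ b a,
      fockEval_fy, grassRep_single, neg_add_cancel]

/-- The inverse of the canonical map from `N ⊗ Λ` to the coinvariants. -/
noncomputable def coinvEval :
    Coinv (eLie n (indRep (parab m l) (τ.comp (leviProj m l)))) (qAlg m l) →ₗ[ℂ]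
      N ⊗[ℂ] Grass (Fin m ⊕ Fin l) n :=
  (lieSpan (eLie n (indRep (parab m l) (τ.comp (leviProj m l)))) (qAlg m l)).liftQ
    (TensorProduct.lift (fockEval m l n N ∘ₗ boxToFock τ)) (by
      refine Submodule.span_le.2 ?_
      rintro _ ⟨X, hX, t, rfl⟩
      rw [SetLike.mem_coe, LinearMap.mem_ker]
      induction t with
      | zero => simp only [map_zero]
      | add s t hs ht => rw [map_add, map_add, hs, ht, add_zero]
      | tmul x ω =>
        rw [eLie_tmul, map_add, TensorProduct.lift.tmul, TensorProduct.lift.tmul,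
          LinearMap.comp_apply, LinearMap.comp_apply, boxToFock_indRep, fockEval_qAlg]
        exact hX)

/-- A vector of N goes to a constant polynomial, and the constant 1 evaluates to the identity on Λ.
The resulting injectivity is the part for which freeness of V ⊠ U over U(𝔮) would otherwise be
invoked. -/
theorem coinvEval_coinvVac (t : N ⊗[ℂ] Grass (Fin m ⊕ Fin l) n) :
    coinvEval n τ (coinvVac n τ t) = t := by
  induction t with
  | zero => simp only [map_zero]
  | add s t hs ht => rw [map_add, map_add, hs, ht]
  | tmul w ω =>
    change fockEval m l n N (boxToFock τ (indVac _ _ w)) ω = w ⊗ₜ ω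
    rw [boxToFock_indVac, fvac, fockEval_fmk, map_one, Module.End.one_apply]

/-- The space of coinvariants of `E(V ⊠ U)` is `V ⊗ U ⊗ Λ`. -/
noncomputable def coinvVacEquiv : (N ⊗[ℂ] Grass (Fin m ⊕ Fin l) n) ≃ₗ[ℂ]
    Coinv (eLie n (indRep (parab m l) (τ.comp (leviProj m l)))) (qAlg m l) :=
  LinearEquiv.ofBijective (coinvVac n τ)
    ⟨Function.LeftInverse.injective (coinvEval_coinvVac n τ), coinvVac_surjective n τ⟩

end coinv

/-! ### Powers of a block matrix on the highest vectors -/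

section powers

variable {m l : ℕ} {M N : Type*} [AddCommGroup M] [Module ℂ M] [AddCommGroup N] [Module ℂ N]
  {P : Matrix (Fin m ⊕ Fin l) (Fin m ⊕ Fin l) (Module.End ℂ M)} {v : N →ₗ[ℂ] M}
  {A : Matrix (Fin m) (Fin m) (Module.End ℂ N)} {D : Matrix (Fin l) (Fin l) (Module.End ℂ N)}

/-- In P^(s+1) = P^s P the right factor acts first, and the left block column of P does not leave
the image of v. -/
theorem blockPow_left (h₁₁ : ∀ a b w, P (.inl a) (.inl b) (v w) = v (A a b w))
    (h₂₁ : ∀ b a w, P (.inr b) (.inl a) (v w) = 0) (s : ℕ) :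
    (∀ a b w, (P ^ s) (.inl a) (.inl b) (v w) = v ((A ^ s) a b w)) ∧
      ∀ b a w, (P ^ s) (.inr b) (.inl a) (v w) = 0 := by
  induction s with
  | zero =>
    refine ⟨fun a b w => ?_, fun b a w => ?_⟩
    · by_cases h : a = b <;> simp [h]
    · simp
  | succ s ih =>
    refine ⟨fun a b w => ?_, fun b a w => ?_⟩ <;>
    simp only [pow_succ, Matrix.mul_apply, Fintype.sum_sum_type, LinearMap.add_apply,
      LinearMap.sum_apply, Module.End.mul_apply, h₁₁, h₂₁, ih.1, ih.2, map_zero, map_sum,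
      Finset.sum_const_zero, add_zero]

/-- The matrix `D` shifted by `-m`. -/
noncomputable def shiftMat (m : ℕ) (D : Matrix (Fin l) (Fin l) (Module.End ℂ N)) :
    Matrix (Fin l) (Fin l) (Module.End ℂ N) := D + (-(m : ℂ)) • 1

theorem shiftMat_apply (c d : Fin l) (w : N) :
    shiftMat m D c d w = D c d w - if c = d then (m : ℂ) • w else 0 := by
  rw [shiftMat, Matrix.add_apply, Matrix.smul_apply, Matrix.one_apply]
  split_ifs <;> simp [sub_eq_add_neg]

/-- The entries P_{ed} lead out of the image of v, so they are commuted to the left of (P^s)_{ae}.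
Each e ≤ m contributes -(P^s)_{ad}; together they turn D into D - m. -/
theorem blockPow_succ_left_right (h₁₁ : ∀ a b w, P (.inl a) (.inl b) (v w) = v (A a b w))
    (h₂₂ : ∀ a b w, P (.inr a) (.inr b) (v w) = v (D a b w))
    (h₂₁ : ∀ b a w, P (.inr b) (.inl a) (v w) = 0)
    (hP : ∀ a b c d, P a b * P c d - P c d * P a b
      = (if a = d then P c b else 0) - (if c = b then P a d else 0))
    (s : ℕ) (a : Fin m) (d : Fin l) (w : N) :
    (P ^ (s + 1)) (.inl a) (.inr d) (v w)
      = ∑ c, (P ^ s) (.inl a) (.inr c) (v (shiftMat m D c d w))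
        + ∑ e, P (.inl e) (.inr d) (v ((A ^ s) a e w)) := by
  have h : ∀ e, (P ^ s) (.inl a) (.inl e) (P (.inl e) (.inr d) (v w))
      = P (.inl e) (.inr d) (v ((A ^ s) a e w)) - (P ^ s) (.inl a) (.inr d) (v w) := fun e => by
    have e1 := LinearMap.congr_fun (matPow_comm hP s (.inl e) (.inr d) (.inl a) (.inl e)) (v w)
    simp only [LinearMap.sub_apply, Module.End.mul_apply, (blockPow_left h₁₁ h₂₁ s).1, if_true,
      reduceCtorEq, if_false, sub_zero] at e1
    rw [← e1]
    abel
  simp only [pow_succ P, Matrix.mul_apply, Fintype.sum_sum_type, LinearMap.add_apply,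
    LinearMap.sum_apply, Module.End.mul_apply, h, h₂₂, shiftMat_apply, map_sub,
    Finset.sum_sub_distrib, Finset.sum_const, Finset.card_univ, Fintype.card_fin]
  have e2 : ∑ c, (P ^ s) (.inl a) (.inr c) (v (if c = d then (m : ℂ) • w else 0))
      = m • (P ^ s) (.inl a) (.inr d) (v w) := by
    rw [Finset.sum_eq_single d]
    · rw [if_pos rfl, map_smul, map_smul, Nat.cast_smul_eq_nsmul]
    · intro c _ hc
      rw [if_neg hc, map_zero, map_zero]
    · simp
  rw [e2]
  abel

/-- Here (P^s)_{ba} kills the image of v, so only the commutator with P_{ad} remains. It contributes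
-(P^s)_{bd} for each of the m indices a, and for b = d also the trace of A^s. -/
theorem blockPow_succ_right_right (h₁₁ : ∀ a b w, P (.inl a) (.inl b) (v w) = v (A a b w))
    (h₂₂ : ∀ a b w, P (.inr a) (.inr b) (v w) = v (D a b w))
    (h₂₁ : ∀ b a w, P (.inr b) (.inl a) (v w) = 0)
    (hP : ∀ a b c d, P a b * P c d - P c d * P a b
      = (if a = d then P c b else 0) - (if c = b then P a d else 0))
    (s : ℕ) (b d : Fin l) (w : N) :
    (P ^ (s + 1)) (.inr b) (.inr d) (v w)
      = ∑ c, (P ^ s) (.inr b) (.inr c) (v (shiftMat m D c d w))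
        + if b = d then v (∑ a, (A ^ s) a a w) else 0 := by
  have h : ∀ a, (P ^ s) (.inr b) (.inl a) (P (.inl a) (.inr d) (v w))
      = (if b = d then v ((A ^ s) a a w) else 0) - (P ^ s) (.inr b) (.inr d) (v w) := fun a => by
    have e1 := LinearMap.congr_fun (matPow_comm hP s (.inl a) (.inr d) (.inr b) (.inl a)) (v w)
    simp only [LinearMap.sub_apply, Module.End.mul_apply, (blockPow_left h₁₁ h₂₁ s).2, if_true,
      map_zero, zero_sub, Sum.inr.injEq] at e1
    rw [neg_eq_iff_eq_neg.1 e1, ← (blockPow_left h₁₁ h₂₁ s).1]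
    split_ifs <;> simp
  simp only [pow_succ P, Matrix.mul_apply, Fintype.sum_sum_type, LinearMap.add_apply,
    LinearMap.sum_apply, Module.End.mul_apply, h, h₂₂, shiftMat_apply, map_sub,
    Finset.sum_sub_distrib, Finset.sum_const, Finset.card_univ, Fintype.card_fin]
  have e2 : ∑ c, (P ^ s) (.inr b) (.inr c) (v (if c = d then (m : ℂ) • w else 0))
      = m • (P ^ s) (.inr b) (.inr d) (v w) := by
    rw [Finset.sum_eq_single d]
    · rw [if_pos rfl, map_smul, map_smul, Nat.cast_smul_eq_nsmul]
    · intro c _ hc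
      rw [if_neg hc, map_zero, map_zero]
    · simp
  rw [e2, map_sum]
  split_ifs
  · abel
  · rw [Finset.sum_const_zero]
    abel

open Finset.HasAntidiagonal in
theorem blockPow_left_right (h₁₁ : ∀ a b w, P (.inl a) (.inl b) (v w) = v (A a b w))
    (h₂₂ : ∀ a b w, P (.inr a) (.inr b) (v w) = v (D a b w))
    (h₂₁ : ∀ b a w, P (.inr b) (.inl a) (v w) = 0)
    (hP : ∀ a b c d, P a b * P c d - P c d * P a b
      = (if a = d then P c b else 0) - (if c = b then P a d else 0))
    (s : ℕ) (a : Fin m) (d : Fin l) (w : N) :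
    (P ^ (s + 1)) (.inl a) (.inr d) (v w)
      = ∑ p ∈ antidiagonal s, ∑ e, ∑ c,
        P (.inl e) (.inr c) (v ((A ^ p.1) a e ((shiftMat m D ^ p.2) c d w))) := by
  induction s generalizing d w with
  | zero =>
    rw [blockPow_succ_left_right h₁₁ h₂₂ h₂₁ hP, Finset.Nat.antidiagonal_zero,
      Finset.sum_singleton]
    simp only [pow_zero, Matrix.one_apply, reduceCtorEq, if_false, LinearMap.zero_apply,
      Finset.sum_const_zero, zero_add]
    refine Finset.sum_congr rfl fun e _ => ?_
    rw [Finset.sum_eq_single d]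
    · simp
    · intro c _ hc
      simp [hc]
    · simp
  | succ s ih =>
    -- The summand with A^(s+1) is the new term q = 0; in all others the exponent of D - m grows by
    -- one.
    rw [blockPow_succ_left_right h₁₁ h₂₂ h₂₁ hP, Finset.Nat.sum_antidiagonal_succ', add_comm]
    congr 1
    · refine Finset.sum_congr rfl fun e _ => ?_
      rw [Finset.sum_eq_single d]
      · simp
      · intro c _ hc
        simp [hc]
      · simp
    · simp only [ih]
      rw [Finset.sum_comm]
      refine Finset.sum_congr rfl fun p _ => ?_
      rw [Finset.sum_comm]
      refine Finset.sum_congr rfl fun e _ => ?_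
      rw [Finset.sum_comm]
      refine Finset.sum_congr rfl fun c _ => ?_
      simp only [pow_succ (shiftMat m D), Matrix.mul_apply, LinearMap.sum_apply,
        Module.End.mul_apply, map_sum]

open Finset.HasAntidiagonal in
theorem blockPow_right_right (h₁₁ : ∀ a b w, P (.inl a) (.inl b) (v w) = v (A a b w))
    (h₂₂ : ∀ a b w, P (.inr a) (.inr b) (v w) = v (D a b w))
    (h₂₁ : ∀ b a w, P (.inr b) (.inl a) (v w) = 0)
    (hP : ∀ a b c d, P a b * P c d - P c d * P a b
      = (if a = d then P c b else 0) - (if c = b then P a d else 0))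
    (s : ℕ) (b d : Fin l) (w : N) :
    (P ^ (s + 1)) (.inr b) (.inr d) (v w)
      = v ((shiftMat m D ^ (s + 1)) b d w)
        + ∑ p ∈ antidiagonal s, ∑ a, v ((A ^ p.1) a a ((shiftMat m D ^ p.2) b d w)) := by
  induction s generalizing d w with
  | zero =>
    rw [blockPow_succ_right_right h₁₁ h₂₂ h₂₁ hP, Finset.Nat.antidiagonal_zero,
      Finset.sum_singleton]
    congr 1
    · rw [Finset.sum_eq_single b]
      · simp
      · intro c _ hc
        simp [Ne.symm hc]
      · simp
    · by_cases h : b = d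
      · simp [h]
      · simp [h]
  | succ s ih =>
    rw [blockPow_succ_right_right h₁₁ h₂₂ h₂₁ hP, Finset.Nat.sum_antidiagonal_succ']
    simp only [ih, Finset.sum_add_distrib]
    rw [pow_succ _ (s + 1), Matrix.mul_apply, LinearMap.sum_apply, add_assoc, map_sum v]
    refine congrArg₂ (fun x y : M => x + y) (by rw [map_sum]; rfl) ?_
    refine (add_comm _ _).trans (congrArg₂ (fun x y : M => x + y) ?_ ?_)
    · by_cases h : b = d <;> simp [h]
    · rw [Finset.sum_comm]
      refine Finset.sum_congr rfl fun p _ => ?_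
      rw [Finset.sum_comm]
      refine Finset.sum_congr rfl fun a _ => ?_
      simp only [pow_succ (shiftMat m D), Matrix.mul_apply, LinearMap.sum_apply,
        Module.End.mul_apply, map_sum]

end powers

/-! ### The Yangian action on the coinvariants -/

section operators

variable {ι X Y : Type*} [Fintype ι] [DecidableEq ι] [AddCommGroup X] [Module ℂ X]
  [AddCommGroup Y] [Module ℂ Y] {n : ℕ}

/-- The operators `∑_{a,b} (Q ^ s)_{ab} ⊗ x_{ai} ∂_{bj}` on a tensor product. -/
noncomputable def tensT (Q : Matrix ι ι (Module.End ℂ X)) (x d : ι → Fin n → Module.End ℂ Y) :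
    ℕ → Fin n → Fin n → Module.End ℂ (X ⊗[ℂ] Y) :=
  glT (Matrix.of fun a b => (Q a b).rTensor Y) (fun a i => (x a i).lTensor X)
    (fun a i => (d a i).lTensor X)

theorem rTensor_matPow (Q : Matrix ι ι (Module.End ℂ X)) (s : ℕ) (a b : ι) :
    ((Matrix.of fun a b => (Q a b).rTensor Y) ^ s) a b = ((Q ^ s) a b).rTensor Y := by
  induction s generalizing b with
  | zero =>
    by_cases h : a = b
    · simp only [pow_zero, h, Matrix.one_apply_eq]
      exact (LinearMap.rTensor_id _ _).symm
    · simp only [pow_zero, Matrix.one_apply_ne h]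
      exact (LinearMap.rTensor_zero _).symm
  | succ s ih =>
    rw [pow_succ, pow_succ, Matrix.mul_apply, Matrix.mul_apply]
    refine Eq.trans ?_ (map_sum (LinearMap.rTensorHom Y) _ _).symm
    refine Finset.sum_congr rfl fun c _ => ?_
    rw [ih]
    exact (LinearMap.rTensor_mul _ _ _).symm

theorem tensT_succ_tmul (Q : Matrix ι ι (Module.End ℂ X)) (x d : ι → Fin n → Module.End ℂ Y)
    (s : ℕ) (i j : Fin n) (u : X) (y : Y) :
    tensT Q x d (s + 1) i j (u ⊗ₜ y) = ∑ a, ∑ b, (Q ^ s) a b u ⊗ₜ[ℂ] x a i (d b j y) := by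
  simp only [tensT, glT, rTensor_matPow, LinearMap.sum_apply, Module.End.mul_apply,
    LinearMap.lTensor_tmul, LinearMap.rTensor_tmul]

theorem tensT_zero (Q : Matrix ι ι (Module.End ℂ X)) (x d : ι → Fin n → Module.End ℂ Y)
    (i j : Fin n) : tensT Q x d 0 i j = if i = j then 1 else 0 := rfl

end operators

/-! ### Shift of the spectral parameter -/

section shiftGl

variable {ι R : Type*} [Fintype ι] [DecidableEq ι] [Ring R] [Algebra ℂ R] {n : ℕ}

/-- Re-expansion at a shifted point amounts to a shift of the matrix. -/
theorem shiftT_glT (P : Matrix ι ι R) (x d : ι → Fin n → R) (z : ℂ) :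
    shiftT (glT P x d) z = glT (P + z • 1) x d := by
  funext s i j
  cases s with
  | zero => rfl
  | succ s =>
    -- The coefficients in the re-expansion of T(u - z) are those of the binomial theorem for P and
    -- the scalar z.
    have h : (P + z • 1) ^ s
        = ∑ r ∈ Finset.range (s + 1), (z ^ (s - r) * (s.choose r : ℂ)) • P ^ r := by
      rw [Commute.add_pow ((Commute.one_right P).smul_right z)]
      refine Finset.sum_congr rfl fun r _ => ?_
      rw [smul_pow, one_pow, mul_smul_comm, mul_one, smul_mul_assoc, mul_smul,
        ← nsmul_eq_mul', Nat.cast_smul_eq_nsmul]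
    simp only [shiftT, glT, h, Matrix.sum_apply, Matrix.smul_apply, Finset.sum_mul,
      Finset.smul_sum, smul_mul_assoc]
    rw [Finset.sum_comm]
    refine Finset.sum_congr rfl fun a _ => ?_
    rw [Finset.sum_comm]

end shiftGl

/-! ### Low and high coefficients of a product of two series -/

section convolution

variable {R : Type*} [Ring R] {n : ℕ} {t t' : ℕ → Fin n → Fin n → R}

theorem convT_one (ht : ∀ i j, t 0 i j = if i = j then 1 else 0)
    (ht' : ∀ i j, t' 0 i j = if i = j then 1 else 0) (i j : Fin n) :
    convT t t' 1 i j = t 1 i j + t' 1 i j := by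
  rw [convT]
  simp [Finset.Nat.antidiagonal_succ, ht, ht', Finset.sum_add_distrib, add_comm]

open Finset.HasAntidiagonal in
-- The two end terms of the convolution, where one factor is δ, are split off. The exponents p and q
-- of the remaining terms add up to s, as in the formulas for the powers of a block matrix.
theorem convT_add_two (ht : ∀ i j, t 0 i j = if i = j then 1 else 0)
    (ht' : ∀ i j, t' 0 i j = if i = j then 1 else 0) (s : ℕ) (i j : Fin n) :
    convT t t' (s + 2) i j = t (s + 2) i j + t' (s + 2) i j
      + ∑ p ∈ antidiagonal s, ∑ k, t (p.1 + 1) i k * t' (p.2 + 1) k j := by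
  rw [convT]
  simp only [Finset.Nat.sum_antidiagonal_succ (n := s + 1),
    Finset.Nat.sum_antidiagonal_succ' (n := s), Finset.sum_add_distrib, ht, ht', ite_mul, one_mul,
    zero_mul, mul_ite, mul_one, mul_zero, Finset.sum_ite_eq, Finset.sum_ite_eq', Finset.mem_univ,
    if_true]
  rw [Finset.sum_comm]
  abel

end convolution

/-! ### The Yangian operators on classes of highest vectors -/

section coinv

variable {m l n : ℕ}

theorem sum_comm_four {α β γ δ K : Type*} [Fintype α] [Fintype β] [Fintype γ] [Fintype δ]
    [AddCommMonoid K] (F : α → β → γ → δ → K) :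
    ∑ a, ∑ d, ∑ e, ∑ c, F a d e c = ∑ c, ∑ d, ∑ a, ∑ e, F a d e c := by
  rw [Finset.sum_congr rfl fun a _ => Finset.sum_congr rfl fun d _ => Finset.sum_comm,
    Finset.sum_congr rfl fun a _ => Finset.sum_comm, Finset.sum_comm]
  exact Finset.sum_congr rfl fun c _ => Finset.sum_comm

theorem sum_comm_inner {α β γ K : Type*} [Fintype α] [Fintype β] [AddCommMonoid K] (S : Finset γ)
    (F : α → β → γ → K) :
    ∑ a, ∑ b, ∑ p ∈ S, F a b p = ∑ p ∈ S, ∑ a, ∑ b, F a b p := by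
  rw [Finset.sum_congr rfl fun a _ => Finset.sum_comm, Finset.sum_comm]

/-- Moving E_{ce} = ∑_k x_{ck} ∂_{ek} to the right of x_{ai} gives the extra term δ_{ea} x_{ci},
which cancels the first sum, the one with traces. In the remainder c and e lie in different blocks,
so x_{ck} and ∂_{ek} anticommute; this absorbs the sign and gives the products x_{ai} ∂_{ek} x_{ck}
∂_{dj} of the comultiplication. -/
theorem contract_swap {K : Type*} [AddCommGroup K] [Module ℂ K]
    (H : Fin m → Fin m → Fin l → Fin l → Grass (Fin m ⊕ Fin l) n →ₗ[ℂ] K) (i j : Fin n)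
    (ω : Grass (Fin m ⊕ Fin l) n) :
    (∑ c, ∑ d, ∑ a, H a a c d (gx (.inr c) i (gd (.inr d) j ω)))
      + ∑ a, ∑ d, ∑ e, ∑ c,
        -H a e c d (gE n (.inr c) (.inl e) (gx (.inl a) i (gd (.inr d) j ω)))
      = ∑ k, ∑ c, ∑ d, ∑ a, ∑ e,
        H a e c d (gx (.inl a) i (gd (.inl e) k (gx (.inr c) k (gd (.inr d) j ω)))) := by
  have h1 : ∀ a e c (η : Grass (Fin m ⊕ Fin l) n), gE n (.inr c) (.inl e) (gx (.inl a) i η)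
      = gx (.inl a) i (gE n (.inr c) (.inl e) η) + if e = a then gx (.inr c) i η else 0 := by
    intro a e c η
    have h := LinearMap.congr_fun (gE_gx (n := n) (Sum.inr c : Fin m ⊕ Fin l) (.inl e) (.inl a) i) η
    rw [Module.End.mul_apply, LinearMap.add_apply, Module.End.mul_apply] at h
    rw [h]
    by_cases hea : e = a <;> simp [hea]
  have h2 : ∀ a e c (η : Grass (Fin m ⊕ Fin l) n),
      ∑ k, gx (.inl a) i (gd (.inl e) k (gx (.inr c) k η))
        = -gx (.inl a) i (gE n (.inr c) (.inl e) η) := by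
    intro a e c η
    rw [← map_neg, ← map_sum]
    congr 1
    rw [gE, LinearMap.sum_apply, ← Finset.sum_neg_distrib]
    refine Finset.sum_congr rfl fun k _ => ?_
    have h := LinearMap.congr_fun (gd_gx (n := n) (Sum.inl e : Fin m ⊕ Fin l) k (.inr c) k) η
    rw [Module.End.mul_apply] at h
    rw [h]
    simp
  have e1 : ∑ k, ∑ c, ∑ d, ∑ a, ∑ e,
        H a e c d (gx (.inl a) i (gd (.inl e) k (gx (.inr c) k (gd (.inr d) j ω))))
      = ∑ c, ∑ d, ∑ a, ∑ e, H a e c d (-gx (.inl a) i (gE n (.inr c) (.inl e) (gd (.inr d) j ω))) := by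
    rw [Finset.sum_comm]
    refine Finset.sum_congr rfl fun c _ => ?_
    rw [Finset.sum_comm]
    refine Finset.sum_congr rfl fun d _ => ?_
    rw [Finset.sum_comm]
    refine Finset.sum_congr rfl fun a _ => ?_
    rw [Finset.sum_comm]
    refine Finset.sum_congr rfl fun e _ => ?_
    rw [← map_sum, h2]
  have e2 : ∑ a, ∑ d, ∑ e, ∑ c,
        -H a e c d (gE n (.inr c) (.inl e) (gx (.inl a) i (gd (.inr d) j ω)))
      = ∑ c, ∑ d, ∑ a, ∑ e,
        -H a e c d (gE n (.inr c) (.inl e) (gx (.inl a) i (gd (.inr d) j ω))) :=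
    sum_comm_four (fun a d e c =>
      -H a e c d (gE n (.inr c) (.inl e) (gx (.inl a) i (gd (.inr d) j ω))))
  rw [e1, e2, ← Finset.sum_add_distrib]
  refine Finset.sum_congr rfl fun c _ => ?_
  rw [← Finset.sum_add_distrib]
  refine Finset.sum_congr rfl fun d _ => ?_
  rw [← Finset.sum_add_distrib]
  refine Finset.sum_congr rfl fun a _ => ?_
  simp only [h1, map_add, map_neg, neg_add, Finset.sum_add_distrib, Finset.sum_neg_distrib]
  have e3 : ∑ e, H a e c d (if e = a then gx (.inr c) i (gd (.inr d) j ω) else 0)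
      = H a a c d (gx (.inr c) i (gd (.inr d) j ω)) := by
    rw [Finset.sum_eq_single a]
    · rw [if_pos rfl]
    · intro e _ he
      rw [if_neg he, map_zero]
    · simp
  rw [e3]
  abel

variable {M N K : Type*} [AddCommGroup M] [Module ℂ M] [AddCommGroup N] [Module ℂ N]
  [AddCommGroup K] [Module ℂ K]
  {P : Matrix (Fin m ⊕ Fin l) (Fin m ⊕ Fin l) (Module.End ℂ M)} {v : N →ₗ[ℂ] M}
  {A : Matrix (Fin m) (Fin m) (Module.End ℂ N)} {D : Matrix (Fin l) (Fin l) (Module.End ℂ N)}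

/-- On the classes of the highest vectors, the operators `T_{ij}^{(s)}` for the block matrix `P`
act as the convolution of those for the diagonal blocks, the second one being shifted. -/
theorem tensT_block {π : M ⊗[ℂ] Grass (Fin m ⊕ Fin l) n →ₗ[ℂ] K}
    (h₁₁ : ∀ a b w, P (.inl a) (.inl b) (v w) = v (A a b w))
    (h₂₂ : ∀ a b w, P (.inr a) (.inr b) (v w) = v (D a b w))
    (h₂₁ : ∀ b a w, P (.inr b) (.inl a) (v w) = 0)
    (hP : ∀ a b c d, P a b * P c d - P c d * P a b
      = (if a = d then P c b else 0) - (if c = b then P a d else 0))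
    (hπ : ∀ e c x ω, π (P (.inl e) (.inr c) x ⊗ₜ ω) = -π (x ⊗ₜ gE n (.inr c) (.inl e) ω))
    (s : ℕ) (i j : Fin n) (t : N ⊗[ℂ] Grass (Fin m ⊕ Fin l) n) :
    π (tensT P gx gd (s + 1) i j (v.rTensor _ t))
      = π (v.rTensor _ (convT (tensT A (fun a => gx (.inl a)) fun a => gd (.inl a))
        (tensT (shiftMat m D) (fun a => gx (.inr a)) fun a => gd (.inr a)) (s + 1) i j t)) := by
  induction t with
  | zero => simp only [map_zero]
  | add x y hx hy => simp only [map_add, hx, hy]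
  | tmul w ω =>
    rw [LinearMap.rTensor_tmul, tensT_succ_tmul]
    simp only [Fintype.sum_sum_type, (blockPow_left h₁₁ h₂₁ s).1, (blockPow_left h₁₁ h₂₁ s).2,
      TensorProduct.zero_tmul, Finset.sum_const_zero, Finset.sum_add_distrib, map_add, map_sum]
    cases s with
    | zero =>
      -- For T^{(1)} only P^0 enters: its off-diagonal blocks vanish and neither shift nor traces
      -- occur.
      rw [convT_one (tensT_zero _ _ _) (tensT_zero _ _ _)]
      simp only [LinearMap.add_apply, map_add, tensT_succ_tmul, map_sum, LinearMap.rTensor_tmul]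
      have e1 : ∀ (a : Fin m) (d : Fin l), (P ^ 0) (.inl a) (.inr d) = 0 := fun a d => by
        simp
      have e2 : ∀ c d : Fin l, (P ^ 0) (.inr c) (.inr d) (v w) = v ((shiftMat m D ^ 0) c d w) :=
        fun c d => by by_cases h : c = d <;> simp [h]
      simp only [e1, e2, LinearMap.zero_apply, TensorProduct.zero_tmul, map_zero,
        Finset.sum_const_zero, zero_add, add_zero]
    | succ s =>
      rw [convT_add_two (tensT_zero _ _ _) (tensT_zero _ _ _)]
      simp only [LinearMap.add_apply, map_add, tensT_succ_tmul, map_sum, LinearMap.rTensor_tmul,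
        LinearMap.sum_apply, Module.End.mul_apply, blockPow_left_right h₁₁ h₂₂ h₂₁ hP,
        blockPow_right_right h₁₁ h₂₂ h₂₁ hP, TensorProduct.add_tmul, TensorProduct.sum_tmul, hπ,
        Finset.sum_add_distrib, map_zero]
      rw [add_zero, add_assoc]
      -- The upper left block gives T^{(s+2)} of the first factor alone.
      refine congrArg₂ (fun x y : K => x + y) rfl ?_
      rw [add_left_comm]
      -- The pure power of D - m in the lower right block gives T^{(s+2)} of the second factor
      -- alone.
      refine congrArg₂ (fun x y : K => x + y) rfl ?_
      -- The traces from the lower right block and the upper right block together form the mixed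
      -- terms, separately for each pair of exponents.
      rw [add_comm, sum_comm_inner, sum_comm_inner, ← Finset.sum_add_distrib]
      refine Finset.sum_congr rfl fun p _ => ?_
      exact contract_swap (fun a e c d => π ∘ₗ TensorProduct.mk ℂ _ _
        (v ((A ^ p.1) a e ((shiftMat m D ^ p.2) c d w)))) i j ω

end coinv

/-! ### Comparison with the tensor product -/

theorem yTensor_yT {n : ℕ} {M N : Type*} [AddCommGroup M] [Module ℂ M] [AddCommGroup N]
    [Module ℂ N] (f : Yangian n →ₐ[ℂ] Module.End ℂ M) (g : Yangian n →ₐ[ℂ] Module.End ℂ N)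
    (s : ℕ) (i j : Fin n) :
    yTensor f g (yT n s i j) = convT (fun s i j => (f (yT n s i j)).rTensor N)
      (fun s i j => (g (yT n s i j)).lTensor M) s i j := by
  rw [yTensor, AlgHom.comp_apply, AlgHom.comp_apply, yComul, yLift_yT, convT, convT]
  simp only [map_sum, map_mul, Algebra.TensorProduct.map_tmul, map_one]
  rfl

theorem map_shiftT {R S : Type*} [Ring R] [Algebra ℂ R] [Ring S] [Algebra ℂ S] {n : ℕ}
    (f : R →ₐ[ℂ] S) (t : ℕ → Fin n → Fin n → R) (z : ℂ) (s : ℕ) (i j : Fin n) :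
    f (shiftT t z s i j) = shiftT (fun s i j => f (t s i j)) z s i j := by
  cases s with
  | zero => rfl
  | succ s => simp only [shiftT, map_sum, map_smul]

/-! ### Matrices of matrix units in a representation -/

section matrices

variable {ι : Type} [Fintype ι] [DecidableEq ι] {V : Type*} [AddCommGroup V] [Module ℂ V]

/-- The matrix whose entry at `(a, b)` is the operator `E_{ba}`. -/
noncomputable def repMat (ρ : gl ι →ₗ⁅ℂ⁆ Module.End ℂ V) : Matrix ι ι (Module.End ℂ V) :=
  Matrix.of fun a b => ρ (Matrix.single b a 1)

theorem repMat_comm (ρ : gl ι →ₗ⁅ℂ⁆ Module.End ℂ V) (a b c d : ι) :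
    repMat ρ a b * repMat ρ c d - repMat ρ c d * repMat ρ a b
      = (if a = d then repMat ρ c b else 0) - (if c = b then repMat ρ a d else 0) := by
  have h := ρ.map_lie (Matrix.single b a 1) (Matrix.single d c 1)
  rw [lie_single_single, LieRing.of_associative_ring_bracket] at h
  simp only [repMat, Matrix.of_apply]
  rw [← h]
  by_cases h : a = d <;> by_cases h' : c = b <;> simp [h, h']

theorem eT_eq_tensT (n : ℕ) (ρ : gl ι →ₗ⁅ℂ⁆ Module.End ℂ V) : eT n ρ = tensT (repMat ρ) gx gd := rfl

theorem grassRep_apply (n : ℕ) (X : gl ι) (ω : Grass ι n) :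
    grassRep ι n X ω = ∑ a, ∑ b, X a b • ∑ k, gx a k (gd b k ω) := by
  change (∑ a, ∑ b, X a b • gE n a b) ω = _
  simp only [LinearMap.sum_apply, LinearMap.smul_apply, gE, Module.End.mul_apply]

theorem lTensor_matPow {X Y : Type*} [AddCommGroup X] [Module ℂ X] [AddCommGroup Y] [Module ℂ Y]
    (Q : Matrix ι ι (Module.End ℂ X)) (s : ℕ) (a b : ι) :
    ((Matrix.of fun a b => (Q a b).lTensor Y) ^ s) a b = ((Q ^ s) a b).lTensor Y := by
  induction s generalizing b with
  | zero =>
    by_cases h : a = b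
    · simp only [pow_zero, h, Matrix.one_apply_eq]
      exact (LinearMap.lTensor_id _ _).symm
    · simp only [pow_zero, Matrix.one_apply_ne h]
      exact (LinearMap.lTensor_zero _).symm
  | succ s ih =>
    rw [pow_succ, pow_succ, Matrix.mul_apply, Matrix.mul_apply]
    refine Eq.trans ?_ (map_sum (LinearMap.lTensorHom Y) _ _).symm
    refine Finset.sum_congr rfl fun c _ => ?_
    rw [ih]
    exact (LinearMap.lTensor_mul _ _ _).symm

end matrices

/-! ### The isomorphism and its compatibility with both actions -/

section comparison

variable {m l : ℕ} (n : ℕ) {V : Type*} [AddCommGroup V] [Module ℂ V] {U : Type*} [AddCommGroup U]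
  [Module ℂ U] (ρ : gl (Fin m) →ₗ⁅ℂ⁆ Module.End ℂ V) (σ : gl (Fin l) →ₗ⁅ℂ⁆ Module.End ℂ U)

/-- The canonical rearrangement of the tensor factors. -/
noncomputable def tensorGrass (m l n : ℕ) (V U : Type*) [AddCommGroup V] [Module ℂ V]
    [AddCommGroup U] [Module ℂ U] :
    ((V ⊗[ℂ] Grass (Fin m) n) ⊗[ℂ] (U ⊗[ℂ] Grass (Fin l) n)) ≃ₗ[ℂ]
      (V ⊗[ℂ] U) ⊗[ℂ] Grass (Fin m ⊕ Fin l) n :=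
  (TensorProduct.tensorTensorTensorComm ℂ V (Grass (Fin m) n) U (Grass (Fin l) n)).trans
    (TensorProduct.congr (LinearEquiv.refl ℂ _) (grassMul (Fin m) (Fin l) n))

theorem tensorGrass_tmul (v : V) (ω : Grass (Fin m) n) (u : U) (η : Grass (Fin l) n) :
    tensorGrass m l n V U ((v ⊗ₜ ω) ⊗ₜ (u ⊗ₜ η)) = (v ⊗ₜ u) ⊗ₜ grassMul _ _ n (ω ⊗ₜ η) := rfl

theorem tensor_four_ext {X Y Z W K : Type*} [AddCommGroup X] [Module ℂ X] [AddCommGroup Y]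
    [Module ℂ Y] [AddCommGroup Z] [Module ℂ Z] [AddCommGroup W] [Module ℂ W] [AddCommGroup K]
    [Module ℂ K] {f g : (X ⊗[ℂ] Y) ⊗[ℂ] (Z ⊗[ℂ] W) →ₗ[ℂ] K}
    (h : ∀ x y z w, f ((x ⊗ₜ y) ⊗ₜ (z ⊗ₜ w)) = g ((x ⊗ₜ y) ⊗ₜ (z ⊗ₜ w))) : f = g :=
  TensorProduct.ext (TensorProduct.ext' fun x y => TensorProduct.ext' fun z w => h x y z w)

theorem tensT_left_tensorGrass (s : ℕ) (i j : Fin n)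
    (t : (V ⊗[ℂ] Grass (Fin m) n) ⊗[ℂ] (U ⊗[ℂ] Grass (Fin l) n)) :
    tensT (Matrix.of fun a b => (repMat ρ a b).rTensor U) (fun a => gx (.inl a))
        (fun a => gd (.inl a)) s i j (tensorGrass m l n V U t)
      = tensorGrass m l n V U ((eT n ρ s i j).rTensor _ t) := by
  revert t
  refine LinearMap.congr_fun (f := _ ∘ₗ (tensorGrass m l n V U).toLinearMap)
    (g := (tensorGrass m l n V U).toLinearMap ∘ₗ _) (tensor_four_ext fun v ω u η => ?_)
  change tensT _ _ _ _ _ _ ((v ⊗ₜ u) ⊗ₜ grassMul _ _ n (ω ⊗ₜ η))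
    = tensorGrass m l n V U (eT n ρ s i j (v ⊗ₜ ω) ⊗ₜ (u ⊗ₜ η))
  rw [eT_eq_tensT]
  cases s with
  | zero =>
    rw [tensT_zero, tensT_zero]
    split_ifs
    · rfl
    · simp
  | succ s =>
    simp only [tensT_succ_tmul, rTensor_matPow, TensorProduct.sum_tmul, map_sum,
      tensorGrass_tmul, LinearMap.rTensor_tmul]
    refine Finset.sum_congr rfl fun a _ => Finset.sum_congr rfl fun b _ => congrArg _ ?_
    exact gx_gd_inl_grassMul a b i j (ω ⊗ₜ η)

/-- For z = -m, which is the pullback through τ_{-m}, the shifted matrix is the D - m found in the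
powers of the block matrix. -/
theorem shiftT_eT (z : ℂ) : shiftT (eT n σ) z = tensT (repMat σ + z • 1) gx gd := by
  rw [eT, shiftT_glT, tensT]
  congr 1
  ext a b : 1
  rw [Matrix.of_apply, Matrix.add_apply, Matrix.add_apply, LinearMap.rTensor_add]
  refine congrArg (fun f => (repMat σ a b).rTensor (Grass (Fin l) n) + f) ?_
  rw [Matrix.smul_apply, Matrix.smul_apply, LinearMap.rTensor_smul]
  congr 1
  by_cases h : a = b
  · rw [h, Matrix.one_apply_eq, Matrix.one_apply_eq]
    exact (LinearMap.rTensor_id _ _).symm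
  · rw [Matrix.one_apply_ne h, Matrix.one_apply_ne h]
    exact (LinearMap.rTensor_zero _).symm

theorem shiftMat_lTensor (Q : Matrix (Fin l) (Fin l) (Module.End ℂ U)) :
    shiftMat m (Matrix.of fun a b => (Q a b).lTensor V)
      = Matrix.of fun a b => (shiftMat m Q a b).lTensor V := by
  ext a b : 1
  refine TensorProduct.ext' fun v u => ?_
  rw [shiftMat_apply, Matrix.of_apply, Matrix.of_apply, LinearMap.lTensor_tmul,
    LinearMap.lTensor_tmul, shiftMat_apply, TensorProduct.tmul_sub]
  split_ifs <;> simp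

theorem tensT_right_tensorGrass (s : ℕ) (i j : Fin n)
    (t : (V ⊗[ℂ] Grass (Fin m) n) ⊗[ℂ] (U ⊗[ℂ] Grass (Fin l) n)) :
    tensT (shiftMat m (Matrix.of fun a b => (repMat σ a b).lTensor V)) (fun a => gx (.inr a))
        (fun a => gd (.inr a)) s i j (tensorGrass m l n V U t)
      = tensorGrass m l n V U ((shiftT (eT n σ) (-(m : ℂ)) s i j).lTensor _ t) := by
  revert t
  refine LinearMap.congr_fun (f := _ ∘ₗ (tensorGrass m l n V U).toLinearMap)
    (g := (tensorGrass m l n V U).toLinearMap ∘ₗ _) (tensor_four_ext fun v ω u η => ?_)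
  change tensT _ _ _ _ _ _ ((v ⊗ₜ u) ⊗ₜ grassMul _ _ n (ω ⊗ₜ η))
    = tensorGrass m l n V U ((v ⊗ₜ ω) ⊗ₜ shiftT (eT n σ) (-(m : ℂ)) s i j (u ⊗ₜ η))
  rw [shiftT_eT, shiftMat_lTensor]
  cases s with
  | zero =>
    rw [tensT_zero, tensT_zero]
    split_ifs
    · rfl
    · simp
  | succ s =>
    simp only [tensT_succ_tmul, lTensor_matPow, TensorProduct.tmul_sum, map_sum,
      tensorGrass_tmul, LinearMap.lTensor_tmul]
    refine Finset.sum_congr rfl fun a _ => Finset.sum_congr rfl fun b _ => congrArg _ ?_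
    exact gx_gd_inr_grassMul a b i j (ω ⊗ₜ η)

/-- The isomorphism of the tensor product with the space of coinvariants. -/
noncomputable def tensorCoinv :
    ((V ⊗[ℂ] Grass (Fin m) n) ⊗[ℂ] (U ⊗[ℂ] Grass (Fin l) n)) ≃ₗ[ℂ] BoxCoinv n ρ σ :=
  (tensorGrass m l n V U).trans (coinvVacEquiv n (outerRep ρ σ))

theorem boxRep_indVac (X : parab m l) (w : V ⊗[ℂ] U) :
    boxRep ρ σ X (indVac (parab m l) (parabRep ρ σ) w)
      = indVac (parab m l) (parabRep ρ σ) (outerRep ρ σ (leviProj m l X) w) :=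
  indRep_indVac _ _ _ _

/-- The hypotheses of `tensT_block` are checked for P_{ab} = E_{ba}. Because of the transposition
the upper right block of P belongs to 𝔮 and the lower left one to 𝔮'. -/
theorem boxCoinvYang_yT (s : ℕ) (i j : Fin n)
    (t : (V ⊗[ℂ] U) ⊗[ℂ] Grass (Fin m ⊕ Fin l) n) :
    boxCoinvYang n ρ σ (yT n (s + 1) i j) (coinvVacEquiv n (outerRep ρ σ) t)
      = coinvVacEquiv n (outerRep ρ σ)
        (convT (tensT (Matrix.of fun a b => (repMat ρ a b).rTensor U) (fun a => gx (.inl a))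
          (fun a => gd (.inl a)))
        (tensT (shiftMat m (Matrix.of fun a b => (repMat σ a b).lTensor V)) (fun a => gx (.inr a))
          (fun a => gd (.inr a))) (s + 1) i j t) := by
  have e : boxCoinvYang n ρ σ (yT n (s + 1) i j) (coinvVacEquiv n (outerRep ρ σ) t)
      = (lieSpan (eLie n (boxRep ρ σ)) (qAlg m l)).mkQ
        (eYang n (boxRep ρ σ) (yT n (s + 1) i j)
          ((indVac (parab m l) (parabRep ρ σ)).rTensor _ t)) := rfl
  rw [e, eYang, yLift_yT, eT_eq_tensT]
  refine tensT_block (fun a b w => ?_) (fun a b w => ?_) (fun b a w => ?_)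
    (repMat_comm (boxRep ρ σ)) (fun e c x ω => ?_) s i j t
  · have hX : (Matrix.single (.inl b) (.inl a) 1 : gl (Fin m ⊕ Fin l)) ∈ parab m l := by
      change Matrix.toBlocks₂₁ _ = 0
      ext
      simp [Matrix.toBlocks₂₁]
    refine (boxRep_indVac ρ σ ⟨_, hX⟩ w).trans (congrArg _ ?_)
    have h : leviProj m l ⟨_, hX⟩ = (Matrix.single b a 1, 0) := by
      refine Prod.ext ?_ ?_
      · ext
        simp [leviProj, Matrix.toBlocks₁₁, Matrix.single_apply]
      · ext
        simp [leviProj, Matrix.toBlocks₂₂]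
    rw [h]
    simp [outerRep, tensorRep, repMat]
  · have hX : (Matrix.single (.inr b) (.inr a) 1 : gl (Fin m ⊕ Fin l)) ∈ parab m l := by
      change Matrix.toBlocks₂₁ _ = 0
      ext
      simp [Matrix.toBlocks₂₁]
    refine (boxRep_indVac ρ σ ⟨_, hX⟩ w).trans (congrArg _ ?_)
    have h : leviProj m l ⟨_, hX⟩ = (0, Matrix.single b a 1) := by
      refine Prod.ext ?_ ?_
      · ext
        simp [leviProj, Matrix.toBlocks₁₁]
      · ext
        simp [leviProj, Matrix.toBlocks₂₂, Matrix.single_apply]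
    rw [h]
    simp [outerRep, tensorRep, repMat]
  · have hX : (Matrix.single (.inl a) (.inr b) 1 : gl (Fin m ⊕ Fin l)) ∈ parab m l := by
      change Matrix.toBlocks₂₁ _ = 0
      ext
      simp [Matrix.toBlocks₂₁]
    refine (boxRep_indVac ρ σ ⟨_, hX⟩ w).trans ?_
    have h : leviProj m l ⟨_, hX⟩ = 0 := by
      refine Prod.ext ?_ ?_
      · ext
        simp [leviProj, Matrix.toBlocks₁₁]
      · ext
        simp [leviProj, Matrix.toBlocks₂₂]
    rw [h, map_zero, LinearMap.zero_apply, map_zero]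
  -- The vanishing of 𝔮 · W in the coinvariants transfers E_{ce} to Λ with the opposite sign.
  · have h := mkQ_eLie (eLie n (boxRep ρ σ)) (qAlg m l) (single_mem_qAlg c e) (x ⊗ₜ ω)
    rw [eLie_tmul, map_add, grassRep_single] at h
    exact eq_neg_of_add_eq_zero_left h

theorem convT_tensorGrass (s : ℕ) (i j : Fin n)
    (t : (V ⊗[ℂ] Grass (Fin m) n) ⊗[ℂ] (U ⊗[ℂ] Grass (Fin l) n)) :
    convT (tensT (Matrix.of fun a b => (repMat ρ a b).rTensor U) (fun a => gx (.inl a))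
          (fun a => gd (.inl a)))
        (tensT (shiftMat m (Matrix.of fun a b => (repMat σ a b).lTensor V)) (fun a => gx (.inr a))
          (fun a => gd (.inr a))) s i j (tensorGrass m l n V U t)
      = tensorGrass m l n V U (yTensor (eYang n ρ) (eYangShift n (m : ℂ) σ) (yT n s i j) t) := by
  have h₁ : ∀ s i j, eYang n ρ (yT n s i j) = eT n ρ s i j := fun s i j => yLift_yT _ s i j
  have h₂ : ∀ s i j, eYangShift n (m : ℂ) σ (yT n s i j) = shiftT (eT n σ) (-(m : ℂ)) s i j :=
    fun s i j => by
      rw [eYangShift, AlgHom.comp_apply, yShift, yLift_yT, map_shiftT]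
      simp only [eYang, yLift_yT]
  rw [yTensor_yT]
  simp only [convT, LinearMap.sum_apply, Module.End.mul_apply, tensT_left_tensorGrass,
    tensT_right_tensorGrass, map_sum, h₁, h₂]

theorem tensorCoinv_yang (y : Yangian n)
    (t : (V ⊗[ℂ] Grass (Fin m) n) ⊗[ℂ] (U ⊗[ℂ] Grass (Fin l) n)) :
    boxCoinvYang n ρ σ y (tensorCoinv n ρ σ t)
      = tensorCoinv n ρ σ (yTensor (eYang n ρ) (eYangShift n (m : ℂ) σ) y t) := by
  -- Conjugation by the isomorphism turns the other action into an algebra homomorphism with the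
  -- same target, so that it is enough to compare generators.
  have h : boxCoinvYang n ρ σ = ((tensorCoinv n ρ σ).conjAlgEquiv ℂ).toAlgHom.comp
      (yTensor (eYang n ρ) (eYangShift n (m : ℂ) σ)) := by
    refine yHom_ext fun s i j => LinearMap.ext fun w => ?_
    obtain ⟨t, rfl⟩ := (tensorCoinv n ρ σ).surjective w
    change _ = tensorCoinv n ρ σ (yTensor (eYang n ρ) (eYangShift n (m : ℂ) σ) (yT n (s + 1) i j)
      ((tensorCoinv n ρ σ).symm (tensorCoinv n ρ σ t)))
    rw [LinearEquiv.symm_apply_apply]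
    exact (boxCoinvYang_yT n ρ σ s i j _).trans
      (congrArg (coinvVacEquiv n (outerRep ρ σ)) (convT_tensorGrass n ρ σ (s + 1) i j t))
  rw [h]
  change tensorCoinv n ρ σ (yTensor (eYang n ρ) (eYangShift n (m : ℂ) σ) y
      ((tensorCoinv n ρ σ).symm (tensorCoinv n ρ σ t))) = _
  rw [LinearEquiv.symm_apply_apply]

/-- A block diagonal matrix involves only the even operators x ∂ within one block, each acting on
its own factor. -/
theorem grassRep_levi (Z : gl (Fin m) × gl (Fin l)) (ω : Grass (Fin m) n) (η : Grass (Fin l) n) :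
    grassRep _ n (levi m l Z) (grassMul _ _ n (ω ⊗ₜ η))
      = grassMul _ _ n (grassRep _ n Z.1 ω ⊗ₜ η) + grassMul _ _ n (ω ⊗ₜ grassRep _ n Z.2 η) := by
  have h₁ : ∀ (a b : Fin m) (k : Fin n),
      gx (Sum.inl a) k (gd (Sum.inl b) k (grassMul (Fin m) (Fin l) n (ω ⊗ₜ η)))
      = grassMul _ _ n (gx a k (gd b k ω) ⊗ₜ η) := fun a b k => gx_gd_inl_grassMul a b k k _
  have h₂ : ∀ (a b : Fin l) (k : Fin n),
      gx (Sum.inr a) k (gd (Sum.inr b) k (grassMul (Fin m) (Fin l) n (ω ⊗ₜ η)))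
      = grassMul _ _ n (ω ⊗ₜ gx a k (gd b k η)) := fun a b k => gx_gd_inr_grassMul a b k k _
  have e : levi m l Z = Matrix.fromBlocks Z.1 0 0 Z.2 := rfl
  simp only [grassRep_apply, e, Fintype.sum_sum_type, Matrix.fromBlocks_apply₁₁,
    Matrix.fromBlocks_apply₁₂, Matrix.fromBlocks_apply₂₁, Matrix.fromBlocks_apply₂₂, h₁, h₂,
    Matrix.zero_apply, zero_smul, Finset.sum_const_zero, add_zero, zero_add,
    TensorProduct.sum_tmul, TensorProduct.tmul_sum, map_sum, ← TensorProduct.smul_tmul',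
    TensorProduct.tmul_smul, map_smul]

/-- The Levi subalgebra lies in 𝔭 and preserves 1 ⊗ N, so the two actions agree on representatives,
before passing to the quotient. -/
theorem tensorCoinv_lie (Z : gl (Fin m) × gl (Fin l))
    (t : (V ⊗[ℂ] Grass (Fin m) n) ⊗[ℂ] (U ⊗[ℂ] Grass (Fin l) n)) :
    boxCoinvLie n ρ σ Z (tensorCoinv n ρ σ t)
      = tensorCoinv n ρ σ (outerRep (eLie n ρ) (eLie n σ) Z t) := by
  revert t
  refine LinearMap.congr_fun (f := boxCoinvLie n ρ σ Z ∘ₗ (tensorCoinv n ρ σ).toLinearMap)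
    (g := (tensorCoinv n ρ σ).toLinearMap ∘ₗ outerRep (eLie n ρ) (eLie n σ) Z)
    (tensor_four_ext fun v ω u η => ?_)
  have e₁ : eLie n (boxRep ρ σ) (levi m l Z)
      (indVac (parab m l) (parabRep ρ σ) (v ⊗ₜ u) ⊗ₜ grassMul _ _ n (ω ⊗ₜ η))
      = (indVac (parab m l) (parabRep ρ σ)).rTensor _ (tensorGrass m l n V U
        (outerRep (eLie n ρ) (eLie n σ) Z ((v ⊗ₜ ω) ⊗ₜ (u ⊗ₜ η)))) := by
    have h : boxRep ρ σ (levi m l Z) (indVac (parab m l) (parabRep ρ σ) (v ⊗ₜ u))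
        = indVac (parab m l) (parabRep ρ σ) (outerRep ρ σ Z (v ⊗ₜ u)) :=
      boxRep_indVac ρ σ ⟨levi m l Z, levi_mem_parab Z⟩ (v ⊗ₜ u)
    have o₁ : outerRep ρ σ Z (v ⊗ₜ u) = ρ Z.1 v ⊗ₜ u + v ⊗ₜ σ Z.2 u := rfl
    have o₂ : outerRep (eLie n ρ) (eLie n σ) Z ((v ⊗ₜ ω) ⊗ₜ (u ⊗ₜ η))
        = (ρ Z.1 v ⊗ₜ ω + v ⊗ₜ grassRep _ n Z.1 ω) ⊗ₜ (u ⊗ₜ η)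
          + (v ⊗ₜ ω) ⊗ₜ (σ Z.2 u ⊗ₜ η + u ⊗ₜ grassRep _ n Z.2 η) := rfl
    rw [eLie_tmul, h, grassRep_levi, o₁, o₂]
    simp only [map_add, TensorProduct.add_tmul, TensorProduct.tmul_add, tensorGrass_tmul,
      LinearMap.rTensor_tmul]
    abel
  exact congrArg (lieSpan (eLie n (boxRep ρ σ)) (qAlg m l)).mkQ e₁

end comparison

end YangInd

theorem theorem2p1 (m l n : ℕ)
    {V : Type*} [AddCommGroup V] [Module ℂ V] (ρ : YangInd.gl (Fin m) →ₗ⁅ℂ⁆ Module.End ℂ V)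
    {U : Type*} [AddCommGroup U] [Module ℂ U] (σ : YangInd.gl (Fin l) →ₗ⁅ℂ⁆ Module.End ℂ U) :
    ∃ e : YangInd.BoxCoinv n ρ σ ≃ₗ[ℂ]
        (V ⊗[ℂ] YangInd.Grass (Fin m) n) ⊗[ℂ] (U ⊗[ℂ] YangInd.Grass (Fin l) n),
      (∀ (y : YangInd.Yangian n) (w : YangInd.BoxCoinv n ρ σ),
        e (YangInd.boxCoinvYang n ρ σ y w)
          = YangInd.yTensor (YangInd.eYang n ρ) (YangInd.eYangShift n (m : ℂ) σ) y (e w)) ∧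
      (∀ (Z : YangInd.gl (Fin m) × YangInd.gl (Fin l)) (w : YangInd.BoxCoinv n ρ σ),
        e (YangInd.boxCoinvLie n ρ σ Z w)
          = YangInd.outerRep (YangInd.eLie n ρ) (YangInd.eLie n σ) Z (e w)) := by
  refine ⟨(YangInd.tensorCoinv n ρ σ).symm, fun y w => ?_, fun Z w => ?_⟩
  · obtain ⟨t, rfl⟩ := (YangInd.tensorCoinv n ρ σ).surjective w
    rw [YangInd.tensorCoinv_yang, LinearEquiv.symm_apply_apply, LinearEquiv.symm_apply_apply]
  · obtain ⟨t, rfl⟩ := (YangInd.tensorCoinv n ρ σ).surjective w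
    rw [YangInd.tensorCoinv_lie, LinearEquiv.symm_apply_apply, LinearEquiv.symm_apply_apply]
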